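/- Let $U_3=\langle s_1,s_2,s_3\mid s_1^2=s_2^2=s_3^2=1\rangle$ be the universal Coxeter group of rank $3$. Let $V=\mathbb R^3$ have basis $\alpha_1,\alpha_2,\alpha_3$ and let $\langle\cdot,\cdot\rangle$ be the bilinear form on $V$ with $\langle\alpha_i,\alpha_i\rangle=1$ and $\langle\alpha_i,\alpha_j\rangle=-1$ for $i\ne j$. Let $U_3$ act linearly on $V$ by $s_i\cdot x=x-2\langle\alpha_i,x\rangle\alpha_i$. Let $\Phi=\{w\cdot\alpha_i : w\in U_3,\ 1\le i\le 3\}$ be the root system, and let $\Phi^+$ be the set of positive roots, that is, the roots which are nonnegative linear combinations of $\alpha_1,\alpha_2,\alpha_3$. A set $R\subseteq\Phi^+$ is closed if for all $\alpha,\beta\in R$ every positive root of the form $a\alpha+b\beta$ with real $a,b\ge 0$ belongs to $R$; it is biclosed if both $R$ and $\Phi^+\setminus R$ are closed. The extended weak order of $U_3$ is the set of biclosed subsets of $\Phi^+$, partially ordered by inclusion. The 2-closure of a set $X\subseteq\Phi^+$ is the smallest closed subset of $\Phi^+$ that contains $X$. Theorem B. Let $\{R_i\}_{i\in I}$ be any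 family of biclosed subsets of $\Phi^+$. Then the join (least upper bound) of $\{R_i\}_{i\in I}$ in the extended weak order exists and is equal to the 2-closure of $\bigcup_{i\in I}R_i$. In particular, this 2-closure is biclosed. -/

import Mathlib

open scoped NNReal

noncomputable section

namespace UniversalCoxeter

/-- The relators `s_i ^ 2`, for `i = 1, 2, 3`, in the free group on three letters. -/
def relators : Set (FreeGroup (Fin 3)) :=
  Set.range fun i : Fin 3 => FreeGroup.of i ^ 2

/-- The universal Coxeter group of rank three, `⟨s₁, s₂, s₃ ∣ s₁² = s₂² = s₃² = 1⟩`. -/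
abbrev U3 : Type := PresentedGroup relators

/-- The space `V = ℝ³`, in the coordinates given by the basis of simple roots. -/
abbrev V : Type := Fin 3 → ℝ

/-- The simple root `α_i`. -/
def simpleRoot (i : Fin 3) : V := Pi.single i 1

/-- The bilinear form on `V` with `⟨α_i, α_i⟩ = 1` and `⟨α_i, α_j⟩ = -1` for `i ≠ j`. -/
def form : LinearMap.BilinForm ℝ V :=
  Matrix.toBilin' (Matrix.of fun i j : Fin 3 => if i = j then (1 : ℝ) else -1)

theorem form_simpleRoot (i j : Fin 3) :
    form (simpleRoot i) (simpleRoot j) = if i = j then 1 else -1 := by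
  simp [form, simpleRoot]

theorem two_form_simpleRoot_self (i : Fin 3) :
    ((2 : ℝ) • form (simpleRoot i)) (simpleRoot i) = 2 := by
  simp [form_simpleRoot]

/-- The reflection `x ↦ x - 2 ⟨α_i, x⟩ α_i` in the simple root `α_i`. -/
def simpleReflection (i : Fin 3) : V ≃ₗ[ℝ] V :=
  Module.reflection (two_form_simpleRoot_self i)

theorem simpleReflection_apply (i : Fin 3) (x : V) :
    simpleReflection i x = x - (2 * form (simpleRoot i) x) • simpleRoot i := by
  simp [simpleReflection, Module.reflection_apply]

theorem simpleReflection_relators :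
    ∀ r ∈ relators, FreeGroup.lift simpleReflection r = 1 := by
  rintro _ ⟨i, rfl⟩
  ext1 x
  simp only [pow_two]
  exact Module.involutive_reflection (two_form_simpleRoot_self i) x

/-- The standard reflection representation of `U3` on `V`, in which the generator `s_i` acts by
the reflection in `α_i`. -/
def rep : U3 →* (V ≃ₗ[ℝ] V) :=
  PresentedGroup.toGroup simpleReflection_relators

theorem rep_of (i : Fin 3) : rep (PresentedGroup.of i) = simpleReflection i :=
  PresentedGroup.toGroup.of simpleReflection_relators

/-- The root system `Φ`: all vectors `w · α_i` with `w` in `U3`. -/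
def roots : Set V := {β | ∃ (w : U3) (i : Fin 3), β = rep w (simpleRoot i)}

/-- The nonnegative span of a set of vectors. -/
def nonnegSpan (X : Set V) : Set V := Submodule.span ℝ≥0 X

/-- The set `Φ⁺` of positive roots: the roots in the nonnegative span of the simple roots. -/
def posRoots : Set V := roots ∩ nonnegSpan (Set.range simpleRoot)

/-- A closed set of positive roots: with any two of its members `α`, `β` it contains every positive
root in the nonnegative span of `α` and `β`. -/
def IsClosedRoots (R : Set V) : Prop :=
  R ⊆ posRoots ∧ ∀ α ∈ R, ∀ β ∈ R, nonnegSpan {α, β} ∩ posRoots ⊆ R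

/-- A biclosed set of positive roots: it and its complement in `Φ⁺` are closed. -/
def IsBiclosed (R : Set V) : Prop :=
  IsClosedRoots R ∧ IsClosedRoots (posRoots \ R)

/-- The extended weak order of `U3`: the biclosed sets of positive roots, ordered by inclusion
(the order of the subtype). -/
abbrev ExtendedWeakOrder : Type := {R : Set V // IsBiclosed R}

/-- `C` is the 2-closure of `X`: the smallest closed set of positive roots that contains `X`. -/
def IsTwoClosure (X C : Set V) : Prop :=
  IsLeast {D : Set V | IsClosedRoots D ∧ X ⊆ D} C

end UniversalCoxeter

end

noncomputable section

namespace UniversalCoxeter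

/-! ### Cones of nonnegative combinations -/

section Cone

variable {S T : Set V} {x y : V}

/-! Closedness only looks at planes, while the cone of a set looks at all of `V`; the theorem holds
because for joins of biclosed sets the two notions agree. The join of biclosed `A` and `B` is the
set of positive roots in the cone of `A ∪ B` (`IsBiclosed.isTwoClosure_union`). Finite joins follow
by induction, and an arbitrary join is the directed union of the finite ones.

The geometry is Lorentzian. Products of roots are odd integers, so never strictly between -1 and 1.
A vector of nonpositive norm has coordinates of one sign, and the group preserves the positive light
cone; hence distinct roots with product at least 1 differ by a vector of that cone, up to sign. Each
positive root has product at least 1 with exactly one simple root, which names its branch, and roots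
in different branches have negative product.

Pointedness: a biclosed set together with the negatives of its complement is a half system, and half
systems span pointed cones (`HalfSystem.free`), so the cones of `A` and of its complement meet only
in zero. The proof is by induction on the word of a `layer`; one letter moves the old layer by a
reflection and adds at most one fan. A forbidden relation then reduces to `η + c α_i + l a = m b`
with `a` in the half system and `b` outside. Pairing with `b` forces `form a b ≥ 1`, and replacing
`b` by its reflection in `a` yields either a relation in the layer of a shorter word or a product of
the wrong sign.

Coclosedness: suppose a root of the cone of `A ∪ B` is a nonnegative combination of two positive
roots outside it. Writing it as `p + q` with `p`, `q` in the two cones gives a plane with outside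
roots on both closed sides. Pointedness for `A` and `B`, and extremality of the simple roots,
exclude this (`no_opposite_sides`).

Minimality: a closed `C` containing `A ∪ B` contains every positive root of the cone
(`act_mem_closed_aux`). Write the root as `w f` with `f` on a fan and induct on the length of `w`.
If `w f` were missing, the ray from it towards a simple root of the moved fan outside the cone would
meet the cone in a point of negative product with `w f` (`exists_form_neg`). Either this is
impossible outright, or the cone reaches far enough into the fan to contain a root of `C` which,
with the other simple root, generates `w f` (`mem_of_mixed`). -/

theorem subset_nonnegSpan : S ⊆ nonnegSpan S := Submodule.subset_span

theorem nonnegSpan_mono (h : S ⊆ T) : nonnegSpan S ⊆ nonnegSpan T := Submodule.span_mono h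

theorem zero_mem_nonnegSpan : (0 : V) ∈ nonnegSpan S :=
  (Submodule.span ℝ≥0 S).zero_mem

theorem add_mem_nonnegSpan (hx : x ∈ nonnegSpan S) (hy : y ∈ nonnegSpan S) :
    x + y ∈ nonnegSpan S :=
  (Submodule.span ℝ≥0 S).add_mem hx hy

theorem smul_mem_nonnegSpan {c : ℝ} (hc : 0 ≤ c) (hx : x ∈ nonnegSpan S) :
    c • x ∈ nonnegSpan S :=
  (Submodule.span ℝ≥0 S).smul_mem (⟨c, hc⟩ : ℝ≥0) hx

theorem nonnegSpan_induction {p : V → Prop} (mem : ∀ x ∈ S, p x) (zero : p 0)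
    (add : ∀ x y, x ∈ nonnegSpan S → y ∈ nonnegSpan S → p x → p y → p (x + y))
    (smul : ∀ (c : ℝ) x, 0 ≤ c → x ∈ nonnegSpan S → p x → p (c • x)) (hx : x ∈ nonnegSpan S) :
    p x := by
  refine Submodule.span_induction (p := fun x _ => p x) mem zero ?_ ?_ hx
  · intro x y hx hy
    exact add x y hx hy
  · intro c x hx hp
    exact smul c x c.2 hx hp

theorem nonnegSpan_subset (h : S ⊆ nonnegSpan T) : nonnegSpan S ⊆ nonnegSpan T :=
  fun _ hx => Submodule.span_le.2 h hx

theorem exists_add_of_mem_nonnegSpan_union (hx : x ∈ nonnegSpan (S ∪ T)) :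
    ∃ p ∈ nonnegSpan S, ∃ q ∈ nonnegSpan T, p + q = x := by
  unfold nonnegSpan at hx
  rw [Submodule.span_union] at hx
  exact Submodule.mem_sup.1 hx

theorem nonneg_of_mem_nonnegSpan {h : V →ₗ[ℝ] ℝ} (hS : ∀ s ∈ S, 0 ≤ h s)
    (hx : x ∈ nonnegSpan S) : 0 ≤ h x := by
  refine nonnegSpan_induction (p := fun x => 0 ≤ h x) hS (by simp) ?_ ?_ hx
  · intro x y _ _ hx hy
    rw [map_add]
    positivity
  · intro c x hc _ hx
    rw [map_smul]
    exact mul_nonneg hc hx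

theorem map_mem_nonnegSpan (f : V →ₗ[ℝ] V) (hS : ∀ s ∈ S, f s ∈ nonnegSpan T)
    (hx : x ∈ nonnegSpan S) : f x ∈ nonnegSpan T := by
  refine nonnegSpan_induction (p := fun x => f x ∈ nonnegSpan T) hS
    (by simpa using zero_mem_nonnegSpan) ?_ ?_ hx
  · intro x y _ _ hx hy
    rw [map_add]
    exact add_mem_nonnegSpan hx hy
  · intro c x hc _ hx
    rw [map_smul]
    exact smul_mem_nonnegSpan hc hx

theorem mem_nonnegSpan_pair {a b : V} :
    x ∈ nonnegSpan {a, b} ↔ ∃ s t : ℝ, 0 ≤ s ∧ 0 ≤ t ∧ x = s • a + t • b := by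
  constructor
  · intro hx
    obtain ⟨s, t, h⟩ := Submodule.mem_span_pair.1 hx
    exact ⟨s, t, s.2, t.2, h.symm⟩
  · rintro ⟨s, t, hs, ht, rfl⟩
    exact add_mem_nonnegSpan (smul_mem_nonnegSpan hs (subset_nonnegSpan (by simp)))
      (smul_mem_nonnegSpan ht (subset_nonnegSpan (by simp)))

theorem comb_mem_nonnegSpan {a b : V} {s t : ℝ} (ha : a ∈ nonnegSpan S) (hb : b ∈ nonnegSpan S)
    (hs : 0 ≤ s) (ht : 0 ≤ t) : s • a + t • b ∈ nonnegSpan S :=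
  add_mem_nonnegSpan (smul_mem_nonnegSpan hs ha) (smul_mem_nonnegSpan ht hb)

end Cone

/-! ### Coordinates, the form and the simple reflections -/

/-- The indices `i`, `j`, `k` are the three elements of `Fin 3`, in some order. -/
structure Triple (i j k : Fin 3) : Prop where
  ij : i ≠ j
  ik : i ≠ k
  jk : j ≠ k

namespace Triple

theorem swap {i j k : Fin 3} (d : Triple i j k) : Triple j i k := ⟨d.ij.symm, d.jk, d.ik⟩

theorem rotate {i j k : Fin 3} (d : Triple i j k) : Triple j k i := ⟨d.jk, d.ij.symm, d.ik.symm⟩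

theorem eq_or {i j k : Fin 3} (d : Triple i j k) (l : Fin 3) : l = i ∨ l = j ∨ l = k := by
  obtain ⟨h1, h2, h3⟩ := d
  revert i j k l; decide

theorem exists_last (k : Fin 3) : ∃ i j : Fin 3, Triple i j k := by
  have : ∀ k : Fin 3, ∃ i j : Fin 3, i ≠ j ∧ i ≠ k ∧ j ≠ k := by decide
  obtain ⟨i, j, h1, h2, h3⟩ := this k
  exact ⟨i, j, h1, h2, h3⟩

theorem exists_of_ne {i j : Fin 3} (h : i ≠ j) : ∃ k : Fin 3, Triple i j k := by
  have : ∀ i j : Fin 3, i ≠ j → ∃ k : Fin 3, i ≠ j ∧ i ≠ k ∧ j ≠ k := by decide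
  obtain ⟨k, h1, h2, h3⟩ := this i j h
  exact ⟨k, h1, h2, h3⟩

theorem ext {i j k : Fin 3} (d : Triple i j k) {x y : V} (h1 : x i = y i) (h2 : x j = y j)
    (h3 : x k = y k) : x = y := by
  funext l
  rcases d.eq_or l with rfl | rfl | rfl <;> assumption

theorem sum_eq {i j k : Fin 3} (d : Triple i j k) (f : Fin 3 → ℝ) :
    ∑ l, f l = f i + f j + f k := by
  have : (Finset.univ : Finset (Fin 3)) = {i, j, k} := by
    ext l
    simpa using d.eq_or l
  rw [this, Finset.sum_insert (by simp [d.ij, d.ik]), Finset.sum_insert (by simp [d.jk]),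
    Finset.sum_singleton, add_assoc]

theorem form_eq {i j k : Fin 3} (d : Triple i j k) (x y : V) :
    form x y = 2 * (x i * y i + x j * y j + x k * y k) - (x i + x j + x k) * (y i + y j + y k) := by
  have : form x y = 2 * ∑ l, x l * y l - (∑ l, x l) * ∑ l, y l := by
    rw [form, Matrix.toBilin'_apply]
    simp only [Fin.sum_univ_three, Matrix.of_apply]
    simp
    ring
  rw [this]
  simp only [d.sum_eq]

end Triple

theorem triple_zero : Triple 0 1 2 := ⟨by decide, by decide, by decide⟩

theorem form_comm (x y : V) : form x y = form y x := by
  rw [triple_zero.form_eq, triple_zero.form_eq]; ring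

@[simp] theorem simpleRoot_same (i : Fin 3) : simpleRoot i i = 1 := by simp [simpleRoot]

theorem simpleRoot_ne {i l : Fin 3} (h : l ≠ i) : simpleRoot i l = 0 := by simp [simpleRoot, h]

theorem simpleRoot_nonneg (i : Fin 3) : 0 ≤ simpleRoot i := by
  rw [simpleRoot, Pi.single_nonneg]; norm_num

theorem Triple.eq_sum {i j k : Fin 3} (d : Triple i j k) (x : V) :
    x = x i • simpleRoot i + x j • simpleRoot j + x k • simpleRoot k := by
  apply d.ext <;>
    simp [simpleRoot_ne d.ij, simpleRoot_ne d.ik, simpleRoot_ne d.jk, simpleRoot_ne d.ij.symm,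
      simpleRoot_ne d.ik.symm, simpleRoot_ne d.jk.symm]

theorem Triple.form_simpleRoot_left {i j k : Fin 3} (d : Triple i j k) (x : V) :
    form (simpleRoot k) x = x k - x i - x j := by
  rw [d.form_eq, simpleRoot_same, simpleRoot_ne d.ik, simpleRoot_ne d.jk]; ring

theorem simpleReflection_ne {l k : Fin 3} (h : l ≠ k) (x : V) : simpleReflection k x l = x l := by
  simp [simpleReflection_apply, simpleRoot_ne h]

theorem Triple.simpleReflection_same {i j k : Fin 3} (d : Triple i j k) (x : V) :
    simpleReflection k x k = 2 * x i + 2 * x j - x k := by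
  simp [simpleReflection_apply, d.form_simpleRoot_left]; ring

theorem form_simpleReflection (k : Fin 3) (x y : V) :
    form (simpleReflection k x) (simpleReflection k y) = form x y := by
  obtain ⟨i, j, d⟩ := Triple.exists_last k
  rw [d.form_eq, d.form_eq, d.simpleReflection_same, d.simpleReflection_same,
    simpleReflection_ne d.ik, simpleReflection_ne d.ik, simpleReflection_ne d.jk,
    simpleReflection_ne d.jk]
  ring

@[simp] theorem simpleReflection_simpleReflection (k : Fin 3) (x : V) :
    simpleReflection k (simpleReflection k x) = x := by
  obtain ⟨i, j, d⟩ := Triple.exists_last k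
  apply d.ext
  · rw [simpleReflection_ne d.ik, simpleReflection_ne d.ik]
  · rw [simpleReflection_ne d.jk, simpleReflection_ne d.jk]
  · rw [d.simpleReflection_same, simpleReflection_ne d.ik, simpleReflection_ne d.jk,
      d.simpleReflection_same]
    ring

/-! ### Words acting on `V`, and the arithmetic of roots -/

/-- The transformation of `V` given by a word in the generators. -/
def act (L : List (Fin 3)) : V ≃ₗ[ℝ] V := (L.map simpleReflection).prod

@[simp] theorem act_nil (x : V) : act [] x = x := rfl

@[simp] theorem act_cons (j : Fin 3) (L : List (Fin 3)) (x : V) :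
    act (j :: L) x = simpleReflection j (act L x) := by
  simp [act]

theorem act_append (L M : List (Fin 3)) (x : V) : act (L ++ M) x = act L (act M x) := by
  simp [act]

@[simp] theorem act_act_reverse (L : List (Fin 3)) (x : V) : act L (act L.reverse x) = x := by
  induction L generalizing x with
  | nil => rfl
  | cons j L ih => simp [act_append, ih]

@[simp] theorem act_reverse_act (L : List (Fin 3)) (x : V) : act L.reverse (act L x) = x := by
  simpa using act_act_reverse L.reverse x

@[simp] theorem form_act (L : List (Fin 3)) (x y : V) : form (act L x) (act L y) = form x y := by
  induction L with
  | nil => rfl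
  | cons j L ih => simp [form_simpleReflection, ih]

theorem mem_roots {r : V} : r ∈ roots ↔ ∃ L i, r = act L (simpleRoot i) := by
  have hrep : ∀ w : U3, ∃ L, rep w = act L := by
    intro w
    induction w using PresentedGroup.induction_on with
    | _ z =>
      induction z using FreeGroup.induction_on with
      | C1 => exact ⟨[], by simp [act]⟩
      | of i => exact ⟨[i], (rep_of i).trans (by simp [act])⟩
      | inv_of i _ =>
        refine ⟨[i], ?_⟩
        rw [map_inv, map_inv]
        refine (congrArg _ (rep_of i)).trans ?_
        ext1 x
        rw [act_cons, act_nil]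
        change (simpleReflection i).symm x = _
        rw [LinearEquiv.symm_apply_eq, simpleReflection_simpleReflection]
      | mul x y hx hy =>
        obtain ⟨L, hL⟩ := hx
        obtain ⟨M, hM⟩ := hy
        exact ⟨L ++ M, by rw [map_mul, map_mul, hL, hM]; simp [act]⟩
  have hact : ∀ L, ∃ w : U3, rep w = act L := by
    intro L
    induction L with
    | nil => exact ⟨1, by simp [act]⟩
    | cons j L ih =>
      obtain ⟨w, hw⟩ := ih
      exact ⟨PresentedGroup.of j * w, by rw [map_mul, hw, rep_of]; simp [act]⟩
  constructor
  · rintro ⟨w, i, rfl⟩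
    obtain ⟨L, hL⟩ := hrep w
    exact ⟨L, i, by rw [hL]⟩
  · rintro ⟨L, i, rfl⟩
    obtain ⟨w, hw⟩ := hact L
    exact ⟨w, i, by rw [hw]⟩

theorem simpleRoot_mem_roots (i : Fin 3) : simpleRoot i ∈ roots := mem_roots.2 ⟨[], i, rfl⟩

theorem act_mem_roots {r : V} (L : List (Fin 3)) (h : r ∈ roots) : act L r ∈ roots := by
  obtain ⟨M, i, rfl⟩ := mem_roots.1 h
  exact mem_roots.2 ⟨L ++ M, i, by rw [act_append]⟩

theorem simpleReflection_mem_roots {r : V} (j : Fin 3) (h : r ∈ roots) :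
    simpleReflection j r ∈ roots := by
  simpa using act_mem_roots [j] h

theorem simpleReflection_self (k : Fin 3) : simpleReflection k (simpleRoot k) = -simpleRoot k := by
  rw [simpleReflection_apply, form_simpleRoot, if_pos rfl]
  module

theorem neg_mem_roots {r : V} (h : r ∈ roots) : -r ∈ roots := by
  obtain ⟨M, i, rfl⟩ := mem_roots.1 h
  exact mem_roots.2 ⟨M ++ [i], i, by rw [act_append]; simp [simpleReflection_self]⟩

theorem form_self_of_mem_roots {r : V} (h : r ∈ roots) : form r r = 1 := by
  obtain ⟨M, i, rfl⟩ := mem_roots.1 h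
  simp [form_simpleRoot]

theorem exists_int_of_mem_roots {r : V} (h : r ∈ roots) : ∃ m : Fin 3 → ℤ, ∀ l, r l = m l := by
  obtain ⟨M, n, rfl⟩ := mem_roots.1 h
  induction M with
  | nil =>
    refine ⟨Pi.single n 1, fun l => ?_⟩
    by_cases hl : l = n
    · subst hl; simp
    · simp [hl, simpleRoot_ne hl]
  | cons k M ih =>
    obtain ⟨m, hm⟩ := ih (act_mem_roots _ (simpleRoot_mem_roots n))
    obtain ⟨i, j, d⟩ := Triple.exists_last k
    refine ⟨Function.update m k (2 * m i + 2 * m j - m k), fun l => ?_⟩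
    by_cases hl : l = k
    · subst hl
      simp [d.simpleReflection_same, hm]
    · simp [simpleReflection_ne hl, hl, hm]

/-- Modulo 2 the form is minus the product of the coordinate sums, and norm 1 makes the coordinate
sum of a root odd. -/
theorem exists_odd_form {r r' : V} (h : r ∈ roots) (h' : r' ∈ roots) :
    ∃ n : ℤ, Odd n ∧ form r r' = n := by
  obtain ⟨m, hm⟩ := exists_int_of_mem_roots h
  obtain ⟨m', hm'⟩ := exists_int_of_mem_roots h'
  have odd_sum : ∀ (r : V) (m : Fin 3 → ℤ), (∀ l, r l = m l) → form r r = 1 →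
      Odd (m 0 + m 1 + m 2) := by
    intro r m hm hr
    rw [triple_zero.form_eq, hm, hm, hm] at hr
    have hz : 2 * (m 0 * m 0 + m 1 * m 1 + m 2 * m 2) -
      (m 0 + m 1 + m 2) * (m 0 + m 1 + m 2) = 1 := by exact_mod_cast hr
    have : Odd ((m 0 + m 1 + m 2) * (m 0 + m 1 + m 2)) :=
      ⟨(m 0 * m 0 + m 1 * m 1 + m 2 * m 2) - 1, by linarith⟩
    exact (Int.odd_mul.1 this).1
  have h1 := odd_sum r m hm (form_self_of_mem_roots h)
  have h2 := odd_sum r' m' hm' (form_self_of_mem_roots h')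
  refine ⟨2 * (m 0 * m' 0 + m 1 * m' 1 + m 2 * m' 2) -
    (m 0 + m 1 + m 2) * (m' 0 + m' 1 + m' 2), ?_, ?_⟩
  · exact Even.sub_odd (even_two_mul _) (h1.mul h2)
  · rw [triple_zero.form_eq]
    simp only [hm, hm']
    push_cast
    ring

theorem form_le_neg_one_or_one_le {r r' : V} (h : r ∈ roots) (h' : r' ∈ roots) :
    form r r' ≤ -1 ∨ 1 ≤ form r r' := by
  obtain ⟨n, hn, e⟩ := exists_odd_form h h'
  rw [e]
  have : n ≤ -1 ∨ 1 ≤ n := by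
    rcases hn with ⟨k, rfl⟩
    omega
  rcases this with h | h
  · left; exact_mod_cast h
  · right; exact_mod_cast h

theorem Triple.sq_eq {i j k : Fin 3} (d : Triple i j k) (x : V) :
    (x k - x i - x j) ^ 2 = form x x + 4 * (x i * x j) := by
  rw [d.form_eq]; ring

theorem nonneg_or_nonpos_of_mul_nonneg {x : V} (h : ∀ i j, i ≠ j → 0 ≤ x i * x j) :
    0 ≤ x ∨ x ≤ 0 := by
  by_contra hc
  rw [not_or] at hc
  obtain ⟨h1, h2⟩ := hc
  simp only [Pi.le_def, not_forall, Pi.zero_apply, not_le] at h1 h2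
  obtain ⟨i, hi⟩ := h1
  obtain ⟨j, hj⟩ := h2
  have hij : i ≠ j := by
    rintro rfl
    linarith
  have := h i j hij
  nlinarith

/-- By `Triple.sq_eq`, `4 * (x i * x j)` is a square minus the norm, hence nonnegative. -/
theorem nonneg_or_nonpos_of_form_nonpos {x : V} (h : form x x ≤ 0) : 0 ≤ x ∨ x ≤ 0 := by
  refine nonneg_or_nonpos_of_mul_nonneg fun i j hij => ?_
  obtain ⟨k, d⟩ := Triple.exists_of_ne hij
  nlinarith [d.sq_eq x, sq_nonneg (x k - x i - x j)]

/-- For a root the same identity gives only `4 * (r i * r j) ≥ -1`; integrality of the coordinates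
improves this to `r i * r j ≥ 0`. -/
theorem nonneg_or_nonpos_of_mem_roots {r : V} (h : r ∈ roots) : 0 ≤ r ∨ r ≤ 0 := by
  refine nonneg_or_nonpos_of_mul_nonneg fun i j hij => ?_
  obtain ⟨k, d⟩ := Triple.exists_of_ne hij
  obtain ⟨m, hm⟩ := exists_int_of_mem_roots h
  have h1 : 0 ≤ 1 + 4 * (r i * r j) := by
    rw [← form_self_of_mem_roots h, ← d.sq_eq]
    positivity
  rw [hm, hm] at h1 ⊢
  have h2 : 0 ≤ 1 + 4 * (m i * m j) := by exact_mod_cast h1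
  have h3 : 0 ≤ m i * m j := by omega
  exact_mod_cast h3

theorem mem_posRoots {r : V} : r ∈ posRoots ↔ r ∈ roots ∧ 0 ≤ r := by
  refine and_congr_right fun _ => ⟨fun h l => ?_, fun h => ?_⟩
  · refine nonneg_of_mem_nonnegSpan (h := LinearMap.proj l) ?_ h
    rintro _ ⟨i, rfl⟩
    exact simpleRoot_nonneg i l
  · rw [triple_zero.eq_sum r]
    have hs : ∀ i, simpleRoot i ∈ nonnegSpan (Set.range simpleRoot) :=
      fun i => subset_nonnegSpan ⟨i, rfl⟩
    exact add_mem_nonnegSpan (comb_mem_nonnegSpan (hs _) (hs _) (h _) (h _))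
      (smul_mem_nonnegSpan (h _) (hs _))

theorem ne_zero_of_mem_roots {r : V} (h : r ∈ roots) : r ≠ 0 := by
  rintro rfl
  have := form_self_of_mem_roots h
  simp at this

theorem not_nonneg_and_nonpos_of_mem_roots {r : V} (h : r ∈ roots) (h0 : 0 ≤ r) (h1 : r ≤ 0) :
    False := ne_zero_of_mem_roots h (le_antisymm h1 h0)

theorem simpleRoot_mem_posRoots (i : Fin 3) : simpleRoot i ∈ posRoots :=
  mem_posRoots.2 ⟨simpleRoot_mem_roots i, simpleRoot_nonneg i⟩

theorem mem_posRoots_or_neg_mem {r : V} (h : r ∈ roots) : r ∈ posRoots ∨ -r ∈ posRoots := by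
  rcases nonneg_or_nonpos_of_mem_roots h with h0 | h0
  · exact Or.inl (mem_posRoots.2 ⟨h, h0⟩)
  · exact Or.inr (mem_posRoots.2 ⟨neg_mem_roots h, by simpa using h0⟩)

theorem not_neg_mem_posRoots {r : V} (h : r ∈ posRoots) : -r ∉ posRoots := by
  intro h'
  exact not_nonneg_and_nonpos_of_mem_roots h.1 (mem_posRoots.1 h).2
    (by simpa using (mem_posRoots.1 h').2)

theorem eq_of_smul_mem_posRoots {r r' : V} {c : ℝ} (h : r ∈ posRoots) (h' : r' ∈ posRoots)
    (e : r' = c • r) : r' = r := by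
  have h1 := form_self_of_mem_roots h.1
  have h2 := form_self_of_mem_roots h'.1
  rw [e] at h2
  simp only [map_smul, LinearMap.smul_apply, h1, smul_eq_mul, mul_one] at h2
  have h3 : (c - 1) * (c + 1) = 0 := by linarith
  rcases mul_eq_zero.1 h3 with h3 | h3
  · rw [e, sub_eq_zero.1 h3, one_smul]
  · rw [eq_neg_of_add_eq_zero_left h3] at e
    refine absurd ?_ (not_neg_mem_posRoots h)
    rw [e] at h'
    simpa using h'

/-! ### The light cone and reflections in roots -/

/-- The closed positive light cone, without its apex. -/
def Forward (x : V) : Prop := form x x ≤ 0 ∧ 0 ≤ x ∧ x ≠ 0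

theorem Forward.simpleReflection {x : V} (h : Forward x) (k : Fin 3) :
    Forward (simpleReflection k x) := by
  obtain ⟨h1, h2, h3⟩ := h
  have hf : form (UniversalCoxeter.simpleReflection k x) (UniversalCoxeter.simpleReflection k x)
    ≤ 0 := by rwa [form_simpleReflection]
  refine ⟨hf, (nonneg_or_nonpos_of_form_nonpos hf).resolve_right fun h0 => h3 ?_, by simpa using h3⟩
  obtain ⟨i, j, d⟩ := Triple.exists_last k
  have hi : x i = 0 := le_antisymm (by simpa [simpleReflection_ne d.ik] using h0 i) (h2 i)
  have hj : x j = 0 := le_antisymm (by simpa [simpleReflection_ne d.jk] using h0 j) (h2 j)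
  refine d.ext hi hj ?_
  rw [d.form_eq, hi, hj] at h1
  change x k = 0
  nlinarith

theorem Forward.act {x : V} (h : Forward x) (L : List (Fin 3)) : Forward (act L x) := by
  induction L with
  | nil => exact h
  | cons k L ih => simpa using ih.simpleReflection k

/-- The reflection `x ↦ x - 2 ⟨a, x⟩ a`. -/
def refl (a : V) : V →ₗ[ℝ] V := LinearMap.id - (2 : ℝ) • (form a).smulRight a

theorem refl_apply (a x : V) : refl a x = x - (2 * form a x) • a := by
  simp [refl, mul_smul]

theorem refl_simpleRoot (k : Fin 3) (x : V) : refl (simpleRoot k) x = simpleReflection k x := by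
  rw [refl_apply, simpleReflection_apply]

theorem act_refl (L : List (Fin 3)) (a x : V) : act L (refl a x) = refl (act L a) (act L x) := by
  simp [refl_apply]

theorem simpleReflection_refl (k : Fin 3) (a x : V) :
    simpleReflection k (refl a x) = refl (simpleReflection k a) (simpleReflection k x) := by
  simpa using act_refl [k] a x

theorem exists_refl_eq_act {a : V} (h : a ∈ roots) : ∃ L, ∀ x, refl a x = act L x := by
  obtain ⟨L, i, rfl⟩ := mem_roots.1 h
  refine ⟨L ++ i :: L.reverse, fun x => ?_⟩
  rw [act_append, act_cons, ← refl_simpleRoot, act_refl, act_act_reverse]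

theorem refl_mem_roots {a r : V} (h : a ∈ roots) (hr : r ∈ roots) : refl a r ∈ roots := by
  obtain ⟨L, hL⟩ := exists_refl_eq_act h
  rw [hL]
  exact act_mem_roots L hr

theorem Forward.refl {a x : V} (h : Forward x) (ha : a ∈ roots) : Forward (refl a x) := by
  obtain ⟨L, hL⟩ := exists_refl_eq_act ha
  rw [hL]
  exact h.act L

theorem form_refl {a : V} (h : a ∈ roots) (x y : V) : form (refl a x) (refl a y) = form x y := by
  obtain ⟨L, hL⟩ := exists_refl_eq_act h
  rw [hL, hL, form_act]

theorem refl_self {a : V} (h : a ∈ roots) : refl a a = -a := by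
  rw [refl_apply, form_self_of_mem_roots h]
  module

theorem refl_refl {a : V} (h : a ∈ roots) (x : V) : refl a (refl a x) = x := by
  rw [refl_apply a x, map_sub, map_smul, refl_self h, refl_apply]
  module

/-- The norm of `b - a` is `2 - 2 * form a b`, which is nonpositive, so its coordinates share a
sign. -/
theorem forward_sub_or_sub {a b : V} (ha : a ∈ roots) (hb : b ∈ roots) (h : 1 ≤ form a b)
    (hab : a ≠ b) : Forward (b - a) ∨ Forward (a - b) := by
  have h1 : form (b - a) (b - a) ≤ 0 := by
    simp only [map_sub, LinearMap.sub_apply, form_self_of_mem_roots ha, form_self_of_mem_roots hb,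
      form_comm b a]
    linarith
  have h2 : form (a - b) (a - b) ≤ 0 := by
    rw [← neg_sub b a, map_neg, map_neg, LinearMap.neg_apply, neg_neg]; exact h1
  rcases nonneg_or_nonpos_of_form_nonpos h1 with h0 | h0
  · exact Or.inl ⟨h1, h0, sub_ne_zero.2 hab.symm⟩
  · exact Or.inr ⟨h2, by rw [← neg_sub b a]; simpa using h0, sub_ne_zero.2 hab⟩

theorem simpleReflection_mem_posRoots {r : V} {k : Fin 3} (h : r ∈ posRoots)
    (hk : r ≠ simpleRoot k) : simpleReflection k r ∈ posRoots := by
  refine (mem_posRoots_or_neg_mem (simpleReflection_mem_roots k h.1)).resolve_right fun h' => hk ?_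
  obtain ⟨i, j, d⟩ := Triple.exists_last k
  have h0 := (mem_posRoots.1 h).2
  have h1 := (mem_posRoots.1 h').2
  have hi : r i = 0 := le_antisymm (by simpa [simpleReflection_ne d.ik] using h1 i) (h0 i)
  have hj : r j = 0 := le_antisymm (by simpa [simpleReflection_ne d.jk] using h1 j) (h0 j)
  refine eq_of_smul_mem_posRoots (c := r k) (simpleRoot_mem_posRoots k) h ?_
  conv_lhs => rw [d.eq_sum r, hi, hj]
  simp

theorem Forward.ht_pos {x : V} (h : Forward x) : 0 < ∑ l, x l := by
  refine lt_of_le_of_ne (Finset.sum_nonneg fun l _ => h.2.1 l) fun h0 => h.2.2 ?_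
  funext l
  exact (Finset.sum_eq_zero_iff_of_nonneg (fun l _ => h.2.1 l)).1 h0.symm l (Finset.mem_univ l)

theorem posRoots_nonneg {r : V} (h : r ∈ posRoots) : 0 ≤ r := (mem_posRoots.1 h).2

theorem Triple.form_eq_sum {i j k : Fin 3} (d : Triple i j k) (r x : V) :
    form r x = r i * (x i - x j - x k) + r j * (x j - x i - x k) + r k * (x k - x i - x j) := by
  rw [d.form_eq]; ring

/-! ### Branches of the positive roots -/

theorem exists_one_le_form_simpleRoot {r : V} (h : r ∈ posRoots) :
    ∃ k, 1 ≤ form (simpleRoot k) r := by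
  by_contra! hc
  have hle : ∀ k, form (simpleRoot k) r ≤ -1 := fun k =>
    (form_le_neg_one_or_one_le (simpleRoot_mem_roots k) h.1).resolve_right (not_le.2 (hc k))
  have h1 := form_self_of_mem_roots h.1
  have d := triple_zero
  have h2 := hle 2
  have h0 := hle 0
  have h3 := hle 1
  rw [d.form_simpleRoot_left] at h2
  rw [d.rotate.form_simpleRoot_left] at h0
  rw [d.rotate.rotate.form_simpleRoot_left] at h3
  rw [d.form_eq_sum] at h1
  have p := posRoots_nonneg h
  have p0 : 0 ≤ r 0 := p 0
  have p1 : 0 ≤ r 1 := p 1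
  have p2 : 0 ≤ r 2 := p 2
  nlinarith

/-- The products of `r` with `α_i` and `α_j` add up to `-2 * r k`, so at most one of them is
positive: the branch of a positive root is unique. -/
theorem form_simpleRoot_le_of_ne {r : V} (h : r ∈ posRoots) {i j : Fin 3} (hij : i ≠ j)
    (hi : 1 ≤ form (simpleRoot i) r) : form (simpleRoot j) r ≤ -1 := by
  obtain ⟨k, d⟩ := Triple.exists_of_ne hij
  refine (form_le_neg_one_or_one_le (simpleRoot_mem_roots j) h.1).resolve_right fun hj => ?_
  rw [d.rotate.form_simpleRoot_left] at hi
  rw [d.rotate.rotate.form_simpleRoot_left] at hj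
  have pk : 0 ≤ r k := posRoots_nonneg h k
  linarith

/-- Since `r i ≥ 1 + r j + r k` and `⟨α_i, x⟩ ≤ -1`, expanding the form bounds it by `⟨α_i, x⟩ - 2 *
r j * x k - 2 * r k * x j`. -/
theorem form_le_neg_one_of_ne {r x : V} (h : r ∈ posRoots) (hx : x ∈ posRoots) {i j : Fin 3}
    (hij : i ≠ j) (hi : 1 ≤ form (simpleRoot i) r) (hj : 1 ≤ form (simpleRoot j) x) :
    form r x ≤ -1 := by
  obtain ⟨k, d⟩ := Triple.exists_of_ne hij
  refine (form_le_neg_one_or_one_le h.1 hx.1).resolve_right fun hc => ?_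
  have hi' := form_simpleRoot_le_of_ne hx hij.symm hj
  rw [d.rotate.form_simpleRoot_left] at hi hi'
  have pj : 0 ≤ r j := posRoots_nonneg h j
  have pk : 0 ≤ r k := posRoots_nonneg h k
  have qj : 0 ≤ x j := posRoots_nonneg hx j
  have qk : 0 ≤ x k := posRoots_nonneg hx k
  rw [d.form_eq_sum] at hc
  nlinarith [mul_nonneg pj qk, mul_nonneg pk qj]

/-- If `form r x` is at least one and `x` lies in the branch of `α_k`, then so does `r`. -/
theorem one_le_form_simpleRoot_of_one_le_form {r x : V} (h : r ∈ posRoots) (hx : x ∈ posRoots)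
    {k : Fin 3} (hrx : 1 ≤ form r x) (hk : 1 ≤ form (simpleRoot k) x) :
    1 ≤ form (simpleRoot k) r := by
  obtain ⟨i, hi⟩ := exists_one_le_form_simpleRoot h
  by_cases hik : i = k
  · rwa [← hik]
  · have := form_le_neg_one_of_ne h hx hik hi hk
    linarith

/-! ### Heights and canonical generators of rank-two subsystems -/

/-- The height of a positive root. -/
def ht (x : V) : ℕ := ⌊∑ l, x l⌋₊

theorem cast_ht {r : V} (h : r ∈ posRoots) : (ht r : ℝ) = ∑ l, r l := by
  obtain ⟨m, hm⟩ := exists_int_of_mem_roots h.1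
  have h0 : 0 ≤ ∑ l, r l := Finset.sum_nonneg fun l _ => posRoots_nonneg h l
  have hs : ∑ l, r l = ((∑ l, m l : ℤ) : ℝ) := by simp [hm]
  rw [ht, hs]
  rw [hs] at h0
  have h1 : 0 ≤ ∑ l, m l := by exact_mod_cast h0
  obtain ⟨n, hn⟩ := Int.eq_ofNat_of_zero_le h1
  rw [hn]
  simp

theorem ht_lt_of_forward {u v : V} (hu : u ∈ posRoots) (hv : v ∈ posRoots)
    (h : Forward (u - v)) : ht v < ht u := by
  have := h.ht_pos
  simp only [Pi.sub_apply, Finset.sum_sub_distrib, ← cast_ht hu, ← cast_ht hv] at this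
  have : (ht v : ℝ) < ht u := by linarith
  exact_mod_cast this

theorem span_pair_eq_of {u v x y : V} (hx : x ∈ Submodule.span ℝ {u, v})
    (hy : y ∈ Submodule.span ℝ {u, v}) (hu : u ∈ Submodule.span ℝ {x, y})
    (hv : v ∈ Submodule.span ℝ {x, y}) : Submodule.span ℝ {x, y} = Submodule.span ℝ {u, v} := by
  apply le_antisymm <;> rw [Submodule.span_le] <;> rintro z (rfl | rfl) <;> assumption

/-- A Euclidean descent: reflect the higher root in the lower one. If the result is positive, the
product has changed sign; otherwise its negative replaces the higher root and the total height
drops. -/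
theorem exists_form_le_neg_one_aux (n : ℕ) : ∀ u v : V, u ∈ posRoots → v ∈ posRoots → u ≠ v →
    ht u + ht v = n → ∃ x ∈ posRoots, ∃ y ∈ posRoots, form x y ≤ -1 ∧
      Submodule.span ℝ {x, y} = Submodule.span ℝ {u, v} := by
  induction n using Nat.strong_induction_on with
  | _ n ih =>
  have key : ∀ u v : V, u ∈ posRoots → v ∈ posRoots → u ≠ v → Forward (u - v) → 1 ≤ form u v →
      ht u + ht v = n → ∃ x ∈ posRoots, ∃ y ∈ posRoots, form x y ≤ -1 ∧
      Submodule.span ℝ {x, y} = Submodule.span ℝ {u, v} := by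
    intro u v hu hv huv hf h1 hn
    have hz : refl v u = u - (2 * form v u) • v := refl_apply v u
    have hform : form (refl v u) v = - form u v := by
      have := form_refl hv.1 (refl v u) v
      rw [refl_refl hv.1, refl_self hv.1, map_neg] at this
      linarith
    have hz1 : refl v u ∈ Submodule.span ℝ {u, v} := by
      rw [hz]
      exact Submodule.sub_mem _ (Submodule.subset_span (by simp))
        (Submodule.smul_mem _ _ (Submodule.subset_span (by simp)))
    rcases mem_posRoots_or_neg_mem (refl_mem_roots hv.1 hu.1) with h | h
    · refine ⟨refl v u, h, v, hv, by linarith, ?_⟩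
      refine span_pair_eq_of hz1 (Submodule.subset_span (by simp)) ?_
        (Submodule.subset_span (by simp))
      exact Submodule.mem_span_pair.2 ⟨1, 2 * form v u, by rw [hz]; module⟩
    · have hne : v ≠ -refl v u := by
        intro e
        have : refl v u = -v := by rw [e, neg_neg, ← e]
        apply huv
        rw [← refl_refl hv.1 u, this, map_neg, refl_self hv.1, neg_neg]
      -- `refl v` maps `u - v` to `refl v u + v`, so invariance of the light cone orders the new
      -- pair.
      have hf' : Forward (v - -refl v u) := by
        have := hf.refl hv.1
        rw [map_sub, refl_self hv.1] at this
        convert this using 1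
        module
      have l1 := ht_lt_of_forward hv h hf'
      have l2 := ht_lt_of_forward hu hv hf
      obtain ⟨x, hx, y, hy, hxy, hs⟩ := ih (ht v + ht (-refl v u)) (by omega) v _ hv h hne rfl
      refine ⟨x, hx, y, hy, hxy, hs.trans ?_⟩
      refine span_pair_eq_of (Submodule.subset_span (by simp)) (Submodule.neg_mem _ hz1) ?_
        (Submodule.subset_span (by simp))
      exact Submodule.mem_span_pair.2 ⟨2 * form v u, -1, by rw [hz]; module⟩
  intro u v hu hv huv hn
  rcases form_le_neg_one_or_one_le hu.1 hv.1 with h | h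
  · exact ⟨u, hu, v, hv, h, rfl⟩
  rcases forward_sub_or_sub hu.1 hv.1 h huv with hf | hf
  · obtain ⟨x, hx, y, hy, hxy, hs⟩ := key v u hv hu huv.symm hf (by rwa [form_comm])
      (by omega)
    exact ⟨x, hx, y, hy, hxy, hs.trans (by rw [Set.pair_comm])⟩
  · exact key u v hu hv huv hf h hn

/-- A pair with product at most -1 that fails to generate the positive roots of its plane admits one
with coefficients of opposite signs. That root is lower than the generator with positive coefficient
and can take its place. -/
theorem exists_canonical_aux (n : ℕ) : ∀ u v : V, u ∈ posRoots → v ∈ posRoots → form u v ≤ -1 →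
    ht u + ht v = n → ∃ x ∈ posRoots, ∃ y ∈ posRoots, form x y ≤ -1 ∧
      Submodule.span ℝ {x, y} = Submodule.span ℝ {u, v} ∧
      ∀ r ∈ posRoots, r ∈ Submodule.span ℝ {u, v} → r ∈ nonnegSpan {x, y} := by
  induction n using Nat.strong_induction_on with
  | _ n ih =>
  have key : ∀ u v r : V, u ∈ posRoots → v ∈ posRoots → r ∈ posRoots → form u v ≤ -1 →
      ht u + ht v = n → ∀ p q : ℝ, 0 < p → q < 0 → r = p • u + q • v →
      ∃ x ∈ posRoots, ∃ y ∈ posRoots, form x y ≤ -1 ∧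
      Submodule.span ℝ {x, y} = Submodule.span ℝ {u, v} ∧
      ∀ r ∈ posRoots, r ∈ Submodule.span ℝ {u, v} → r ∈ nonnegSpan {x, y} := by
    intro u v r hu hv hr h1 hn p q hp hq e
    have f1 : p ^ 2 + q ^ 2 + 2 * (p * q) * form u v = 1 := by
      rw [← form_self_of_mem_roots hr.1, e]
      simp only [map_add, map_smul, LinearMap.add_apply, LinearMap.smul_apply, smul_eq_mul,
        form_self_of_mem_roots hu.1, form_self_of_mem_roots hv.1, form_comm v u]
      ring
    have hpq : p * q < 0 := mul_neg_of_pos_of_neg hp hq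
    -- In `f1` the mixed term is positive because `p * q < 0` and `form u v ≤ -1`, so `p ^ 2 < 1`.
    -- This makes `r` lower than `u`.
    have hp1 : p < 1 := by nlinarith
    have f2 : form r v = p * form u v + q := by
      rw [e]
      simp only [map_add, map_smul, LinearMap.add_apply, LinearMap.smul_apply, smul_eq_mul,
        form_self_of_mem_roots hv.1]
      ring
    have f3 : form r v ≤ -1 :=
      (form_le_neg_one_or_one_le hr.1 hv.1).resolve_right fun hc => by nlinarith
    have l1 : ht r < ht u := by
      have : (ht r : ℝ) < ht u := by
        have es : ∑ l, r l = p * ∑ l, u l + q * ∑ l, v l := by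
          rw [e]
          simp [Finset.sum_add_distrib, Finset.mul_sum]
        have hu0 : 0 < ∑ l, u l := by
          have h0 : (0:ℝ) ≤ ∑ l, r l := Finset.sum_nonneg fun l _ => posRoots_nonneg hr l
          have h3 : ∀ w ∈ posRoots, 0 < ∑ l, w l := by
            intro w hw
            refine lt_of_le_of_ne (Finset.sum_nonneg fun l _ => posRoots_nonneg hw l) fun h0 => ?_
            refine ne_zero_of_mem_roots hw.1 ?_
            funext l
            exact (Finset.sum_eq_zero_iff_of_nonneg (fun l _ => posRoots_nonneg hw l)).1 h0.symm l
              (Finset.mem_univ l)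
          exact h3 u hu
        have hv0 : (0:ℝ) ≤ ∑ l, v l := Finset.sum_nonneg fun l _ => posRoots_nonneg hv l
        rw [cast_ht hr, cast_ht hu, es]
        nlinarith
      exact_mod_cast this
    have hs : Submodule.span ℝ {r, v} = Submodule.span ℝ {u, v} := by
      refine span_pair_eq_of (Submodule.mem_span_pair.2 ⟨p, q, e.symm⟩)
        (Submodule.subset_span (by simp)) ?_ (Submodule.subset_span (by simp))
      refine Submodule.mem_span_pair.2 ⟨p⁻¹, -(p⁻¹ * q), ?_⟩
      rw [e, smul_add, smul_smul, inv_mul_cancel₀ hp.ne']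
      module
    rw [← hs]
    exact ih (ht r + ht v) (by omega) r v hr hv f3 rfl
  intro u v hu hv h1 hn
  by_cases hall : ∀ r ∈ posRoots, r ∈ Submodule.span ℝ {u, v} → r ∈ nonnegSpan {u, v}
  · exact ⟨u, hu, v, hv, h1, rfl, hall⟩
  push Not at hall
  obtain ⟨r, hr, hrs, hrn⟩ := hall
  obtain ⟨p, q, e⟩ := Submodule.mem_span_pair.1 hrs
  by_cases hp : 0 ≤ p
  · by_cases hq : 0 ≤ q
    · exact absurd (mem_nonnegSpan_pair.2 ⟨p, q, hp, hq, e.symm⟩) hrn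
    push Not at hq
    refine key u v r hu hv hr h1 hn p q (lt_of_le_of_ne hp ?_) hq e.symm
    rintro rfl
    refine not_nonneg_and_nonpos_of_mem_roots hr.1 (posRoots_nonneg hr) ?_
    rw [← e]
    intro l
    have := posRoots_nonneg hv l
    simp only [Pi.zero_apply] at this
    simp
    nlinarith
  · push Not at hp
    by_cases hq : 0 < q
    · obtain ⟨x, hx, y, hy, hxy, hs, hc⟩ := key v u r hv hu hr (by rwa [form_comm]) (by omega)
        q p hq hp (by rw [← e, add_comm])
      rw [Set.pair_comm v u] at hs hc
      exact ⟨x, hx, y, hy, hxy, hs, hc⟩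
    · exfalso
      refine not_nonneg_and_nonpos_of_mem_roots hr.1 (posRoots_nonneg hr) ?_
      rw [← e]
      intro l
      have h1 := posRoots_nonneg hv l
      have h2 := posRoots_nonneg hu l
      simp only [Pi.zero_apply] at h1 h2
      simp
      nlinarith

/-- The positive roots of a plane have canonical generators. -/
theorem exists_canonical {u v : V} (hu : u ∈ posRoots) (hv : v ∈ posRoots) (huv : u ≠ v) :
    ∃ x ∈ posRoots, ∃ y ∈ posRoots, form x y ≤ -1 ∧
      Submodule.span ℝ {x, y} = Submodule.span ℝ {u, v} ∧
      ∀ r ∈ posRoots, r ∈ Submodule.span ℝ {u, v} → r ∈ nonnegSpan {x, y} := by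
  obtain ⟨x, hx, y, hy, hxy, hs⟩ := exists_form_le_neg_one_aux _ u v hu hv huv rfl
  obtain ⟨x', hx', y', hy', hxy', hs', hc⟩ := exists_canonical_aux _ x y hx hy hxy rfl
  rw [hs] at hs' hc
  exact ⟨x', hx', y', hy', hxy', hs', hc⟩

/-! ### Half systems and pointed cones -/

/-- A set of roots that contains exactly one of each pair of opposite roots and is closed. -/
structure HalfSystem (H : Set V) : Prop where
  subset : H ⊆ roots
  mem_or : ∀ r ∈ roots, r ∈ H ∨ -r ∈ H
  not_neg : ∀ r ∈ H, -r ∉ H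
  closed : ∀ u ∈ H, ∀ v ∈ H, ∀ r ∈ roots, r ∈ nonnegSpan {u, v} → r ∈ H

theorem neg_mem_nonnegSpan_neg {S : Set V} {x : V} :
    -x ∈ nonnegSpan {r | -r ∈ S} ↔ x ∈ nonnegSpan S := by
  have key : ∀ {S T : Set V} {x : V}, (∀ s ∈ S, -s ∈ T) → x ∈ nonnegSpan S →
      -x ∈ nonnegSpan T := fun hST h =>
    map_mem_nonnegSpan (-LinearMap.id) (fun s hs => subset_nonnegSpan (hST s hs)) h
  refine ⟨fun h => ?_, fun h => key (fun s hs => ?_) h⟩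
  · simpa using key (T := S) (fun s hs => hs) h
  · simpa using hs

theorem simpleReflection_mem_nonnegSpan {S : Set V} {x : V} {j : Fin 3} :
    x ∈ nonnegSpan {r | simpleReflection j r ∈ S} ↔ simpleReflection j x ∈ nonnegSpan S := by
  constructor
  · exact map_mem_nonnegSpan (T := S) (simpleReflection j).toLinearMap
      (fun s hs => subset_nonnegSpan hs)
  · intro h
    have := map_mem_nonnegSpan (T := {r | simpleReflection j r ∈ S})
      (simpleReflection j).toLinearMap
      (fun s hs => subset_nonnegSpan (by simpa using hs)) h
    simpa using this

theorem HalfSystem.neg {H : Set V} (h : HalfSystem H) : HalfSystem {r | -r ∈ H} := by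
  refine ⟨fun r hr => ?_, fun r hr => ?_, fun r hr => ?_, fun u hu v hv r hr hc => ?_⟩
  · simpa using neg_mem_roots (h.subset hr)
  · simpa using (h.mem_or _ (neg_mem_roots hr))
  · exact h.not_neg _ hr
  · refine h.closed _ hu _ hv _ (neg_mem_roots hr) ?_
    obtain ⟨s, t, hs, ht, rfl⟩ := mem_nonnegSpan_pair.1 hc
    exact mem_nonnegSpan_pair.2 ⟨s, t, hs, ht, by module⟩

theorem HalfSystem.simpleReflection {H : Set V} (h : HalfSystem H) (j : Fin 3) :
    HalfSystem {r | simpleReflection j r ∈ H} := by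
  refine ⟨fun r hr => ?_, fun r hr => ?_, fun r hr => ?_, fun u hu v hv r hr hc => ?_⟩
  · simpa using simpleReflection_mem_roots j (h.subset hr)
  · simpa using (h.mem_or _ (simpleReflection_mem_roots j hr))
  · simpa using h.not_neg _ hr
  · refine h.closed _ hu _ hv _ (simpleReflection_mem_roots j hr) ?_
    obtain ⟨s, t, hs, ht, rfl⟩ := mem_nonnegSpan_pair.1 hc
    exact mem_nonnegSpan_pair.2 ⟨s, t, hs, ht, by simp⟩

theorem HalfSystem.neg_mem {H : Set V} (h : HalfSystem H) {r : V} (hr : r ∈ roots) (hn : r ∉ H) :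
    -r ∈ H := (h.mem_or r hr).resolve_left hn

/-- No member of the set has its negative in the cone spanned by the set. -/
def Free (S : Set V) : Prop := ∀ v ∈ S, -v ∉ nonnegSpan S

theorem Free.mono {S T : Set V} (h : Free T) (hST : S ⊆ T) : Free S :=
  fun v hv hn => h v (hST hv) (nonnegSpan_mono hST hn)

theorem Free.eq_zero {S : Set V} (h : Free S) {x : V} (hx : x ∈ nonnegSpan S)
    (hn : -x ∈ nonnegSpan S) : x = 0 := by
  revert hn
  refine nonnegSpan_induction (p := fun x => -x ∈ nonnegSpan S → x = 0)
    (fun x hx hn => absurd hn (h x hx)) (fun _ => rfl) ?_ ?_ hx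
  · intro x y hx hy px py hn
    have h1 : -x ∈ nonnegSpan S := by
      convert add_mem_nonnegSpan hn hy using 1
      module
    have h2 : -y ∈ nonnegSpan S := by
      convert add_mem_nonnegSpan hn hx using 1
      module
    rw [px h1, py h2, add_zero]
  · intro c x hc hx px hn
    rcases hc.eq_or_lt with rfl | hc
    · simp
    · have := smul_mem_nonnegSpan (inv_nonneg.2 hc.le) hn
      rw [smul_neg, smul_smul, inv_mul_cancel₀ hc.ne', one_smul] at this
      rw [px this, smul_zero]

theorem Free.neg {S : Set V} (h : Free S) : Free {r | -r ∈ S} := by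
  intro v hv hn
  exact h _ hv (by simpa using neg_mem_nonnegSpan_neg.1 hn)

theorem Free.simpleReflection {S : Set V} (h : Free S) (j : Fin 3) :
    Free {r | simpleReflection j r ∈ S} := by
  intro v hv hn
  exact h _ hv (by simpa using simpleReflection_mem_nonnegSpan.1 hn)

/-! ### Fans and layers -/

/-- The roots with a vanishing coordinate. -/
def fans : Set V := {r | r ∈ roots ∧ ∃ l, r l = 0}

/-- The union of the images of `fans` under the prefixes of a word. -/
def layer : List (Fin 3) → Set V
  | [] => fans
  | j :: L => fans ∪ {r | simpleReflection j r ∈ layer L}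

theorem mem_layer_cons {j : Fin 3} {L : List (Fin 3)} {r : V} :
    r ∈ layer (j :: L) ↔ r ∈ fans ∨ simpleReflection j r ∈ layer L := Iff.rfl

theorem fans_subset_layer (L : List (Fin 3)) : fans ⊆ layer L := by
  cases L with
  | nil => exact subset_rfl
  | cons j L => exact Set.subset_union_left

theorem simpleRoot_mem_fans (i : Fin 3) : simpleRoot i ∈ fans := by
  obtain ⟨j, k, d⟩ := Triple.exists_last i
  exact ⟨simpleRoot_mem_roots i, j, simpleRoot_ne d.ik⟩

theorem neg_mem_fans {r : V} (h : r ∈ fans) : -r ∈ fans := by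
  obtain ⟨h, l, hl⟩ := h
  exact ⟨neg_mem_roots h, l, by simpa using hl⟩

theorem layer_subset_roots (L : List (Fin 3)) : layer L ⊆ roots := by
  induction L with
  | nil => exact fun r hr => hr.1
  | cons j L ih =>
    rintro r (hr | hr)
    · exact hr.1
    · simpa using simpleReflection_mem_roots j (ih hr)

theorem neg_mem_layer {L : List (Fin 3)} {r : V} (h : r ∈ layer L) : -r ∈ layer L := by
  induction L generalizing r with
  | nil => exact neg_mem_fans h
  | cons j L ih =>
    rcases mem_layer_cons.1 h with h | h
    · exact Or.inl (neg_mem_fans h)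
    · refine mem_layer_cons.2 (Or.inr ?_)
      rw [map_neg]
      exact ih h

theorem act_mem_layer_append {L M : List (Fin 3)} {r : V} (h : r ∈ layer M) :
    act L r ∈ layer (L ++ M) := by
  induction L with
  | nil => exact h
  | cons j L ih => exact mem_layer_cons.2 (Or.inr (by simpa using ih))

theorem layer_subset_append (L M : List (Fin 3)) : layer L ⊆ layer (L ++ M) := by
  induction L with
  | nil => exact fans_subset_layer _
  | cons j L ih => exact Set.union_subset_union subset_rfl fun r hr => ih hr

/-- The layers are directed: the word `L` followed by its inverse and then `M` passes through the
prefixes of `L` and, after cancellation, through those of `M`. -/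
theorem exists_layer_union (L M : List (Fin 3)) : ∃ N, layer L ⊆ layer N ∧ layer M ⊆ layer N := by
  refine ⟨L ++ (L.reverse ++ M), layer_subset_append _ _, fun r hr => ?_⟩
  simpa using act_mem_layer_append (L := L) (act_mem_layer_append (L := L.reverse) hr)

theorem exists_mem_layer {r : V} (h : r ∈ roots) : ∃ L, r ∈ layer L := by
  obtain ⟨L, i, rfl⟩ := mem_roots.1 h
  exact ⟨L ++ [], act_mem_layer_append (simpleRoot_mem_fans i)⟩

theorem exists_prefix_of_mem_layer {L : List (Fin 3)} {r : V} (h : r ∈ layer L) :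
    ∃ M, M <+: L ∧ ∃ f ∈ fans, r = act M f := by
  induction L generalizing r with
  | nil => exact ⟨[], List.prefix_rfl, r, h, rfl⟩
  | cons j L ih =>
    rcases mem_layer_cons.1 h with h | h
    · exact ⟨[], List.nil_prefix, r, h, rfl⟩
    · obtain ⟨M, hM, f, hf, e⟩ := ih h
      refine ⟨j :: M, by simpa using hM, f, hf, ?_⟩
      rw [act_cons, ← e, simpleReflection_simpleReflection]

/-- Where `r` vanishes, `0 ≤ a ≤ r` makes `a` vanish too, so the reflection keeps that coordinate
zero. -/
theorem refl_mem_fans {a r : V} (ha : a ∈ posRoots) (hr : r ∈ fans) (h : Forward (r - a)) :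
    refl a r ∈ fans := by
  obtain ⟨hr, l, hl⟩ := hr
  refine ⟨refl_mem_roots ha.1 hr, l, ?_⟩
  have h1 : 0 ≤ r l - a l := h.2.1 l
  have h2 : 0 ≤ a l := posRoots_nonneg ha l
  have h3 : a l = 0 := by linarith
  simp [refl_apply, hl, h3]

/-- Folding a layer along a positive root either lands in a layer of a shorter word, or preserves
the part of the layer beyond that root. -/
theorem fold_layer (L : List (Fin 3)) : ∀ a ∈ posRoots,
    (∃ M : List (Fin 3), M.length < L.length ∧ a ∈ layer M ∧
      ∀ r ∈ layer L, r ∈ layer M ∨ refl a r ∈ layer M) ∨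
    ∀ r ∈ layer L, Forward (r - a) → refl a r ∈ layer L := by
  induction L with
  | nil => exact fun a ha => Or.inr fun r hr h => refl_mem_fans ha hr h
  | cons j L ih =>
    intro a ha
    by_cases haj : a = simpleRoot j
    · subst haj
      -- Reflecting in the first letter itself removes that letter: the shorter word is the tail.
      refine Or.inl ⟨L, by simp, fans_subset_layer L (simpleRoot_mem_fans j), fun r hr => ?_⟩
      rw [refl_simpleRoot]
      exact (mem_layer_cons.1 hr).imp_left fun h => fans_subset_layer L h
    -- Otherwise `s_j a` is still positive, and both alternatives for the tail are carried back by
    -- `s_j`, which preserves the light cone.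
    rcases ih _ (simpleReflection_mem_posRoots ha haj) with ⟨M, hM, haM, h⟩ | h
    · refine Or.inl ⟨j :: M, by simpa using hM, Or.inr haM, fun r hr => ?_⟩
      rcases mem_layer_cons.1 hr with hr | hr
      · exact Or.inl (Or.inl hr)
      · refine (h _ hr).imp (fun h => Or.inr h) fun h => Or.inr ?_
        rwa [← simpleReflection_refl] at h
    · refine Or.inr fun r hr hf => ?_
      rcases mem_layer_cons.1 hr with hr | hr
      · exact Or.inl (refl_mem_fans ha hr hf)
      · refine Or.inr ?_
        have := h _ hr (by simpa using hf.simpleReflection j)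
        rwa [← simpleReflection_refl] at this

/-- The exchange condition. -/
theorem exists_shorter {w : List (Fin 3)} : ∀ {a : V}, a ∈ posRoots → act w.reverse a ≤ 0 →
    ∃ w' : List (Fin 3), w'.length < w.length ∧ ∀ x, refl a (act w x) = act w' x := by
  induction w with
  | nil =>
    intro a ha h
    exact (not_nonneg_and_nonpos_of_mem_roots ha.1 (posRoots_nonneg ha) (by simpa using h)).elim
  | cons j w ih =>
    intro a ha h
    by_cases haj : a = simpleRoot j
    · subst haj
      exact ⟨w, by simp, fun x => by simp [refl_simpleRoot]⟩
    · obtain ⟨w', hl, he⟩ := ih (simpleReflection_mem_posRoots ha haj)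
        (by simpa [act_append] using h)
      refine ⟨j :: w', by simpa using hl, fun x => ?_⟩
      rw [act_cons, act_cons, ← he, simpleReflection_refl, simpleReflection_simpleReflection]

/-! ### Reduced words and regions -/

/-- The roots that lie, up to sign, in the branch of `α_j` or on a fan through `α_j`. -/
def region (j : Fin 3) : Set V :=
  {r | (∃ l, l ≠ j ∧ r l = 0) ∨ (0 ≤ r ∧ 1 ≤ form (simpleRoot j) r) ∨
    (r ≤ 0 ∧ form (simpleRoot j) r ≤ -1)}

theorem neg_mem_region {j : Fin 3} {r : V} (h : r ∈ region j) : -r ∈ region j := by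
  rcases h with ⟨l, hl, h⟩ | ⟨h, h'⟩ | ⟨h, h'⟩
  · exact Or.inl ⟨l, hl, by simpa using h⟩
  · exact Or.inr (Or.inr ⟨by simpa using h, by simpa using h'⟩)
  · refine Or.inr (Or.inl ⟨by simpa using h, ?_⟩)
    rw [map_neg]
    linarith

theorem simpleReflection_mem_region {j : Fin 3} {r : V} (h : r ∈ posRoots)
    (h' : form (simpleRoot j) r ≤ -1) : simpleReflection j r ∈ region j := by
  refine Or.inr (Or.inl ⟨posRoots_nonneg (simpleReflection_mem_posRoots h ?_), ?_⟩)
  · rintro rfl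
    rw [form_simpleRoot, if_pos rfl] at h'
    norm_num at h'
  · rw [← simpleReflection_simpleReflection j (simpleRoot j), form_simpleReflection,
      simpleReflection_self, map_neg, LinearMap.neg_apply]
    linarith

theorem simpleReflection_mem_region_of_mem_fans {j : Fin 3} {r : V} (h : r ∈ fans) :
    simpleReflection j r ∈ region j := by
  obtain ⟨hr, l, hl⟩ := h
  by_cases hlj : l = j
  · subst hlj
    have key : ∀ r ∈ posRoots, r l = 0 → simpleReflection l r ∈ region l := by
      intro r hr hl
      obtain ⟨i, k, d⟩ := Triple.exists_last l
      refine simpleReflection_mem_region hr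
        ((form_le_neg_one_or_one_le (simpleRoot_mem_roots l) hr.1).resolve_right fun h1 => ?_)
      rw [d.form_simpleRoot_left, hl] at h1
      have p1 := posRoots_nonneg hr i
      have p2 := posRoots_nonneg hr k
      simp only [Pi.zero_apply] at p1 p2
      linarith
    rcases mem_posRoots_or_neg_mem hr with hr | hr
    · exact key r hr hl
    · have := neg_mem_region (key (-r) hr (by simpa using hl))
      simpa using this
  · exact Or.inl ⟨l, hlj, by rwa [simpleReflection_ne hlj]⟩

theorem simpleReflection_mem_region_of_mem_region {i j : Fin 3} (hij : i ≠ j) {r : V}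
    (hr : r ∈ roots) (h : r ∈ region i) : simpleReflection j r ∈ region j := by
  rcases h with ⟨l, hl, h⟩ | ⟨h, h'⟩ | ⟨h, h'⟩
  · exact simpleReflection_mem_region_of_mem_fans ⟨hr, l, h⟩
  · have hp := mem_posRoots.2 ⟨hr, h⟩
    exact simpleReflection_mem_region hp (form_simpleRoot_le_of_ne hp hij h')
  · have hp : -r ∈ posRoots := mem_posRoots.2 ⟨neg_mem_roots hr, by simpa using h⟩
    have := neg_mem_region (simpleReflection_mem_region hp (form_simpleRoot_le_of_ne hp hij
      (by rw [map_neg]; linarith)))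
    simpa using this

/-- Ping-pong: `s_j` sends every fan, and every region other than its own, into `region j`, so the
first letter of a reduced word decides the region. -/
theorem act_mem_region_of_isChain {u : List (Fin 3)} : ∀ {j : Fin 3},
    List.IsChain (· ≠ ·) (j :: u) → ∀ {f : V}, f ∈ fans → act (j :: u) f ∈ region j := by
  induction u with
  | nil =>
    intro j _ f hf
    simpa using simpleReflection_mem_region_of_mem_fans hf
  | cons i u ih =>
    intro j hc f hf
    rw [List.isChain_cons_cons] at hc
    rw [act_cons]
    exact simpleReflection_mem_region_of_mem_region hc.1.symm (act_mem_roots _ hf.1) (ih hc.2 hf)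

/-- Free reduction of `j :: M`, one letter of `M` at a time. The leading `j` could be cancelled only
by a prefix of `M` that acts as `s_j`, which is excluded. -/
theorem exists_isChain {j : Fin 3} (M : List (Fin 3))
    (h : ∀ M', M' <+: M → act M' ≠ simpleReflection j) :
    ∃ u, List.IsChain (· ≠ ·) (j :: u) ∧ act (j :: u) = act (j :: M) := by
  induction M using List.reverseRecOn with
  | nil => exact ⟨[], by simp, rfl⟩
  | append_singleton M m ih =>
    obtain ⟨u, hu, e⟩ := ih fun M' hM' => h M' (hM'.trans (List.prefix_append _ _))
    have e' : ∀ x, act (j :: (M ++ [m])) x = act (j :: u) (simpleReflection m x) := by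
      intro x
      rw [e, act_cons, act_append]
      simp
    rcases List.eq_nil_or_concat u with rfl | ⟨v, n, rfl⟩
    · by_cases hm : m = j
      · subst hm
        refine absurd ?_ (h (M ++ [m]) List.prefix_rfl)
        ext1 x
        simpa using congrArg (simpleReflection m) (e' x)
      · refine ⟨[m], by simpa using Ne.symm hm, ?_⟩
        ext1 x
        rw [e']
        simp
    · rw [List.concat_eq_append] at *
      by_cases hm : m = n
      · subst hm
        refine ⟨v, ?_, ?_⟩
        · rw [← List.cons_append] at hu
          exact hu.left_of_append
        · ext1 x
          rw [e', ← List.cons_append, act_append]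
          simp
      · refine ⟨v ++ [n] ++ [m], ?_, ?_⟩
        · rw [← List.cons_append, List.isChain_append]
          refine ⟨hu, by simp, ?_⟩
          intro x hx y hy
          rw [← List.cons_append, List.getLast?_append] at hx
          simp at hx hy
          subst hx hy
          exact Ne.symm hm
        · ext1 x
          rw [e', ← List.cons_append, act_append]
          simp

theorem layer_subset_region {j : Fin 3} {L : List (Fin 3)}
    (h : ∀ M, M <+: L → act M ≠ simpleReflection j) {r : V}
    (hr : simpleReflection j r ∈ layer L) : r ∈ region j := by
  obtain ⟨M, hM, f, hf, e⟩ := exists_prefix_of_mem_layer hr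
  obtain ⟨u, hu, e'⟩ := exists_isChain M fun M' hM' => h M' (hM'.trans hM)
  have := act_mem_region_of_isChain hu hf
  rwa [e', act_cons, ← e, simpleReflection_simpleReflection] at this

/-- The complementary case to `layer_subset_region`: if a prefix of `L` already acts as `s_j`, then
`layer L` contains the `s_j`-images of the fans, and prepending `j` adds no new fan. -/
theorem layer_cons_eq {j : Fin 3} {L M : List (Fin 3)} (hM : M <+: L)
    (h : act M = simpleReflection j) : layer (j :: L) = {r | simpleReflection j r ∈ layer L} := by
  refine Set.union_eq_self_of_subset_left fun r hr => ?_
  obtain ⟨N, rfl⟩ := hM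
  rw [Set.mem_ofPred_eq, ← h]
  exact act_mem_layer_append (fans_subset_layer N hr)

/-! ### Planes meeting a half system, and excluded relations -/

theorem HalfSystem.comb_mem {H : Set V} (h : HalfSystem H) {u v r : V} (hu : u ∈ H) (hv : v ∈ H)
    (hr : r ∈ roots) {s t : ℝ} (hs : 0 ≤ s) (ht : 0 ≤ t) (e : r = s • u + t • v) : r ∈ H :=
  h.closed u hu v hv r hr (mem_nonnegSpan_pair.2 ⟨s, t, hs, ht, e⟩)

theorem HalfSystem.comb_mem_of_neg {H : Set V} (h : HalfSystem H) {u v r : V} (hu : -u ∈ H)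
    (hv : -v ∈ H) (hr : r ∈ roots) {s t : ℝ} (hs : 0 ≤ s) (ht : 0 ≤ t) (e : r = s • u + t • v) :
    -r ∈ H :=
  h.comb_mem hu hv (neg_mem_roots hr) hs ht (by rw [e]; module)

/-- In the plane spanned by a root `a` of `H` and a root `b` outside `H`, the root `a` may be
replaced by a canonical generator of the plane. -/
theorem HalfSystem.exists_canonical {H : Set V} (h : HalfSystem H) {a b : V} (ha : a ∈ posRoots)
    (haH : a ∈ H) (hb : b ∈ posRoots) (hbH : -b ∈ H) :
    ∃ x ∈ posRoots, ∃ y ∈ posRoots, x ∈ H ∧ form x y ≤ -1 ∧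
      b ∈ Submodule.span ℝ {x, y} ∧
      (∀ r ∈ posRoots, r ∈ Submodule.span ℝ {x, y} → r ∈ nonnegSpan {x, y}) ∧
      refl x b ∈ posRoots ∧ ∃ s t : ℝ, 0 ≤ s ∧ 0 ≤ t ∧ a = s • x + t • b := by
  have hbn : b ∉ H := fun h' => h.not_neg _ h' hbH
  have hab : a ≠ b := fun e => hbn (e ▸ haH)
  obtain ⟨x, hx, y, hy, hxy, hs, hc⟩ := UniversalCoxeter.exists_canonical ha hb hab
  obtain ⟨p, q, hp, hq, ea⟩ := mem_nonnegSpan_pair.1 (hc a ha (Submodule.subset_span (by simp)))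
  obtain ⟨p', q', hp', hq', eb⟩ := mem_nonnegSpan_pair.1 (hc b hb (Submodule.subset_span (by simp)))
  have key : ∀ x y : V, x ∈ posRoots → y ∈ posRoots → x ∈ H → form x y ≤ -1 →
      (∀ r ∈ posRoots, r ∈ Submodule.span ℝ {a, b} → r ∈ nonnegSpan {x, y}) →
      Submodule.span ℝ {x, y} = Submodule.span ℝ {a, b} →
      ∀ p q p' q' : ℝ, 0 ≤ p → 0 ≤ q → 0 ≤ p' → 0 ≤ q' → a = p • x + q • y → b = p' • x + q' • y →
      ∃ x ∈ posRoots, ∃ y ∈ posRoots, x ∈ H ∧ form x y ≤ -1 ∧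
      b ∈ Submodule.span ℝ {x, y} ∧
      (∀ r ∈ posRoots, r ∈ Submodule.span ℝ {x, y} → r ∈ nonnegSpan {x, y}) ∧
      refl x b ∈ posRoots ∧ ∃ s t : ℝ, 0 ≤ s ∧ 0 ≤ t ∧ a = s • x + t • b := by
    intro x y hx hy hxH hxy hc hspan p q p' q' hp hq hp' hq' ea eb
    have hq0 : 0 < q' := by
      refine lt_of_le_of_ne hq' ?_
      rintro rfl
      refine hbn (h.comb_mem hxH hxH hb.1 hp' le_rfl (by rw [eb]; simp))
    have hxs : x ∈ Submodule.span ℝ {a, b} := hspan ▸ Submodule.subset_span (by simp)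
    refine ⟨x, hx, y, hy, hxH, hxy, hspan ▸ Submodule.subset_span (by simp),
      fun r hr hrs => hc r hr (hspan ▸ hrs), ?_, ?_⟩
    · have hr := refl_mem_roots hx.1 hb.1
      refine (mem_posRoots_or_neg_mem hr).resolve_right fun hn => ?_
      have hs : -refl x b ∈ Submodule.span ℝ {a, b} := by
        rw [refl_apply]
        exact Submodule.neg_mem _ (Submodule.sub_mem _ (Submodule.subset_span (by simp))
          (Submodule.smul_mem _ _ hxs))
      -- The reflection in `x` does not change the `y`-coefficient `q' > 0` of `b`. Were it
      -- negative, `y` would be a multiple of `x`, hence equal to it, against `form x y ≤ -1`.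
      obtain ⟨e, f, he, hf, E⟩ := mem_nonnegSpan_pair.1 (hc _ hn hs)
      rw [refl_apply, eb] at E
      have hqf : 0 < q' + f := by linarith
      obtain ⟨g, hg⟩ : ∃ g : ℝ, (q' + f) • y = g • x := by
        refine ⟨-e - p' + 2 * form x b, ?_⟩
        rw [eb]
        linear_combination (norm := module) -E
      have : y = ((q' + f)⁻¹ * g) • x := by
        rw [mul_smul, ← hg, smul_smul, inv_mul_cancel₀ hqf.ne', one_smul]
      have e := eq_of_smul_mem_posRoots hx hy this
      rw [e, form_self_of_mem_roots hx.1] at hxy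
      norm_num at hxy
    -- The slopes decide which of `a` and `b` lies between `x` and the other. If `b` did, closedness
    -- of `H` would contain it.
    · by_cases hlt : q * p' ≤ p * q'
      · refine ⟨p - q / q' * p', q / q', ?_, by positivity, ?_⟩
        · rw [sub_nonneg, div_mul_eq_mul_div, div_le_iff₀ hq0]
          exact hlt
        · rw [ea, eb, smul_add, smul_smul, smul_smul, div_mul_cancel₀ _ hq0.ne']
          module
      · exfalso
        push Not at hlt
        have hq1 : 0 < q := by
          refine lt_of_le_of_ne hq ?_
          rintro rfl
          nlinarith [mul_nonneg hp hq']
        refine hbn (h.comb_mem haH hxH hb.1 (s := q' / q) (t := p' - q' / q * p) (by positivity)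
          ?_ ?_)
        · rw [sub_nonneg, div_mul_eq_mul_div, div_le_iff₀ hq1]
          linarith
        · rw [ea, eb, smul_add, smul_smul, smul_smul, div_mul_cancel₀ _ hq1.ne']
          module
  by_cases hxH : x ∈ H
  · exact key x y hx hy hxH hxy hc hs p q p' q' hp hq hp' hq' ea eb
  · have hxH' := h.neg_mem hx.1 hxH
    by_cases hyH : y ∈ H
    · refine key y x hy hx hyH (by rwa [form_comm]) (by rwa [Set.pair_comm y x])
        (by rwa [Set.pair_comm y x]) q p q' p' hq hp hq' hp' ?_ ?_
      · rw [ea, add_comm]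
      · rw [eb, add_comm]
    · exact absurd (h.comb_mem_of_neg hxH' (h.neg_mem hy.1 hyH) ha.1 hp hq ea)
        (h.not_neg _ haH)

theorem Triple.eq_combination {i k j : Fin 3} (d : Triple i k j) {x : V} (h : x j = 0) :
    x = x i • simpleRoot i + x k • simpleRoot k := by
  conv_lhs => rw [d.eq_sum x, h, zero_smul, add_zero]

theorem Triple.eq_simpleRoot {i k j : Fin 3} (d : Triple i k j) {x : V} (hx : x ∈ posRoots)
    (hk : x k = 0) (hj : x j = 0) : x = simpleRoot i := by
  refine eq_of_smul_mem_posRoots (c := x i) (simpleRoot_mem_posRoots i) hx ?_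
  conv_lhs => rw [d.eq_combination hj, hk, zero_smul, add_zero]

/-- The relation makes `b i` and `b k` positive, so `b` lies in the branch of `α_j` and has negative
product with `e`. Pairing the relation with `b`, whose norm is 1, then needs a positive product of
`a` and `b`, which also puts `a` in that branch. -/
theorem one_le_form_of_relation {i k j : Fin 3} (d : Triple i k j) {e a b : V} (hej : e j = 0)
    (hei : 0 < e i) (hek : 0 < e k) (ha : a ∈ posRoots) (hb : b ∈ posRoots) (hbr : b ∈ region j)
    (hbj : 0 < b j) {l m : ℝ} (hl : 0 ≤ l) (hm : 0 < m) (rel : e + l • a = m • b) :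
    1 ≤ form a b ∧ 1 ≤ form (simpleRoot j) a := by
  have hpos : ∀ n, 0 < e n → 0 < b n := by
    intro n hn
    have h1 := congrFun rel n
    have h2 : 0 ≤ a n := posRoots_nonneg ha n
    simp only [Pi.add_apply, Pi.smul_apply, smul_eq_mul] at h1
    have : 0 < m * b n := by nlinarith [mul_nonneg hl h2]
    exact (mul_pos_iff_of_pos_left hm).1 this
  have hbT : 1 ≤ form (simpleRoot j) b := by
    rcases hbr with ⟨n, hn, h0⟩ | ⟨_, h⟩ | ⟨h, _⟩
    · rcases d.eq_or n with rfl | rfl | rfl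
      · exact absurd h0 (hpos _ hei).ne'
      · exact absurd h0 (hpos _ hek).ne'
      · exact absurd rfl hn
    · exact h
    · exact absurd hbj (not_lt.2 (h j))
  have h1 : form b (simpleRoot i) ≤ -1 :=
    form_le_neg_one_of_ne hb (simpleRoot_mem_posRoots i) d.ik.symm hbT (by simp [form_simpleRoot])
  have h2 : form b (simpleRoot k) ≤ -1 :=
    form_le_neg_one_of_ne hb (simpleRoot_mem_posRoots k) d.jk.symm hbT (by simp [form_simpleRoot])
  have h3 := congrArg (form b) rel
  rw [d.eq_combination hej] at h3
  simp only [map_add, map_smul, smul_eq_mul, form_self_of_mem_roots hb.1] at h3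
  have hab : 1 ≤ form a b := by
    refine (form_le_neg_one_or_one_le ha.1 hb.1).resolve_left fun hc => ?_
    rw [form_comm] at hc
    nlinarith [mul_nonneg hl (by linarith : 0 ≤ -1 - form b a)]
  exact ⟨hab, one_le_form_simpleRoot_of_one_le_form ha hb hab hbT⟩

section Core

variable {H W : Set V} {i k j : Fin 3} {N : List (Fin 3)}

/-- Replacing `b` by `refl a b` preserves the shape of the relation and only changes the coefficient
of `a`. By `fold_layer`, either one of the two relations lies in the layer of a shorter word, or
`refl a b` stays in `W`; then both `b` and `refl a b` would have product at least 1 with `a`,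
although these products are opposite. -/
theorem relation_contradiction_aux (hH : HalfSystem H) (d : Triple i k j)
    (ih : ∀ M : List (Fin 3), M.length < N.length → Free (H ∩ layer M)) (hW : W ⊆ layer N)
    (hN : ∀ r ∈ layer N, r ∈ W ∨ r j = 0) (hreg : W ⊆ region j) {η ζ a b : V} {c l m : ℝ}
    (hη : η ∈ H ∩ fans) (hζ : ζ ∈ H ∩ fans) (hc : 0 ≤ c) (hej : (η + c • ζ) j = 0)
    (hei : 0 < (η + c • ζ) i) (hek : 0 < (η + c • ζ) k) (ha : a ∈ posRoots) (haH : a ∈ H)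
    (hb : b ∈ posRoots) (hbW : b ∈ W) (hbH : -b ∈ H) (hbj : 0 < b j) (hl : 0 ≤ l) (hm : 0 < m)
    (rel : (η + c • ζ) + l • a = m • b) (hx : refl a b ∈ posRoots) : False := by
  obtain ⟨hab, haj⟩ := one_le_form_of_relation d hej hei hek ha hb (hreg hbW) hbj hl hm rel
  have hne : a ≠ b := fun e => hH.not_neg a haH (e ▸ hbH)
  -- Were `a - b` in the light cone, its reflection in `a` would be `-a - refl a b`, which is
  -- nonpositive.
  have hf : Forward (b - a) := by
    refine (forward_sub_or_sub ha.1 hb.1 hab hne).resolve_right fun hf => ?_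
    have h1 := hf.refl ha.1
    rw [map_sub, refl_self ha.1] at h1
    refine h1.2.2 (le_antisymm ?_ h1.2.1)
    have h2 := posRoots_nonneg hx
    have h3 := posRoots_nonneg ha
    intro n
    have h4 := h2 n
    have h5 := h3 n
    simp only [Pi.zero_apply, Pi.sub_apply, Pi.neg_apply] at *
    linarith
  have hxH : -refl a b ∈ H := by
    refine hH.neg_mem hx.1 fun hxH => hH.not_neg b ?_ hbH
    refine hH.comb_mem hxH haH hb.1 zero_le_one (by linarith : 0 ≤ 2 * form a b) ?_
    rw [refl_apply]
    module
  have rel' : (η + c • ζ) + (l - 2 * form a b * m) • a = m • refl a b := by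
    rw [refl_apply, smul_sub, ← rel]
    module
  have haj' : 0 < a j := by
    rw [d.form_simpleRoot_left] at haj
    have p1 : 0 ≤ a i := posRoots_nonneg ha i
    have p2 : 0 ≤ a k := posRoots_nonneg ha k
    linarith
  -- In the `j`-th coordinate the fan part vanishes, `a j > 0`, and the right side is nonnegative.
  have hl' : 0 ≤ l - 2 * form a b * m := by
    have h1 := congrFun rel' j
    have h2 : 0 ≤ refl a b j := posRoots_nonneg hx j
    rw [Pi.add_apply, hej, zero_add, Pi.smul_apply, Pi.smul_apply, smul_eq_mul, smul_eq_mul] at h1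
    by_contra hcon
    push Not at hcon
    nlinarith
  have contra : ∀ M : List (Fin 3), M.length < N.length → a ∈ layer M →
      ∀ r ∈ layer M, -r ∈ H → ∀ l' : ℝ, 0 ≤ l' → (η + c • ζ) + l' • a = m • r → False := by
    intro M hM haM r hr hrH l' hl' hrel
    refine ih M hM (-r) ⟨hrH, neg_mem_layer hr⟩ ?_
    rw [neg_neg]
    have : r = m⁻¹ • ((η + c • ζ) + l' • a) := by
      rw [hrel, smul_smul, inv_mul_cancel₀ hm.ne', one_smul]
    rw [this]
    refine smul_mem_nonnegSpan (inv_nonneg.2 hm.le) (add_mem_nonnegSpan (add_mem_nonnegSpan ?_ ?_)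
      (smul_mem_nonnegSpan hl' ?_))
    · exact subset_nonnegSpan ⟨hη.1, fans_subset_layer M hη.2⟩
    · exact smul_mem_nonnegSpan hc (subset_nonnegSpan ⟨hζ.1, fans_subset_layer M hζ.2⟩)
    · exact subset_nonnegSpan ⟨haH, haM⟩
  rcases fold_layer N a ha with ⟨M, hM, haM, h⟩ | h
  · rcases h b (hW hbW) with hbM | hbM
    · exact contra M hM haM b hbM hbH l hl rel
    · exact contra M hM haM _ hbM hxH _ hl' rel'
  · have hxj : 0 ≤ refl a b j := posRoots_nonneg hx j
    -- If the coordinate vanished, so would the coefficient of `a`; then `refl a b` would be a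
    -- nonnegative combination of `η` and `ζ` and lie in `H`.
    have hx0 : refl a b j ≠ 0 := by
      intro h0
      have h1 := congrFun rel' j
      rw [Pi.add_apply, hej, zero_add, Pi.smul_apply, Pi.smul_apply, h0, smul_zero, smul_eq_mul]
        at h1
      have h2 := (mul_eq_zero.1 h1).resolve_right haj'.ne'
      rw [h2, zero_smul, add_zero] at rel'
      refine hH.not_neg (refl a b) ?_ hxH
      refine hH.comb_mem hη.1 hζ.1 hx.1 (inv_nonneg.2 hm.le) (mul_nonneg (inv_nonneg.2 hm.le) hc) ?_
      rw [mul_smul, ← smul_add, rel', smul_smul, inv_mul_cancel₀ hm.ne', one_smul]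
    have hxW : refl a b ∈ W := (hN _ (h b (hW hbW) hf)).resolve_right hx0
    have := (one_le_form_of_relation d hej hei hek ha hx (hreg hxW) (lt_of_le_of_ne hxj hx0.symm)
      hl' hm rel').1
    have h1 := form_refl ha.1 a (refl a b)
    rw [refl_refl ha.1, refl_self ha.1, map_neg, LinearMap.neg_apply] at h1
    linarith

theorem relation_contradiction (hH : HalfSystem H) (d : Triple i k j)
    (ih : ∀ M : List (Fin 3), M.length < N.length → Free (H ∩ layer M)) (hW : W ⊆ layer N)
    (hN : ∀ r ∈ layer N, r ∈ W ∨ r j = 0) (hreg : W ⊆ region j) {η ζ a b : V} {c l m : ℝ}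
    (hη : η ∈ H ∩ fans) (hζ : ζ ∈ H ∩ fans) (hc : 0 ≤ c) (hej : (η + c • ζ) j = 0)
    (hei : 0 < (η + c • ζ) i) (hek : 0 < (η + c • ζ) k) (ha : a ∈ posRoots) (haH : a ∈ H)
    (hb : b ∈ posRoots) (hbW : b ∈ W) (hbH : -b ∈ H) (hbj : 0 < b j) (hl : 0 ≤ l)
    (rel : (η + c • ζ) + l • a = m • b) : False := by
  obtain ⟨x, hx, -, -, hxH, -, -, -, hxb, s, t, hs, ht, e⟩ := hH.exists_canonical ha haH hb hbH
  have rel' : (η + c • ζ) + (l * s) • x = (m - l * t) • b := by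
    rw [sub_smul, ← rel, e]
    module
  refine relation_contradiction_aux hH d ih hW hN hreg hη hζ hc hej hei hek hx hxH hb hbW hbH hbj
    (mul_nonneg hl hs) ?_ rel' hxb
  have h1 := congrFun rel' i
  have h2 : 0 ≤ x i := posRoots_nonneg hx i
  have h3 : 0 ≤ b i := posRoots_nonneg hb i
  rw [Pi.add_apply, Pi.smul_apply, Pi.smul_apply, smul_eq_mul, smul_eq_mul] at h1
  by_contra hcon
  push Not at hcon
  nlinarith [mul_nonneg (mul_nonneg hl hs) h2]

/-- The mediant inequality: the ratio `f / g` of a sum with positive denominators is at most the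
largest ratio of the summands. -/
theorem exists_ratio_le {S : Set V} (f g : V →ₗ[ℝ] ℝ) (hg : ∀ v ∈ S, 0 < g v) {x : V}
    (hx : x ∈ nonnegSpan S) : x = 0 ∨ 0 < g x ∧ ∃ a ∈ S, f x * g a ≤ f a * g x := by
  refine nonnegSpan_induction (p := fun x => x = 0 ∨ 0 < g x ∧ ∃ a ∈ S, f x * g a ≤ f a * g x)
    (fun x hx => Or.inr ⟨hg x hx, x, hx, le_rfl⟩) (Or.inl rfl) ?_ ?_ hx
  · rintro x y - - (rfl | ⟨h1, a, ha, h2⟩) hy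
    · simpa using hy
    rcases hy with rfl | ⟨h3, b, hb, h4⟩
    · rw [add_zero]
      exact Or.inr ⟨h1, a, ha, h2⟩
    refine Or.inr ⟨by rw [map_add]; positivity, ?_⟩
    have pa := hg a ha
    have pb := hg b hb
    simp only [map_add]
    by_cases hab : f a * g b ≤ f b * g a
    · refine ⟨b, hb, ?_⟩
      have : f x * g b ≤ f b * g x := by
        have h5 : g a * (f x * g b) ≤ g a * (f b * g x) := by nlinarith
        exact le_of_mul_le_mul_left h5 pa
      nlinarith
    · refine ⟨a, ha, ?_⟩
      push Not at hab
      have : f y * g a ≤ f a * g y := by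
        have h5 : g b * (f y * g a) ≤ g b * (f a * g y) := by nlinarith
        exact le_of_mul_le_mul_left h5 pb
      nlinarith
  · rintro c x hc - (rfl | ⟨h1, a, ha, h2⟩)
    · exact Or.inl (smul_zero c)
    rcases hc.eq_or_lt with rfl | hc
    · exact Or.inl (zero_smul ℝ x)
    · refine Or.inr ⟨by rw [map_smul]; exact mul_pos hc h1, a, ha, ?_⟩
      simp only [map_smul, smul_eq_mul]
      nlinarith

/-- In a vanishing combination modulo `α_i` and `α_k` two members of `H` of opposite signs are
separated in slope. -/
theorem exists_pair_of_mem_nonnegSpan (hH : HalfSystem H) (d : Triple i k j) (hWr : W ⊆ roots)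
    (hreg : W ⊆ region j) (hi : simpleRoot i ∈ H) (hk : -simpleRoot k ∈ H) {s t : ℝ} (hs : 0 < s)
    (ht : 0 < t) {x : V} (hx : x ∈ nonnegSpan (H ∩ W)) (hxj : x j = 0) (hx0 : x ≠ 0)
    (hl : 0 ≤ x k * s - x i * t) :
    ∃ a ∈ posRoots, a ∈ H ∩ W ∧ ∃ b ∈ posRoots, -b ∈ H ∩ W ∧ 0 < a j ∧ 0 < b j ∧
      (b k * s - b i * t) * a j ≤ (a k * s - a i * t) * b j := by
  set A : Set V := {a | a ∈ posRoots ∧ a ∈ H ∩ W ∧ 0 < a j} with hA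
  set B : Set V := {b | b ∈ posRoots ∧ -b ∈ H ∩ W ∧ 0 < b j} with hB
  -- Separate the generators by sign. Those with vanishing `j`-th coordinate are only `α_i` and
  -- `-α_k`, because `region j` contains no other roots of that fan up to sign.
  have hdec : ∃ p ∈ nonnegSpan A, ∃ n ∈ nonnegSpan B, ∃ b c : ℝ, 0 ≤ b ∧ 0 ≤ c ∧
      x = p - n + b • simpleRoot i - c • simpleRoot k := by
    refine nonnegSpan_induction (p := fun x => ∃ p ∈ nonnegSpan A, ∃ n ∈ nonnegSpan B,
      ∃ b c : ℝ, 0 ≤ b ∧ 0 ≤ c ∧ x = p - n + b • simpleRoot i - c • simpleRoot k) ?_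
      ⟨0, zero_mem_nonnegSpan, 0, zero_mem_nonnegSpan, 0, 0, le_rfl, le_rfl, by simp⟩ ?_ ?_ hx
    · intro v hv
      have small : ∀ v ∈ posRoots, (v ∈ W ∨ -v ∈ W) → v j = 0 →
          v = simpleRoot i ∨ v = simpleRoot k := by
        intro v hvp hvW hvj
        have hvr : v ∈ region j := by
          rcases hvW with h | h
          · exact hreg h
          · simpa using neg_mem_region (hreg h)
        have hp := posRoots_nonneg hvp
        have pi : 0 ≤ v i := hp i
        have pk : 0 ≤ v k := hp k
        rcases hvr with ⟨n, hn, h0⟩ | ⟨_, h⟩ | ⟨h, _⟩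
        · rcases d.eq_or n with rfl | rfl | rfl
          · exact Or.inr (d.swap.eq_simpleRoot hvp h0 hvj)
          · exact Or.inl (d.eq_simpleRoot hvp h0 hvj)
          · exact absurd rfl hn
        · rw [d.form_simpleRoot_left] at h
          linarith
        · exact (not_nonneg_and_nonpos_of_mem_roots hvp.1 hp h).elim
      rcases mem_posRoots_or_neg_mem (hWr hv.2) with hp | hp
      · have pj : 0 ≤ v j := posRoots_nonneg hp j
        rcases pj.eq_or_lt with h0 | h0
        · rcases small v hp (Or.inl hv.2) h0.symm with e | e
          · exact ⟨0, zero_mem_nonnegSpan, 0, zero_mem_nonnegSpan, 1, 0, zero_le_one, le_rfl,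
              by rw [e]; simp⟩
          · exact absurd hk (hH.not_neg _ (e ▸ hv.1))
        · exact ⟨v, subset_nonnegSpan ⟨hp, hv, h0⟩, 0, zero_mem_nonnegSpan, 0, 0, le_rfl, le_rfl,
            by simp⟩
      · have pj : 0 ≤ (-v) j := posRoots_nonneg hp j
        rcases pj.eq_or_lt with h0 | h0
        · rcases small (-v) hp (Or.inr (by simpa using hv.2)) h0.symm with e | e
          · exact absurd hv.1 (fun hv1 => hH.not_neg _ hi (by rw [← e]; simpa using hv1))
          · exact ⟨0, zero_mem_nonnegSpan, 0, zero_mem_nonnegSpan, 0, 1, le_rfl, zero_le_one,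
              by rw [← e]; simp⟩
        · exact ⟨0, zero_mem_nonnegSpan, -v, subset_nonnegSpan ⟨hp, by simpa using hv, h0⟩, 0, 0,
            le_rfl, le_rfl, by simp⟩
    · rintro x y - - ⟨p, hp, n, hn, b, c, hb, hc, rfl⟩ ⟨p', hp', n', hn', b', c', hb', hc', rfl⟩
      exact ⟨p + p', add_mem_nonnegSpan hp hp', n + n', add_mem_nonnegSpan hn hn', b + b', c + c',
        by positivity, by positivity, by module⟩
    · rintro r x hr - ⟨p, hp, n, hn, b, c, hb, hc, rfl⟩
      exact ⟨r • p, smul_mem_nonnegSpan hr hp, r • n, smul_mem_nonnegSpan hr hn, r * b, r * c,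
        by positivity, by positivity, by module⟩
  obtain ⟨p, hp, n, hn, b, c, hb, hc, e⟩ := hdec
  let g : V →ₗ[ℝ] ℝ := LinearMap.proj j
  -- The functional `f` is nonpositive on `α_i` and `-α_k`, so dropping these terms leaves `f n ≤ f
  -- p` with `p j = n j`: some positive part has at least the ratio of some negative part.
  let f : V →ₗ[ℝ] ℝ := s • LinearMap.proj k - t • LinearMap.proj i
  have hf : ∀ v, f v = v k * s - v i * t := fun v => by simp [f, mul_comm]
  have hg : ∀ v, g v = v j := fun v => rfl
  have ej : p j = n j := by
    have := congrFun e j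
    simp [hxj, simpleRoot_ne d.ik.symm, simpleRoot_ne d.jk.symm] at this
    linarith
  have ef : f x = f p - f n - b * t - c * s := by
    rw [e]
    simp only [hf, Pi.sub_apply, Pi.add_apply, Pi.smul_apply, simpleRoot_same, simpleRoot_ne d.ij,
      simpleRoot_ne d.ij.symm, smul_eq_mul]
    ring
  rw [← hf, ef] at hl
  have hbt := mul_nonneg hb ht.le
  have hcs := mul_nonneg hc hs.le
  have h1 := exists_ratio_le f g (fun v hv => hv.2.2) hp
  have h2 := exists_ratio_le (-f) g (fun v hv => hv.2.2) hn
  simp only [hg, LinearMap.neg_apply] at h1 h2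
  rcases h1 with rfl | ⟨hp0, a, ha, h1⟩
  · rcases h2 with rfl | ⟨hn0, -⟩
    · exfalso
      simp only [map_zero] at hl
      have hb0 : b = 0 := by
        have : b * t = 0 := by linarith
        exact (mul_eq_zero.1 this).resolve_right ht.ne'
      have hc0 : c = 0 := by
        have : c * s = 0 := by linarith
        exact (mul_eq_zero.1 this).resolve_right hs.ne'
      apply hx0
      rw [e, hb0, hc0]
      simp
    · rw [← ej] at hn0
      exact absurd hn0 (lt_irrefl _)
  · rcases h2 with rfl | ⟨hn0, b', hb', h2⟩
    · rw [ej] at hp0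
      exact absurd hp0 (lt_irrefl _)
    · refine ⟨a, ha.1, ha.2.1, b', hb'.1, hb'.2.1, ha.2.2, hb'.2.2, ?_⟩
      rw [← hf, ← hf]
      have pa := ha.2.2
      have pb := hb'.2.2
      have hfpn : f n ≤ f p := by linarith
      rw [← ej] at h2
      have : p j * (f b' * a j) ≤ p j * (f a * b' j) := by
        have h3 : f n * (a j * b' j) ≤ f p * (a j * b' j) :=
          mul_le_mul_of_nonneg_right hfpn (by positivity)
        nlinarith
      exact le_of_mul_le_mul_left this hp0

/-- If `-η` were in the cone, slope separation would give one `a` in `H` and one `b` outside with `b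
j • a - a j • b` in the fan plane. Expressed through `η` and `α_i`, this contradicts either freeness
of `H ∩ W` or `relation_contradiction`. -/
theorem neg_not_mem_nonnegSpan_of_pos (hH : HalfSystem H) (d : Triple i k j)
    (ih : ∀ M : List (Fin 3), M.length < N.length → Free (H ∩ layer M)) (hW : W ⊆ layer N)
    (hN : ∀ r ∈ layer N, r ∈ W ∨ r j = 0) (hreg : W ⊆ region j) (hneg : ∀ r ∈ W, -r ∈ W)
    (hfree : Free (H ∩ W)) (hiW : simpleRoot i ∈ W)
    (hi : simpleRoot i ∈ H) (hk : -simpleRoot k ∈ H) {η : V} (hη : η ∈ posRoots)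
    (hηj : η j = 0) (hηH : η ∈ H) : -η ∉ nonnegSpan (H ∩ W) := by
  intro hn
  have hWr : W ⊆ roots := hW.trans (layer_subset_roots N)
  have h0i : 0 ≤ η i := posRoots_nonneg hη i
  have h0k : 0 ≤ η k := posRoots_nonneg hη k
  have hs : 0 < η i := by
    refine lt_of_le_of_ne h0i fun h => ?_
    exact hH.not_neg _ (d.swap.eq_simpleRoot hη h.symm hηj ▸ hηH) hk
  have ht : 0 < η k := by
    refine lt_of_le_of_ne h0k fun h => ?_
    have e := d.eq_simpleRoot hη h.symm hηj
    rw [e] at hn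
    exact hfree _ ⟨hi, hiW⟩ hn
  have hη0 := ne_zero_of_mem_roots hη.1
  obtain ⟨a, ha, haW, b, hb, hbW, haj, hbj, hab⟩ :=
    exists_pair_of_mem_nonnegSpan hH d hWr hreg hi hk hs ht hn (by simp [hηj])
      (by simpa using hη0) (by simp; linarith)
  -- `T` matches the `k`-th coordinates in `rel` and `S` the `i`-th ones; the slope inequality says
  -- exactly that `S ≥ 0`.
  obtain ⟨T, hT⟩ : ∃ T, T = (b j * a k - a j * b k) / η k := ⟨_, rfl⟩
  obtain ⟨S, hS⟩ : ∃ S, S = T * η i - (b j * a i - a j * b i) := ⟨_, rfl⟩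
  have hTk : T * η k = b j * a k - a j * b k := by rw [hT, div_mul_cancel₀ _ ht.ne']
  have hS0 : 0 ≤ S := by
    have : 0 ≤ η k * S := by
      rw [hS]
      have : η k * (T * η i - (b j * a i - a j * b i)) =
        (T * η k) * η i - η k * (b j * a i - a j * b i) := by ring
      rw [this, hTk]
      linarith
    exact nonneg_of_mul_nonneg_right this ht
  have rel : b j • a + S • simpleRoot i = T • η + a j • b := by
    apply d.ext
    · simp [hS]
      ring
    · simp [simpleRoot_ne d.ij.symm]
      linarith
    · simp [simpleRoot_ne d.ik.symm, hηj]
      ring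
  have hiHW : simpleRoot i ∈ nonnegSpan (H ∩ W) := subset_nonnegSpan ⟨hi, hiW⟩
  have hTneg : T < 0 := by
    by_contra hT0
    push Not at hT0
    rcases hT0.eq_or_lt with hT0 | hT0
    · refine hfree (-b) hbW ?_
      rw [neg_neg]
      have : b = (a j)⁻¹ • (b j • a + S • simpleRoot i) := by
        rw [rel, ← hT0, zero_smul, zero_add, smul_smul, inv_mul_cancel₀ haj.ne', one_smul]
      rw [this]
      exact smul_mem_nonnegSpan (inv_nonneg.2 haj.le)
        (comb_mem_nonnegSpan (subset_nonnegSpan haW) hiHW hbj.le hS0)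
    · refine hη0 (neg_eq_zero.1 (hfree.eq_zero hn ?_))
      rw [neg_neg]
      have : η = T⁻¹ • ((b j • a + S • simpleRoot i) + a j • -b) := by
        rw [rel, smul_neg, add_neg_cancel_right, smul_smul, inv_mul_cancel₀ hT0.ne', one_smul]
      rw [this]
      exact smul_mem_nonnegSpan (inv_nonneg.2 hT0.le) (add_mem_nonnegSpan
        (comb_mem_nonnegSpan (subset_nonnegSpan haW) hiHW hbj.le hS0)
        (smul_mem_nonnegSpan haj.le (subset_nonnegSpan hbW)))
  -- For `T < 0`, dividing by `-T` brings the relation to the form `η + c α_i + l a = m b`.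
  have hc : 0 ≤ (-T)⁻¹ * S := mul_nonneg (inv_nonneg.2 (by linarith)) hS0
  refine relation_contradiction hH d ih hW hN hreg (η := η) (ζ := simpleRoot i) (a := a) (b := b)
    (c := (-T)⁻¹ * S) (l := (-T)⁻¹ * b j) (m := (-T)⁻¹ * a j) ⟨hηH, hη.1, j, hηj⟩
    ⟨hi, simpleRoot_mem_fans i⟩ hc ?_ ?_ ?_ ha haW.1 hb (by simpa using hneg _ hbW.2) hbW.1 hbj
    (mul_nonneg (inv_nonneg.2 (by linarith)) hbj.le) ?_
  · simp [hηj, simpleRoot_ne d.ik.symm]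
  · simp only [Pi.add_apply, Pi.smul_apply, simpleRoot_same, smul_eq_mul]
    linarith
  · simpa [simpleRoot_ne d.ij.symm] using ht
  · have hT1 : (-T)⁻¹ * (-T) = 1 := inv_mul_cancel₀ (by linarith)
    have : η = (-T)⁻¹ • (-T) • η := by rw [smul_smul, hT1, one_smul]
    conv_lhs => rw [this]
    rw [mul_smul, mul_smul, mul_smul, ← smul_add, ← smul_add]
    congr 1
    linear_combination (norm := module) rel

end Core

/-! ### Slopes within a fan, and adjoining a fan -/

/-- The roots whose `j`-th coordinate vanishes. -/
def fan (j : Fin 3) : Set V := {r | r ∈ roots ∧ r j = 0}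

theorem neg_mem_fan {j : Fin 3} {r : V} (h : r ∈ fan j) : -r ∈ fan j :=
  ⟨neg_mem_roots h.1, by simp [h.2]⟩

theorem free_posRoots : Free posRoots := by
  intro v hv hn
  have h0 : ∀ l, 0 ≤ (-v) l := fun l => nonneg_of_mem_nonnegSpan (h := LinearMap.proj l)
    (fun s hs => posRoots_nonneg hs l) hn
  exact not_nonneg_and_nonpos_of_mem_roots hv.1 (posRoots_nonneg hv)
    fun l => by simpa using h0 l

theorem Free.union_of_subset {S T : Set V} (h : Free S) (hT : T ⊆ nonnegSpan S)
    (h0 : (0 : V) ∉ T) : Free (S ∪ T) := by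
  have hsub : nonnegSpan (S ∪ T) ⊆ nonnegSpan S :=
    nonnegSpan_subset (Set.union_subset subset_nonnegSpan hT)
  rintro v (hv | hv) hn
  · exact h v hv (hsub hn)
  · exact h0 (h.eq_zero (hT hv) (hsub hn) ▸ hv)

section Fan

variable {H W : Set V} {i k j : Fin 3}

/-- With `α_k` outside `H`, the positive fan roots outside `H` are strictly steeper towards `α_k`
than those inside: otherwise `η` would lie between `ξ` and `α_k`. -/
theorem fan_slope_lt (hH : HalfSystem H) (d : Triple i k j) (hk : -simpleRoot k ∈ H) {η ξ : V}
    (hη : η ∈ posRoots) (hηH : η ∈ H) (hηj : η j = 0) (hξ : ξ ∈ posRoots)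
    (hξH : -ξ ∈ H) (hξj : ξ j = 0) : ξ i * η k < η i * ξ k := by
  by_contra! hc
  have hi : 0 ≤ ξ i := posRoots_nonneg hξ i
  have hηi : 0 ≤ η i := posRoots_nonneg hη i
  refine hH.not_neg _ hηH ?_
  rcases hi.eq_or_lt with h0 | h0
  · have e := d.swap.eq_simpleRoot hξ h0.symm hξj
    have : η i = 0 := by
      rw [e, simpleRoot_same, simpleRoot_ne d.ij, mul_one, zero_mul] at hc
      exact le_antisymm hc hηi
    rw [d.swap.eq_simpleRoot hη this hηj]
    exact hk
  · refine hH.comb_mem_of_neg hξH hk hη.1 (s := η i / ξ i) (t := η k - ξ k * η i / ξ i)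
      (by positivity) ?_ ?_
    · rw [sub_nonneg, div_le_iff₀ h0]
      linarith
    · apply d.ext
      · simp [simpleRoot_ne d.ij, div_mul_cancel₀ _ h0.ne']
      · simp
        ring
      · simp [simpleRoot_ne d.jk.symm, hηj, hξj]

/-- The extreme slopes of the cone are bounded by single roots. Sums are mediants; when the summands
have different signs, `fan_slope_lt` supplies the missing comparison. -/
theorem fan_slopes (hH : HalfSystem H) (d : Triple i k j) (hk : -simpleRoot k ∈ H) {c : V}
    (hc : c ∈ nonnegSpan (H ∩ fan j)) : c j = 0 ∧
    (0 < c k → ∃ η ∈ posRoots, η ∈ H ∧ η j = 0 ∧ 0 < η k ∧ c k * η i ≤ c i * η k) ∧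
    (c i < 0 → ∃ ξ ∈ posRoots, -ξ ∈ H ∧ ξ j = 0 ∧ 0 < ξ i ∧ c k * ξ i ≤ c i * ξ k) := by
  refine nonnegSpan_induction (p := fun c => c j = 0 ∧
    (0 < c k → ∃ η ∈ posRoots, η ∈ H ∧ η j = 0 ∧ 0 < η k ∧ c k * η i ≤ c i * η k) ∧
    (c i < 0 → ∃ ξ ∈ posRoots, -ξ ∈ H ∧ ξ j = 0 ∧ 0 < ξ i ∧ c k * ξ i ≤ c i * ξ k)) ?_
    (by simp) ?_ ?_ hc
  · rintro v ⟨hv, hvr, hvj⟩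
    refine ⟨hvj, fun h => ⟨v, ?_, hv, hvj, h, by rw [mul_comm]⟩,
      fun h => ⟨-v, ?_, by simpa using hv, by simpa using hvj, by simpa using h, ?_⟩⟩
    · refine (mem_posRoots_or_neg_mem hvr).resolve_right fun hn => ?_
      have : 0 ≤ (-v) k := posRoots_nonneg hn k
      simp at this
      linarith
    · refine (mem_posRoots_or_neg_mem hvr).resolve_left fun hn => ?_
      have : 0 ≤ v i := posRoots_nonneg hn i
      linarith
    · simp [mul_comm]
  · rintro x y - - ⟨hx0, hx1, hx2⟩ ⟨hy0, hy1, hy2⟩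
    have mix : ∀ x y : V,
        (0 < x k → ∃ η ∈ posRoots, η ∈ H ∧ η j = 0 ∧ 0 < η k ∧ x k * η i ≤ x i * η k) →
        (y i < 0 → ∃ ξ ∈ posRoots, -ξ ∈ H ∧ ξ j = 0 ∧ 0 < ξ i ∧ y k * ξ i ≤ y i * ξ k) →
        0 < x k → y k ≤ 0 →
        ∃ η ∈ posRoots, η ∈ H ∧ η j = 0 ∧ 0 < η k ∧ (x + y) k * η i ≤ (x + y) i * η k := by
      intro x y hx1 hy2 hxk hyk
      obtain ⟨η, h1, h2, h3, h4, h5⟩ := hx1 hxk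
      refine ⟨η, h1, h2, h3, h4, ?_⟩
      have h6 : 0 ≤ η i := posRoots_nonneg h1 i
      simp only [Pi.add_apply]
      have : y k * η i ≤ y i * η k := by
        by_cases hyi : 0 ≤ y i
        · nlinarith
        · push Not at hyi
          obtain ⟨ξ, g1, g2, g3, g4, g5⟩ := hy2 hyi
          have g6 := fan_slope_lt hH d hk h1 h2 h3 g1 g2 g3
          have : ξ i * (y k * η i) ≤ ξ i * (y i * η k) := by
            have e1 : (y k * ξ i) * η i ≤ (y i * ξ k) * η i := mul_le_mul_of_nonneg_right g5 h6
            nlinarith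
          exact le_of_mul_le_mul_left this g4
      linarith
    have mix' : ∀ x y : V,
        (0 < x k → ∃ η ∈ posRoots, η ∈ H ∧ η j = 0 ∧ 0 < η k ∧ x k * η i ≤ x i * η k) →
        (y i < 0 → ∃ ξ ∈ posRoots, -ξ ∈ H ∧ ξ j = 0 ∧ 0 < ξ i ∧ y k * ξ i ≤ y i * ξ k) →
        y i < 0 → 0 ≤ x i →
        ∃ ξ ∈ posRoots, -ξ ∈ H ∧ ξ j = 0 ∧ 0 < ξ i ∧ (x + y) k * ξ i ≤ (x + y) i * ξ k := by
      intro x y hx1 hy2 hyi hxi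
      obtain ⟨ξ, g1, g2, g3, g4, g5⟩ := hy2 hyi
      refine ⟨ξ, g1, g2, g3, g4, ?_⟩
      have g6 : 0 ≤ ξ k := posRoots_nonneg g1 k
      simp only [Pi.add_apply]
      have : x k * ξ i ≤ x i * ξ k := by
        by_cases hxk : x k ≤ 0
        · nlinarith
        · push Not at hxk
          obtain ⟨η, h1, h2, h3, h4, h5⟩ := hx1 hxk
          have h6 := fan_slope_lt hH d hk h1 h2 h3 g1 g2 g3
          have : η k * (x k * ξ i) ≤ η k * (x i * ξ k) := by
            have e1 : (x k * η i) * ξ k ≤ (x i * η k) * ξ k := mul_le_mul_of_nonneg_right h5 g6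
            nlinarith
          exact le_of_mul_le_mul_left this h4
      linarith
    refine ⟨by simp [hx0, hy0], fun h => ?_, fun h => ?_⟩
    · simp only [Pi.add_apply] at h
      by_cases hxk : 0 < x k
      · by_cases hyk : 0 < y k
        · obtain ⟨η, h1, h2, h3, h4, h5⟩ := hx1 hxk
          obtain ⟨θ, g1, g2, g3, g4, g5⟩ := hy1 hyk
          simp only [Pi.add_apply]
          by_cases hs : η i * θ k ≤ θ i * η k
          · refine ⟨η, h1, h2, h3, h4, ?_⟩
            have : θ k * (y k * η i) ≤ θ k * (y i * η k) := by nlinarith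
            have := le_of_mul_le_mul_left this g4
            linarith
          · push Not at hs
            refine ⟨θ, g1, g2, g3, g4, ?_⟩
            have : η k * (x k * θ i) ≤ η k * (x i * θ k) := by nlinarith
            have := le_of_mul_le_mul_left this h4
            linarith
        · exact mix x y hx1 hy2 hxk (not_lt.1 hyk)
      · rw [add_comm x y]
        exact mix y x hy1 hx2 (by linarith) (not_lt.1 hxk)
    · simp only [Pi.add_apply] at h
      by_cases hxi : x i < 0
      · by_cases hyi : y i < 0
        · obtain ⟨η, h1, h2, h3, h4, h5⟩ := hx2 hxi
          obtain ⟨θ, g1, g2, g3, g4, g5⟩ := hy2 hyi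
          simp only [Pi.add_apply]
          by_cases hs : η k * θ i ≤ θ k * η i
          · refine ⟨η, h1, h2, h3, h4, ?_⟩
            have : θ i * (y k * η i) ≤ θ i * (y i * η k) := by nlinarith
            have := le_of_mul_le_mul_left this g4
            linarith
          · push Not at hs
            refine ⟨θ, g1, g2, g3, g4, ?_⟩
            have : η i * (x k * θ i) ≤ η i * (x i * θ k) := by nlinarith
            have := le_of_mul_le_mul_left this h4
            linarith
        · rw [add_comm x y]
          exact mix' y x hy1 hx2 hxi (not_lt.1 hyi)
      · exact mix' x y hx1 hy2 (by linarith) (not_lt.1 hxi)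
  · rintro r x hr - ⟨h0, h1, h2⟩
    rcases hr.eq_or_lt with rfl | hr
    · simp
    refine ⟨by simp [h0], fun h => ?_, fun h => ?_⟩
    · obtain ⟨η, g1, g2, g3, g4, g5⟩ := h1 (by simpa [hr] using h)
      refine ⟨η, g1, g2, g3, g4, ?_⟩
      simp only [Pi.smul_apply, smul_eq_mul]
      nlinarith
    · obtain ⟨η, g1, g2, g3, g4, g5⟩ := h2 (by simpa [hr, mul_neg_iff, hr.le.not_gt] using h)
      refine ⟨η, g1, g2, g3, g4, ?_⟩
      simp only [Pi.smul_apply, smul_eq_mul]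
      nlinarith

/-- One fan root is enough: after scaling the root from `fan_slopes` to match one coordinate, its
slope bound makes the remaining multiple of `α_i` or `-α_k` nonnegative. -/
theorem fan_decomposition (hH : HalfSystem H) (d : Triple i k j) (hk : -simpleRoot k ∈ H) {c : V}
    (hc : c ∈ nonnegSpan (H ∩ fan j)) : ∃ a b e : ℝ, 0 ≤ a ∧ 0 ≤ b ∧ 0 ≤ e ∧
      (a = 0 ∧ c = b • simpleRoot i - e • simpleRoot k ∨
      ∃ η ∈ H ∩ fan j, c = a • η + b • simpleRoot i - e • simpleRoot k) := by
  obtain ⟨h0, h1, h2⟩ := fan_slopes hH d hk hc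
  by_cases hck : 0 < c k
  · obtain ⟨η, g1, g2, g3, g4, g5⟩ := h1 hck
    refine ⟨c k / η k, c i - c k * η i / η k, 0, by positivity, ?_, le_rfl,
      Or.inr ⟨η, ⟨g2, g1.1, g3⟩, ?_⟩⟩
    · rw [sub_nonneg, div_le_iff₀ g4]
      exact g5
    · apply d.ext
      · simp
        ring
      · simp [simpleRoot_ne d.ij.symm, div_mul_cancel₀ _ g4.ne']
      · simp [simpleRoot_ne d.ik.symm, h0, g3]
  · by_cases hci : c i < 0
    · obtain ⟨ξ, g1, g2, g3, g4, g5⟩ := h2 hci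
      refine ⟨-c i / ξ i, 0, c i * ξ k / ξ i - c k, div_nonneg (by linarith) g4.le, le_rfl, ?_,
        Or.inr ⟨-ξ, ⟨g2, neg_mem_roots g1.1, by simpa using g3⟩, ?_⟩⟩
      · rw [sub_nonneg, le_div_iff₀ g4]
        exact g5
      · apply d.ext
        · simp [simpleRoot_ne d.ij]
          rw [neg_div, neg_mul, neg_neg, div_mul_cancel₀ _ g4.ne']
        · simp
          ring
        · simp [simpleRoot_ne d.jk.symm, h0, g3]
    · refine ⟨0, c i, -c k, le_rfl, not_lt.1 hci, by linarith, Or.inl ⟨rfl, ?_⟩⟩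
      rw [neg_smul, sub_neg_eq_add]
      exact d.eq_combination h0

theorem mem_nonnegSpan_simple_of_mem_fan (hH : HalfSystem H) (d : Triple i k j)
    (hi : simpleRoot i ∈ H) (hk : simpleRoot k ∈ H) {r : V} (hr : r ∈ H ∩ fan j) :
    r ∈ posRoots ∧ r ∈ nonnegSpan {simpleRoot i, simpleRoot k} := by
  have hp : r ∈ posRoots := by
    refine (mem_posRoots_or_neg_mem hr.2.1).resolve_right fun hn => ?_
    refine hH.not_neg r hr.1 (hH.comb_mem hi hk hn.1 (posRoots_nonneg hn i)
      (posRoots_nonneg hn k) (d.eq_combination (by simp [hr.2.2])))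
  exact ⟨hp, mem_nonnegSpan_pair.2 ⟨r i, r k, posRoots_nonneg hp i, posRoots_nonneg hp k,
    d.eq_combination hr.2.2⟩⟩

/-- Up to negating the half system and exchanging the two simple roots of a fan, both simple
roots belong to the half system or just the first one does. -/
theorem fan_cases {P : Set V → Prop} (hP : ∀ H, P {r | -r ∈ H} → P H)
    (same : ∀ H, HalfSystem H → simpleRoot i ∈ H → simpleRoot k ∈ H → P H)
    (mixed : ∀ H, HalfSystem H → simpleRoot i ∈ H → -simpleRoot k ∈ H → P H)
    (hH : HalfSystem H) : P H := by
  rcases hH.mem_or _ (simpleRoot_mem_roots i) with hi | hi <;>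
    rcases hH.mem_or _ (simpleRoot_mem_roots k) with hk | hk
  · exact same H hH hi hk
  · exact mixed H hH hi hk
  · exact hP H (mixed _ hH.neg hi (by simpa using hk))
  · exact hP H (same _ hH.neg hi hk)

theorem Free.of_neg {S : Set V} (hS : ∀ r ∈ S, -r ∈ S) (h : Free ({r | -r ∈ H} ∩ S)) :
    Free (H ∩ S) := by
  refine h.neg.mono fun r hr => ?_
  exact ⟨by simpa using hr.1, hS r hr.2⟩

theorem free_fan (hH : HalfSystem H) (j : Fin 3) : Free (H ∩ fan j) := by
  obtain ⟨i, k, d⟩ := Triple.exists_last j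
  refine fan_cases (i := i) (k := k) (P := fun H => Free (H ∩ fan j))
    (fun H h => Free.of_neg (fun r hr => neg_mem_fan hr) h) ?_ ?_ hH
  · intro H hH hi hk
    exact free_posRoots.mono fun r hr => (mem_nonnegSpan_simple_of_mem_fan hH d hi hk hr).1
  · intro H hH hi hk v hv hn
    obtain ⟨h0, h1, h2⟩ := fan_slopes hH d hk hn
    rcases mem_posRoots_or_neg_mem hv.2.1 with hp | hp
    · have pi : 0 ≤ v i := posRoots_nonneg hp i
      rcases pi.eq_or_lt with hvi | hvi
      · exact hH.not_neg _ (d.swap.eq_simpleRoot hp hvi.symm hv.2.2 ▸ hv.1) hk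
      · obtain ⟨ξ, g1, g2, g3, g4, g5⟩ := h2 (by simpa using hvi)
        have := fan_slope_lt hH d hk hp hv.1 hv.2.2 g1 g2 g3
        simp at g5
        linarith
    · have pk : 0 ≤ (-v) k := posRoots_nonneg hp k
      rcases pk.eq_or_lt with hvk | hvk
      · refine hH.not_neg _ hi ?_
        rw [← d.eq_simpleRoot hp hvk.symm h0]
        simpa using hv.1
      · obtain ⟨η, g1, g2, g3, g4, g5⟩ := h1 hvk
        have := fan_slope_lt hH d hk g1 g2 g3 hp (by simpa using hv.1) h0
        simp at g5 this
        linarith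

/-- A relation between the two cones involves, by `fan_decomposition`, just one new fan root `η`
besides `α_i` and `-α_k`, which already lie in `W`; it would put `-η` into the cone of `H ∩ W`. -/
theorem Free.union_fan (hH : HalfSystem H) (d : Triple i k j) (hi : simpleRoot i ∈ H)
    (hk : -simpleRoot k ∈ H) (hiW : simpleRoot i ∈ W) (hkW : -simpleRoot k ∈ W)
    (hfree : Free (H ∩ W)) (h : ∀ η ∈ H ∩ fan j, -η ∉ nonnegSpan (H ∩ W)) :
    Free (H ∩ (W ∪ fan j)) := by
  have base : ∀ b e : ℝ, 0 ≤ b → 0 ≤ e →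
      b • simpleRoot i - e • simpleRoot k ∈ nonnegSpan (H ∩ W) := by
    intro b e hb he
    rw [sub_eq_add_neg, ← smul_neg]
    exact comb_mem_nonnegSpan (subset_nonnegSpan ⟨hi, hiW⟩) (subset_nonnegSpan ⟨hk, hkW⟩) hb he
  have red : ∀ p ∈ nonnegSpan (H ∩ W), ∀ c ∈ nonnegSpan (H ∩ fan j), p + c = 0 → c = 0 := by
    intro p hp c hc hpc
    obtain ⟨a, b, e, ha, hb, he, hcase⟩ := fan_decomposition hH d hk hc
    have hc' : c ∈ nonnegSpan (H ∩ W) := by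
      rcases hcase with ⟨-, rfl⟩ | ⟨η, hη, rfl⟩
      · exact base b e hb he
      · rcases ha.eq_or_lt with rfl | ha
        · rw [zero_smul, zero_add]
          exact base b e hb he
        · refine absurd ?_ (h η hη)
          have : -η = a⁻¹ • (p + (b • simpleRoot i - e • simpleRoot k)) := by
            rw [eq_neg_of_add_eq_zero_left hpc]
            have h1 : -(a • η + b • simpleRoot i - e • simpleRoot k) +
              (b • simpleRoot i - e • simpleRoot k) = a • -η := by module
            rw [h1, smul_smul, inv_mul_cancel₀ ha.ne', one_smul]
          rw [this]
          exact smul_mem_nonnegSpan (inv_nonneg.2 ha.le) (add_mem_nonnegSpan hp (base b e hb he))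
    refine hfree.eq_zero hc' ?_
    rwa [← eq_neg_of_add_eq_zero_left hpc]
  rw [Set.inter_union_distrib_left]
  intro v hv hn
  obtain ⟨p, hp, c, hc, e⟩ := exists_add_of_mem_nonnegSpan_union hn
  rcases hv with hv | hv
  · have h0 := red (v + p) (add_mem_nonnegSpan (subset_nonnegSpan hv) hp) c hc
      (by rw [add_assoc, e, add_neg_cancel])
    rw [h0, add_zero] at e
    exact hfree v hv (e ▸ hp)
  · have h0 := red p hp (c + v) (add_mem_nonnegSpan hc (subset_nonnegSpan hv))
      (by rw [← add_assoc, e, neg_add_cancel])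
    refine free_fan hH j v hv ?_
    rwa [← eq_neg_of_add_eq_zero_left h0]

/-- If `α_i` and `α_k` both lie in `H`, they already generate its part of the new fan. Only the
mixed case needs `neg_not_mem_nonnegSpan_of_pos`; a negative `η` is handled by negating `H`, which
exchanges the roles of `α_i` and `α_k`. -/
theorem Free.union_fan_layer {N : List (Fin 3)} (d : Triple i k j)
    (ih : ∀ M : List (Fin 3), M.length < N.length → ∀ H, HalfSystem H → Free (H ∩ layer M))
    (hN : layer N = W ∪ fan j) (hreg : W ⊆ region j) (hneg : ∀ r ∈ W, -r ∈ W)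
    (hfree : ∀ H, HalfSystem H → Free (H ∩ W)) (hiW : simpleRoot i ∈ W) (hkW : simpleRoot k ∈ W)
    (hH : HalfSystem H) : Free (H ∩ layer N) := by
  have hWN : W ⊆ layer N := hN ▸ Set.subset_union_left
  have hNW : ∀ r ∈ layer N, r ∈ W ∨ r j = 0 := fun r hr =>
    (hN ▸ hr : r ∈ W ∪ fan j).imp_right fun h => h.2
  refine fan_cases (i := i) (k := k) (P := fun H => Free (H ∩ layer N))
    (fun H h => Free.of_neg (fun r hr => neg_mem_layer hr) h) ?_ ?_ hH
  · intro H hH hi hk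
    rw [hN, Set.inter_union_distrib_left]
    refine (hfree H hH).union_of_subset (fun r hr => ?_) fun h0 => ?_
    · refine nonnegSpan_mono ?_ (mem_nonnegSpan_simple_of_mem_fan hH d hi hk hr).2
      rintro _ (rfl | rfl)
      · exact ⟨hi, hiW⟩
      · exact ⟨hk, hkW⟩
    · exact ne_zero_of_mem_roots h0.2.1 rfl
  · intro H hH hi hk
    rw [hN]
    refine Free.union_fan hH d hi hk hiW (hneg _ hkW) (hfree H hH) fun η hη => ?_
    rcases mem_posRoots_or_neg_mem hη.2.1 with hp | hp
    · exact neg_not_mem_nonnegSpan_of_pos hH d (fun M hM => ih M hM H hH) hWN hNW hreg hneg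
        (hfree H hH) hiW hi hk hp hη.2.2 hη.1
    · intro hn
      refine neg_not_mem_nonnegSpan_of_pos hH.neg d.swap (fun M hM => ih M hM _ hH.neg) hWN hNW hreg
        hneg (hfree _ hH.neg) hkW hk (by simpa using hi) hp (neg_mem_fan hη.2).2
        (by simpa using hη.1) ?_
      rw [← neg_mem_nonnegSpan_neg] at hn
      refine nonnegSpan_mono ?_ hn
      rintro r ⟨h1, h2⟩
      exact ⟨h1, by simpa using hneg _ h2⟩

/-- The planes of the two fans meet in the line of `α_j`. A relation across the fans therefore
splits along a multiple of `α_j`; `H` contains a sign of `α_j`, and freeness of a single fan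
excludes the relation. -/
theorem free_two_fans (hH : HalfSystem H) (d : Triple i k j) : Free (H ∩ (fan k ∪ fan i)) := by
  have key : ∀ i k : Fin 3, Triple i k j → ∀ v ∈ H ∩ fan k,
      -v ∉ nonnegSpan (H ∩ fan k ∪ H ∩ fan i) := by
    intro i k d v hv hn
    obtain ⟨p, hp, q, hq, e⟩ := exists_add_of_mem_nonnegSpan_union hn
    have hpk : p k = 0 := by
      refine nonnegSpan_induction (p := fun p => p k = 0) (fun r hr => hr.2.2) rfl ?_ ?_ hp
      · intro x y _ _ hx hy; simp [hx, hy]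
      · intro c x _ _ hx; simp [hx]
    have hqi : q i = 0 := by
      refine nonnegSpan_induction (p := fun p => p i = 0) (fun r hr => hr.2.2) rfl ?_ ?_ hq
      · intro x y _ _ hx hy; simp [hx, hy]
      · intro c x _ _ hx; simp [hx]
    have hqk : q k = 0 := by
      have := congrFun e k
      simpa [hpk, hv.2.2] using this
    have hq' : q = q j • simpleRoot j := by
      conv_lhs => rw [d.eq_sum q, hqi, hqk]
      simp
    have hvp : v + p ∈ nonnegSpan (H ∩ fan k) := add_mem_nonnegSpan (subset_nonnegSpan hv) hp
    have hvq : v + p = -q := by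
      rw [eq_neg_iff_add_eq_zero, add_assoc, e, add_neg_cancel]
    have hjfan : ∀ l, l ≠ j → ∀ σ : ℝ, σ = 1 ∨ σ = -1 → σ • simpleRoot j ∈ fan l := by
      intro l hl σ hσ
      rcases hσ with rfl | rfl
      · rw [one_smul]
        exact ⟨simpleRoot_mem_roots j, simpleRoot_ne hl⟩
      · rw [neg_one_smul]
        exact neg_mem_fan ⟨simpleRoot_mem_roots j, simpleRoot_ne hl⟩
    have contra : ∀ σ : ℝ, σ = 1 ∨ σ = -1 → ∀ t : ℝ, 0 < t → q = t • σ • simpleRoot j → False := by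
      intro σ hσ t ht hqt
      have hσr : σ • simpleRoot j ∈ roots := (hjfan i d.ik σ hσ).1
      rcases hH.mem_or _ hσr with h | h
      · refine free_fan hH k _ ⟨h, hjfan k d.jk σ hσ⟩ ?_
        have := smul_mem_nonnegSpan (inv_nonneg.2 ht.le) hvp
        rwa [hvq, smul_neg, hqt, smul_smul, inv_mul_cancel₀ ht.ne', one_smul] at this
      · refine free_fan hH i _ ⟨h, neg_mem_fan (hjfan i d.ik σ hσ)⟩ ?_
        have := smul_mem_nonnegSpan (inv_nonneg.2 ht.le) hq
        rwa [hqt, smul_smul, inv_mul_cancel₀ ht.ne', one_smul, ← neg_neg (σ • simpleRoot j)] at this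
    rcases lt_trichotomy (q j) 0 with h0 | h0 | h0
    · refine contra (-1) (Or.inr rfl) (-q j) (by linarith) ?_
      rw [smul_smul, neg_mul_neg, mul_one]
      exact hq'
    · rw [h0, zero_smul] at hq'
      rw [hq', add_zero] at e
      exact free_fan hH k v hv (e ▸ hp)
    · exact contra 1 (Or.inl rfl) (q j) h0 (by rwa [one_smul])
  rw [Set.inter_union_distrib_left]
  rintro v (hv | hv)
  · exact key i k d v hv
  · rw [Set.union_comm]
    exact key k i d.swap v hv

end Fan

/-! ### Half systems span pointed cones -/

theorem free_layer_aux (n : ℕ) : ∀ N : List (Fin 3), N.length = n → ∀ H, HalfSystem H →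
    Free (H ∩ layer N) := by
  induction n using Nat.strong_induction_on with
  | _ n ih =>
  have ih' : ∀ M : List (Fin 3), M.length < n → ∀ H, HalfSystem H → Free (H ∩ layer M) :=
    fun M hM => ih _ hM M rfl
  rintro (_ | ⟨j, L⟩) hn H hH
  · have d := triple_zero
    -- The empty word is the same situation: `fan 2` is adjoined to the other two fans, which lie in
    -- `region 2`, and the hypothesis on shorter words is vacuous.
    have e : layer [] = (fan 1 ∪ fan 0) ∪ fan 2 := by
      ext r
      change (r ∈ roots ∧ ∃ l, r l = 0) ↔ _
      constructor
      · rintro ⟨h, l, hl⟩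
        rcases d.eq_or l with rfl | rfl | rfl
        · exact Or.inl (Or.inr ⟨h, hl⟩)
        · exact Or.inl (Or.inl ⟨h, hl⟩)
        · exact Or.inr ⟨h, hl⟩
      · rintro ((⟨h, h'⟩ | ⟨h, h'⟩) | ⟨h, h'⟩)
        · exact ⟨h, 1, h'⟩
        · exact ⟨h, 0, h'⟩
        · exact ⟨h, 2, h'⟩
    refine Free.union_fan_layer d (by simp) e ?_ ?_ (fun H hH => free_two_fans hH d)
      (Or.inl ⟨simpleRoot_mem_roots 0, simpleRoot_ne d.ij.symm⟩)
      (Or.inr ⟨simpleRoot_mem_roots 1, simpleRoot_ne d.ij⟩) hH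
    · rintro r (h | h)
      · exact Or.inl ⟨1, d.jk, h.2⟩
      · exact Or.inl ⟨0, d.ik, h.2⟩
    · rintro r (h | h)
      · exact Or.inl (neg_mem_fan h)
      · exact Or.inr (neg_mem_fan h)
  · have hfree : ∀ H, HalfSystem H → Free (H ∩ {r | simpleReflection j r ∈ layer L}) := by
      intro H hH
      refine ((ih' L (by simp [← hn]) _ (hH.simpleReflection j)).simpleReflection j).mono ?_
      rintro r ⟨h1, h2⟩
      exact ⟨by simpa using h1, h2⟩
    -- If a prefix of `L` acts as `s_j`, nothing is added to the reflected layer; otherwise that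
    -- layer lies in `region j` and only `fan j` is new.
    by_cases hret : ∃ M, M <+: L ∧ act M = simpleReflection j
    · obtain ⟨M, hM, he⟩ := hret
      rw [layer_cons_eq hM he]
      exact hfree H hH
    push Not at hret
    obtain ⟨i, k, d⟩ := Triple.exists_last j
    have hmem : ∀ l, l ≠ j → fan l ⊆ {r | simpleReflection j r ∈ layer L} := by
      intro l hl r hr
      exact fans_subset_layer L ⟨simpleReflection_mem_roots j hr.1, l, by
        rw [simpleReflection_ne hl]; exact hr.2⟩
    refine Free.union_fan_layer (W := {r | simpleReflection j r ∈ layer L}) d (by rwa [hn]) ?_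
      (fun r hr => layer_subset_region hret hr) ?_ hfree
      (hmem k d.jk ⟨simpleRoot_mem_roots i, simpleRoot_ne d.ij.symm⟩)
      (hmem i d.ik ⟨simpleRoot_mem_roots k, simpleRoot_ne d.ij⟩) hH
    · apply Set.Subset.antisymm
      · rintro r (⟨hr, l, hl⟩ | hr)
        · by_cases hlj : l = j
          · exact Or.inr ⟨hr, hlj ▸ hl⟩
          · exact Or.inl (hmem l hlj ⟨hr, hl⟩)
        · exact Or.inl hr
      · rintro r (hr | hr)
        · exact Or.inr hr
        · exact Or.inl ⟨hr.1, j, hr.2⟩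
    · intro r hr
      have := neg_mem_layer hr
      rwa [← map_neg] at this

/-- The cone spanned by a half system is pointed. -/
theorem HalfSystem.free {H : Set V} (hH : HalfSystem H) : Free H := by
  have key : ∀ x ∈ nonnegSpan H, ∃ L, x ∈ nonnegSpan (H ∩ layer L) := by
    intro x hx
    refine nonnegSpan_induction (p := fun x => ∃ L, x ∈ nonnegSpan (H ∩ layer L)) ?_
      ⟨[], zero_mem_nonnegSpan⟩ ?_ ?_ hx
    · intro r hr
      obtain ⟨L, hL⟩ := exists_mem_layer (hH.subset hr)
      exact ⟨L, subset_nonnegSpan ⟨hr, hL⟩⟩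
    · rintro x y - - ⟨L, hL⟩ ⟨M, hM⟩
      obtain ⟨N, h1, h2⟩ := exists_layer_union L M
      exact ⟨N, add_mem_nonnegSpan (nonnegSpan_mono (Set.inter_subset_inter_right _ h1) hL)
        (nonnegSpan_mono (Set.inter_subset_inter_right _ h2) hM)⟩
    · rintro c x hc - ⟨L, hL⟩
      exact ⟨L, smul_mem_nonnegSpan hc hL⟩
  intro v hv hn
  obtain ⟨L, hL⟩ := key _ hn
  obtain ⟨M, hM⟩ := exists_mem_layer (hH.subset hv)
  obtain ⟨N, h1, h2⟩ := exists_layer_union L M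
  exact free_layer_aux _ N rfl H hH v ⟨hv, h2 hM⟩
    (nonnegSpan_mono (Set.inter_subset_inter_right _ h1) hL)

/-! ### Biclosed sets as half systems -/

theorem IsClosedRoots.comb_mem {R : Set V} (h : IsClosedRoots R) {u v r : V} (hu : u ∈ R)
    (hv : v ∈ R) (hr : r ∈ posRoots) {s t : ℝ} (hs : 0 ≤ s) (ht : 0 ≤ t)
    (e : r = s • u + t • v) : r ∈ R :=
  h.2 u hu v hv ⟨mem_nonnegSpan_pair.2 ⟨s, t, hs, ht, e⟩, hr⟩

/-- A biclosed set together with the negatives of the roots in its complement. -/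
theorem IsBiclosed.halfSystem {A : Set V} (hA : IsBiclosed A) :
    HalfSystem {r | r ∈ A ∨ -r ∈ posRoots \ A} := by
  obtain ⟨h1, h2⟩ := hA
  -- For `r = s u - t v`, solve for `u` or for `v`: if `r` were on the wrong side, closedness of the
  -- complement would exclude `u` from `A`, or closedness of `A` would put `v` into it.
  have key : ∀ u v r : V, u ∈ A → v ∈ posRoots \ A → r ∈ roots → ∀ s t : ℝ, 0 ≤ s → 0 ≤ t →
      r = s • u - t • v → r ∈ A ∨ -r ∈ posRoots \ A := by
    intro u v r hu hv hr s t hs ht e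
    rcases mem_posRoots_or_neg_mem hr with hp | hp
    · refine Or.inl ?_
      by_contra hrA
      have hs0 : 0 < s := by
        refine lt_of_le_of_ne hs ?_
        rintro rfl
        refine not_nonneg_and_nonpos_of_mem_roots hr (posRoots_nonneg hp) fun l => ?_
        have := mul_nonneg ht (posRoots_nonneg hv.1 l)
        rw [e]
        simpa using this
      refine (h2.comb_mem (r := u) (s := s⁻¹) (t := s⁻¹ * t) ⟨hp, hrA⟩ hv (h1.1 hu)
        (inv_nonneg.2 hs) (mul_nonneg (inv_nonneg.2 hs) ht) ?_).2 hu
      rw [e, mul_smul, ← smul_add, sub_add_cancel, smul_smul, inv_mul_cancel₀ hs0.ne', one_smul]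
    · refine Or.inr ⟨hp, fun hrA => ?_⟩
      have ht0 : 0 < t := by
        refine lt_of_le_of_ne ht ?_
        rintro rfl
        refine not_nonneg_and_nonpos_of_mem_roots hp.1 (posRoots_nonneg hp) fun l => ?_
        have := mul_nonneg hs (posRoots_nonneg (h1.1 hu) l)
        rw [e]
        simpa using this
      refine hv.2 (h1.comb_mem (s := t⁻¹) (t := t⁻¹ * s) hrA hu hv.1
        (inv_nonneg.2 ht) (mul_nonneg (inv_nonneg.2 ht) hs) ?_)
      rw [e, mul_smul, ← smul_add, neg_sub, sub_add_cancel, smul_smul, inv_mul_cancel₀ ht0.ne',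
        one_smul]
  refine ⟨?_, fun r hr => ?_, ?_, ?_⟩
  · rintro r (hr | hr)
    · exact (h1.1 hr).1
    · simpa using neg_mem_roots hr.1.1
  · rcases mem_posRoots_or_neg_mem hr with hp | hp
    · by_cases hrA : r ∈ A
      · exact Or.inl (Or.inl hrA)
      · exact Or.inr (Or.inr (by simpa using ⟨hp, hrA⟩))
    · by_cases hrA : -r ∈ A
      · exact Or.inr (Or.inl hrA)
      · exact Or.inl (Or.inr ⟨hp, hrA⟩)
  · rintro r (hr | hr) (hn | hn)
    · exact not_neg_mem_posRoots (h1.1 hr) (h1.1 hn)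
    · exact hn.2 (by simpa using hr)
    · exact hr.2 hn
    · exact not_neg_mem_posRoots hr.1 hn.1
  · intro u hu v hv r hr hc
    obtain ⟨s, t, hs, ht, e⟩ := mem_nonnegSpan_pair.1 hc
    rcases hu with hu | hu <;> rcases hv with hv | hv
    · refine Or.inl (h1.comb_mem hu hv (mem_posRoots.2 ⟨hr, ?_⟩) hs ht e)
      rw [e]
      exact add_nonneg (smul_nonneg hs (posRoots_nonneg (h1.1 hu)))
        (smul_nonneg ht (posRoots_nonneg (h1.1 hv)))
    · exact key u (-v) r hu hv hr s t hs ht (by rw [e]; module)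
    · exact key v (-u) r hv hu hr t s ht hs (by rw [e]; module)
    · have e' : -r = s • -u + t • -v := by rw [e]; module
      refine Or.inr (h2.comb_mem hu hv (mem_posRoots.2 ⟨neg_mem_roots hr, ?_⟩) hs ht e')
      rw [e']
      exact add_nonneg (smul_nonneg hs (posRoots_nonneg hu.1))
        (smul_nonneg ht (posRoots_nonneg hv.1))

/-- The cones spanned by a biclosed set and by its complement meet in zero only. -/
theorem IsBiclosed.eq_zero {A : Set V} (hA : IsBiclosed A) {x : V} (h1 : x ∈ nonnegSpan A)
    (h2 : x ∈ nonnegSpan (posRoots \ A)) : x = 0 := by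
  refine hA.halfSystem.free.eq_zero (nonnegSpan_mono (fun r hr => Or.inl hr) h1) ?_
  rw [← neg_mem_nonnegSpan_neg, neg_neg]
  exact nonnegSpan_mono (fun r hr => Or.inr (by simpa using hr)) h2

/-! ### Farkas' lemma and exit points -/

section Farkas

/-- Induction on the generators. If the functional separating `e` from `l` is negative on the new
generator `w`, project along `w` to its kernel; coefficients arising when undoing the projection
have the right sign. -/
theorem farkas_list_aux (n : ℕ) : ∀ (l : List V) (e : V), l.length = n →
    e ∈ nonnegSpan {x | x ∈ l} ∨ ∃ h : V →ₗ[ℝ] ℝ, (∀ s ∈ l, 0 ≤ h s) ∧ h e < 0 := by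
  induction n with
  | zero =>
    intro l e hl
    rw [List.length_eq_zero_iff] at hl
    subst hl
    by_cases he : e = 0
    · exact Or.inl (he ▸ zero_mem_nonnegSpan)
    · right
      obtain ⟨i, hi⟩ := Function.ne_iff.1 he
      rcases lt_or_gt_of_ne hi with h | h
      · exact ⟨LinearMap.proj i, by simp, h⟩
      · exact ⟨-LinearMap.proj i, by simp, by simpa using h⟩
  | succ n ih =>
    rintro (_ | ⟨w, l⟩) e hl
    · simp at hl
    have hl : l.length = n := by simpa using hl
    rcases ih l e hl with h | ⟨g, hg, hge⟩
    · exact Or.inl (nonnegSpan_mono (fun x hx => List.mem_cons_of_mem _ hx) h)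
    by_cases hgw : 0 ≤ g w
    · exact Or.inr ⟨g, by simpa using ⟨hgw, hg⟩, hge⟩
    push Not at hgw
    have hw : w ∈ nonnegSpan {x | x ∈ w :: l} := subset_nonnegSpan (by simp)
    let π : V →ₗ[ℝ] V := LinearMap.id - (g w)⁻¹ • g.smulRight w
    have hπ : ∀ v, π v = v - ((g w)⁻¹ * g v) • w := fun v => by simp [π, mul_smul]
    have hπw : π w = 0 := by rw [hπ, inv_mul_cancel₀ hgw.ne, one_smul, sub_self]
    rcases ih (l.map π) (π e) (by simpa using hl) with h | ⟨h, hh, hhe⟩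
    · left
      have h1 : π e ∈ nonnegSpan {x | x ∈ w :: l} := by
        refine nonnegSpan_subset ?_ h
        intro x hx
        obtain ⟨v, hv, rfl⟩ := List.mem_map.1 hx
        rw [hπ, sub_eq_add_neg, ← neg_smul]
        refine add_mem_nonnegSpan (subset_nonnegSpan (List.mem_cons_of_mem _ hv))
          (smul_mem_nonnegSpan ?_ hw)
        have := hg v hv
        rw [← neg_mul]
        exact mul_nonneg (by simpa using hgw.le) this
      have h2 : e = π e + ((g w)⁻¹ * g e) • w := by rw [hπ]; module
      rw [h2]
      exact add_mem_nonnegSpan h1 (smul_mem_nonnegSpan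
        (mul_nonneg_of_nonpos_of_nonpos (inv_nonpos.2 hgw.le) hge.le) hw)
    · refine Or.inr ⟨h ∘ₗ π, ?_, hhe⟩
      intro s hs
      rcases List.mem_cons.1 hs with rfl | hs
      · simp [hπw]
      · exact hh _ (List.mem_map.2 ⟨s, hs, rfl⟩)

/-- Farkas' lemma. -/
theorem farkas_list (l : List V) (e : V) :
    e ∈ nonnegSpan {x | x ∈ l} ∨ ∃ h : V →ₗ[ℝ] ℝ, (∀ s ∈ l, 0 ≤ h s) ∧ h e < 0 :=
  farkas_list_aux _ l e rfl

theorem exists_list_of_mem_nonnegSpan {S : Set V} {x : V} (hx : x ∈ nonnegSpan S) :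
    ∃ l : List V, (∀ s ∈ l, s ∈ S) ∧ x ∈ nonnegSpan {x | x ∈ l} := by
  refine nonnegSpan_induction (p := fun x => ∃ l : List V, (∀ s ∈ l, s ∈ S) ∧
    x ∈ nonnegSpan {x | x ∈ l}) (fun x hx => ⟨[x], by simpa, subset_nonnegSpan (by simp)⟩)
    ⟨[], by simp, zero_mem_nonnegSpan⟩ ?_ ?_ hx
  · rintro x y - - ⟨l, hl, hx⟩ ⟨m, hm, hy⟩
    refine ⟨l ++ m, fun s hs => (List.mem_append.1 hs).elim (hl s) (hm s), add_mem_nonnegSpan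
      (nonnegSpan_mono (fun x hx => List.mem_append_left _ hx) hx)
      (nonnegSpan_mono (fun x hx => List.mem_append_right _ hx) hy)⟩
  · rintro c x hc - ⟨l, hl, hx⟩
    exact ⟨l, hl, smul_mem_nonnegSpan hc hx⟩

/-- A ray that leaves a finitely generated cone does so at a point with a supporting functional. -/
theorem exists_exit (l : List V) {η e : V} (hη : η ∈ nonnegSpan {x | x ∈ l})
    (he : e ∉ nonnegSpan {x | x ∈ l}) : ∃ t : ℝ, 0 ≤ t ∧ η + t • e ∈ nonnegSpan {x | x ∈ l} ∧
      ∃ h : V →ₗ[ℝ] ℝ, (∀ s ∈ l, 0 ≤ h s) ∧ h e < 0 ∧ h (η + t • e) = 0 := by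
  set K := nonnegSpan {x | x ∈ l} with hK
  set T : Set ℝ := {t | 0 ≤ t ∧ η + t • e ∈ K} with hT
  have h0T : (0 : ℝ) ∈ T := ⟨le_rfl, by simpa using hη⟩
  have bound : ∀ h : V →ₗ[ℝ] ℝ, (∀ s ∈ l, 0 ≤ h s) → h e < 0 → ∀ t ∈ T, t ≤ h η / -h e := by
    intro h hh hhe t ht
    have := nonneg_of_mem_nonnegSpan hh ht.2
    rw [map_add, map_smul, smul_eq_mul] at this
    rw [le_div_iff₀ (by linarith)]
    linarith
  obtain ⟨h0, hh0, hhe0⟩ := (farkas_list l e).resolve_left he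
  have hbdd : BddAbove T := ⟨_, fun t ht => bound h0 hh0 hhe0 t ht⟩
  obtain ⟨t, ht⟩ : ∃ t, t = sSup T := ⟨_, rfl⟩
  have ht0 : 0 ≤ t := ht ▸ le_csSup hbdd h0T
  -- The supremum is attained: by Farkas, a point outside would be cut off by a functional that
  -- bounds all of `T` below `t`.
  have htK : η + t • e ∈ K := by
    refine (farkas_list l _).resolve_right ?_
    rintro ⟨h, hh, hhe⟩
    have hηh := nonneg_of_mem_nonnegSpan hh hη
    rw [map_add, map_smul, smul_eq_mul] at hhe
    have hen : h e < 0 := by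
      by_contra hc
      push Not at hc
      nlinarith [mul_nonneg ht0 hc]
    have : t ≤ h η / -h e := ht ▸ csSup_le ⟨0, h0T⟩ (bound h hh hen)
    rw [le_div_iff₀ (by linarith)] at this
    linarith
  refine ⟨t, ht0, htK, ?_⟩
  -- Adjoining the negative of the exit point forces a separating functional to vanish there. If `e`
  -- lay in the enlarged cone instead, the ray could be continued beyond `t`.
  rcases farkas_list (-(η + t • e) :: l) e with h | ⟨h, hh, hhe⟩
  · exfalso
    have hset : {x | x ∈ -(η + t • e) :: l} = {-(η + t • e)} ∪ {x | x ∈ l} := by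
      ext x
      simp
    rw [hset] at h
    obtain ⟨p, hp, q, hq, hpq⟩ := exists_add_of_mem_nonnegSpan_union h
    rw [← Set.pair_eq_singleton] at hp
    obtain ⟨c, c', hc, hc', rfl⟩ := mem_nonnegSpan_pair.1 hp
    have hq' : e + (c + c') • (η + t • e) = q := by
      linear_combination (norm := module) -hpq
    rcases (add_nonneg hc hc').eq_or_lt with h0 | h0
    · rw [← h0, zero_smul, add_zero] at hq'
      exact he (hq' ▸ hq)
    · have hmem : t + (c + c')⁻¹ ∈ T := by
        refine ⟨by positivity, ?_⟩
        have : η + (t + (c + c')⁻¹) • e = (c + c')⁻¹ • q := by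
          have hinv := inv_mul_cancel₀ h0.ne'
          generalize (c + c')⁻¹ = r at hinv
          rw [← hq', smul_add, smul_smul r, hinv]
          module
        rw [this]
        exact smul_mem_nonnegSpan (inv_nonneg.2 h0.le) hq
      have h1 : t + (c + c')⁻¹ ≤ t := by
        conv_rhs => rw [ht]
        exact le_csSup hbdd hmem
      have := inv_pos.2 h0
      linarith
  · have h1 : ∀ s ∈ l, 0 ≤ h s := fun s hs => hh s (List.mem_cons_of_mem _ hs)
    refine ⟨h, h1, hhe, le_antisymm ?_ (nonneg_of_mem_nonnegSpan h1 htK)⟩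
    have := hh _ List.mem_cons_self
    rw [map_neg] at this
    linarith

theorem mem_nonnegSpan_tight {S : Set V} {h : V →ₗ[ℝ] ℝ} (hS : ∀ s ∈ S, 0 ≤ h s) {x : V}
    (hx : x ∈ nonnegSpan S) (h0 : h x = 0) : x ∈ nonnegSpan {s | s ∈ S ∧ h s = 0} := by
  revert h0
  refine nonnegSpan_induction (p := fun x => h x = 0 → x ∈ nonnegSpan {s | s ∈ S ∧ h s = 0})
    (fun x hx h0 => subset_nonnegSpan ⟨hx, h0⟩) (fun _ => zero_mem_nonnegSpan) ?_ ?_ hx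
  · intro x y hx hy px py h0
    have h1 := nonneg_of_mem_nonnegSpan hS hx
    have h2 := nonneg_of_mem_nonnegSpan hS hy
    rw [map_add] at h0
    exact add_mem_nonnegSpan (px (by linarith)) (py (by linarith))
  · intro c x hc hx px h0
    rw [map_smul, smul_eq_mul] at h0
    rcases mul_eq_zero.1 h0 with rfl | h0
    · rw [zero_smul]
      exact zero_mem_nonnegSpan
    · exact smul_mem_nonnegSpan hc (px h0)

theorem eq_zero_of_mem_nonnegSpan_eq_zero {S : Set V} {h : V →ₗ[ℝ] ℝ} (hS : ∀ s ∈ S, h s = 0)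
    {x : V} (hx : x ∈ nonnegSpan S) : h x = 0 := by
  refine nonnegSpan_induction (p := fun x => h x = 0) hS (map_zero h) ?_ ?_ hx
  · intro x y _ _ hx hy
    rw [map_add, hx, hy, add_zero]
  · intro c x _ _ hx
    rw [map_smul, hx, smul_zero]

end Farkas

/-! ### Positive roots outside the cone of a union -/

theorem nonneg_of_mem_nonnegSpan_posRoots {S : Set V} (hS : S ⊆ posRoots) {x : V}
    (hx : x ∈ nonnegSpan S) : 0 ≤ x :=
  fun l => nonneg_of_mem_nonnegSpan (h := LinearMap.proj l) (fun _ hs => posRoots_nonneg (hS hs) l)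
    hx

/-- The simple roots are extremal: if one lies in the cone of a set of positive roots, it is a
member of the set. -/
theorem simpleRoot_mem_of_mem_nonnegSpan {S : Set V} (hS : S ⊆ posRoots) {i : Fin 3}
    (h : simpleRoot i ∈ nonnegSpan S) : simpleRoot i ∈ S := by
  have key : ∀ x ∈ nonnegSpan S, (∀ l, l ≠ i → x l = 0) → x = 0 ∨ simpleRoot i ∈ S := by
    intro x hx
    refine nonnegSpan_induction (p := fun x => (∀ l, l ≠ i → x l = 0) → x = 0 ∨ simpleRoot i ∈ S)
      ?_ (fun _ => Or.inl rfl) ?_ ?_ hx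
    · intro r hr h0
      obtain ⟨j, k, d⟩ := Triple.exists_last i
      right
      rw [← d.rotate.rotate.eq_simpleRoot (hS hr) (h0 j d.ik) (h0 k d.jk)]
      exact hr
    · intro x y hx hy px py h0
      have h1 : ∀ l, 0 ≤ x l := nonneg_of_mem_nonnegSpan_posRoots hS hx
      have h2 : ∀ l, 0 ≤ y l := nonneg_of_mem_nonnegSpan_posRoots hS hy
      have h3 : ∀ l, l ≠ i → x l + y l = 0 := h0
      rcases px fun l hl => by linarith [h1 l, h2 l, h3 l hl] with rfl | h
      · rcases py fun l hl => by linarith [h1 l, h2 l, h3 l hl] with rfl | h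
        · exact Or.inl (add_zero 0)
        · exact Or.inr h
      · exact Or.inr h
    · intro c x hc hx px h0
      by_cases hc0 : c = 0
      · exact Or.inl (by rw [hc0, zero_smul])
      · rcases px fun l hl => (mul_eq_zero.1 (h0 l hl)).resolve_left hc0 with rfl | h
        · exact Or.inl (smul_zero c)
        · exact Or.inr h
  refine (key _ h fun l hl => simpleRoot_ne hl).resolve_left ?_
  exact ne_zero_of_mem_roots (simpleRoot_mem_roots i)

section Binary

variable {A B : Set V}

theorem IsBiclosed.eq_zero_of_subset (hA : IsBiclosed A) {S : Set V} (hS : S ⊆ posRoots \ A)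
    {x : V} (h1 : x ∈ nonnegSpan A) (h2 : x ∈ nonnegSpan S) : x = 0 :=
  hA.eq_zero h1 (nonnegSpan_mono hS h2)

theorem exists_pair_coords {p q e : V} {h : V →ₗ[ℝ] ℝ} (hne : h ≠ 0) (hp : h p = 0) (hq : h q = 0)
    (he : h e = 0) (hpq : LinearIndependent ℝ ![p, q]) : ∃ a b : ℝ, e = a • p + b • q := by
  have h1 : Submodule.span ℝ {p, q} = LinearMap.ker h := by
    refine Submodule.eq_of_le_of_finrank_eq ?_ ?_
    · rw [Submodule.span_le]
      rintro x (rfl | rfl) <;> assumption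
    · have h2 := Module.Dual.finrank_ker_add_one_of_ne_zero (f := h) hne
      have h3 := finrank_span_eq_card hpq
      have h4 : Set.range ![p, q] = {p, q} := by
        ext x
        simp [eq_comm, or_comm]
      rw [h4] at h3
      simp at h2 h3
      omega
  have : e ∈ Submodule.span ℝ {p, q} := by
    rw [h1]
    exact he
  obtain ⟨a, b, h⟩ := Submodule.mem_span_pair.1 this
  exact ⟨a, b, h.symm⟩

/-- If `p` and `q` were proportional, `p + q` would lie in the cone of `A` or of `B` and in that of
the complement, so pointedness would make it zero. -/
theorem linearIndependent_of_mem (hA : IsBiclosed A) (hB : IsBiclosed B) {p q : V}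
    (hp : p ∈ nonnegSpan A) (hq : q ∈ nonnegSpan B)
    (hpq : p + q ∈ nonnegSpan (posRoots \ (A ∪ B))) (hne : p + q ≠ 0) :
    LinearIndependent ℝ ![p, q] := by
  have hNA : posRoots \ (A ∪ B) ⊆ posRoots \ A := fun r hr => ⟨hr.1, fun h => hr.2 (Or.inl h)⟩
  have hNB : posRoots \ (A ∪ B) ⊆ posRoots \ B := fun r hr => ⟨hr.1, fun h => hr.2 (Or.inr h)⟩
  have hp0 : 0 ≤ p := nonneg_of_mem_nonnegSpan_posRoots hA.1.1 hp
  have hq0 : 0 ≤ q := nonneg_of_mem_nonnegSpan_posRoots hB.1.1 hq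
  have hpne : p ≠ 0 := by
    rintro rfl
    rw [zero_add] at hne hpq
    exact hne (hB.eq_zero_of_subset hNB hq hpq)
  rw [LinearIndependent.pair_iff' hpne]
  intro c hc
  by_cases hc0 : 0 ≤ c
  · have : p + q = (1 + c) • p := by rw [← hc]; module
    refine hne (hA.eq_zero_of_subset hNA ?_ hpq)
    rw [this]
    exact smul_mem_nonnegSpan (by linarith) hp
  · push Not at hc0
    have hq1 : q = 0 := by
      refine le_antisymm ?_ hq0
      rw [← hc]
      intro l
      have := hp0 l
      simp only [Pi.zero_apply, Pi.smul_apply, smul_eq_mul] at *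
      nlinarith
    rw [hq1, add_zero] at hpq hne
    exact hne (hA.eq_zero_of_subset hNA hp hpq)

/-- For `a < 0`, either both coefficients are negative and `e` vanishes, or adding `-a` times `p +
q` leaves a positive multiple of `q` in the cone of the complement, against pointedness for `B`. -/
theorem coord_nonneg (hB : IsBiclosed B) {p q e : V}
    (hp0 : 0 ≤ p) (hq : q ∈ nonnegSpan B) (hqne : q ≠ 0)
    (hpq : p + q ∈ nonnegSpan (posRoots \ (A ∪ B))) (hli : LinearIndependent ℝ ![p, q])
    (he : e ∈ nonnegSpan (posRoots \ (A ∪ B))) {a b : ℝ} (hab : e = a • p + b • q) : 0 ≤ a := by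
  by_contra! ha
  have hNB : posRoots \ (A ∪ B) ⊆ posRoots \ B := fun r hr => ⟨hr.1, fun h => hr.2 (Or.inr h)⟩
  have hq0 : 0 ≤ q := nonneg_of_mem_nonnegSpan_posRoots hB.1.1 hq
  have he0 : 0 ≤ e := nonneg_of_mem_nonnegSpan_posRoots (fun r hr => hr.1) he
  by_cases hb : b ≤ a
  · have : e = 0 := by
      refine le_antisymm ?_ he0
      intro l
      have h1 := hp0 l
      have h2 := hq0 l
      rw [hab]
      simp only [Pi.zero_apply, Pi.add_apply, Pi.smul_apply, smul_eq_mul] at *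
      nlinarith
    rw [this] at hab
    exact ha.ne (LinearIndependent.pair_iff.1 hli a b hab.symm).1
  · push Not at hb
    refine hqne (hB.eq_zero_of_subset hNB hq ?_)
    have : q = (b - a)⁻¹ • (e + (-a) • (p + q)) := by
      have : e + (-a) • (p + q) = (b - a) • q := by rw [hab]; module
      rw [this, smul_smul, inv_mul_cancel₀ (by linarith), one_smul]
    rw [this]
    exact smul_mem_nonnegSpan (inv_nonneg.2 (by linarith)) (add_mem_nonnegSpan he
      (smul_mem_nonnegSpan (by linarith) hpq))

/-- Faces of the simplicial cone: a nonnegative vector supported where `y` is supported uses only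
simple roots that `y` uses. -/
theorem mem_nonnegSpan_simple {S : Set V} {x y : V} (hx0 : 0 ≤ x)
    (hy : y ∈ nonnegSpan (Set.range simpleRoot \ S)) (hxy : ∀ l, y l = 0 → x l = 0) :
    x ∈ nonnegSpan (Set.range simpleRoot \ S) := by
  have hy0 : ∀ l, simpleRoot l ∈ S → y l = 0 := by
    intro l hl
    refine eq_zero_of_mem_nonnegSpan_eq_zero (h := LinearMap.proj l) ?_ hy
    rintro _ ⟨⟨i, rfl⟩, hi⟩
    refine simpleRoot_ne ?_
    rintro rfl
    exact hi hl
  have key : ∀ i, x i • simpleRoot i ∈ nonnegSpan (Set.range simpleRoot \ S) := by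
    intro i
    by_cases hi : simpleRoot i ∈ S
    · rw [hxy i (hy0 i hi), zero_smul]
      exact zero_mem_nonnegSpan
    · exact smul_mem_nonnegSpan (hx0 i) (subset_nonnegSpan ⟨⟨i, rfl⟩, hi⟩)
  rw [triple_zero.eq_sum x]
  exact add_mem_nonnegSpan (add_mem_nonnegSpan (key _) (key _)) (key _)

/-- A plane through a common point of the cones of `A ∪ B` and of its complement, spanned by a
member of the cone of `A` and one of `B`, has all positive roots outside the cone of `A ∪ B` on
one side. -/
theorem no_opposite_sides (hA : IsBiclosed A) (hB : IsBiclosed B) {p q : V}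
    (hp : p ∈ nonnegSpan A) (hq : q ∈ nonnegSpan B)
    (hpq : p + q ∈ nonnegSpan (posRoots \ (A ∪ B))) (hne : p + q ≠ 0) {h : V →ₗ[ℝ] ℝ}
    (h0 : h ≠ 0) (hhp : h p = 0) (hhq : h q = 0) {y y' : V} (hy : y ∈ posRoots)
    (hyU : y ∉ nonnegSpan (A ∪ B)) (hy' : y' ∈ posRoots) (hyU' : y' ∉ nonnegSpan (A ∪ B))
    (h1 : 0 ≤ h y) (h2 : h y' ≤ 0) : False := by
  have hNA : posRoots \ (A ∪ B) ⊆ posRoots \ A := fun r hr => ⟨hr.1, fun h => hr.2 (Or.inl h)⟩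
  have hNB : posRoots \ (A ∪ B) ⊆ posRoots \ B := fun r hr => ⟨hr.1, fun h => hr.2 (Or.inr h)⟩
  have hp0 : 0 ≤ p := nonneg_of_mem_nonnegSpan_posRoots hA.1.1 hp
  have hq0 : 0 ≤ q := nonneg_of_mem_nonnegSpan_posRoots hB.1.1 hq
  have hli := linearIndependent_of_mem hA hB hp hq hpq hne
  have hpne : p ≠ 0 := hli.ne_zero 0
  have hqne : q ≠ 0 := hli.ne_zero 1
  have hli' : LinearIndependent ℝ ![q, p] := by
    rw [LinearIndependent.pair_iff] at hli ⊢
    intro s t hst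
    exact (hli t s (by rw [add_comm]; exact hst)).symm
  have plane : ∀ e ∈ nonnegSpan (posRoots \ (A ∪ B)), h e = 0 →
      ∃ a b : ℝ, 0 ≤ a ∧ 0 ≤ b ∧ e = a • p + b • q := by
    intro e he hhe
    obtain ⟨a, b, hab⟩ := exists_pair_coords h0 hhp hhq hhe hli
    refine ⟨a, b, coord_nonneg hB hp0 hq hqne hpq hli he hab, ?_, hab⟩
    rw [Set.union_comm] at hpq he
    rw [add_comm] at hpq hab
    exact coord_nonneg hA hq0 hp hpne hpq hli' he hab
  have planeU : ∀ e ∈ nonnegSpan (posRoots \ (A ∪ B)), h e = 0 → e ∈ nonnegSpan (A ∪ B) := by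
    intro e he hhe
    obtain ⟨a, b, ha, hb, rfl⟩ := plane e he hhe
    exact comb_mem_nonnegSpan (nonnegSpan_mono Set.subset_union_left hp)
      (nonnegSpan_mono Set.subset_union_right hq) ha hb
  have mem_compl : ∀ y ∈ posRoots, y ∉ nonnegSpan (A ∪ B) →
      y ∈ nonnegSpan (posRoots \ (A ∪ B)) :=
    fun y hy hyU => subset_nonnegSpan ⟨hy, fun h => hyU (subset_nonnegSpan h)⟩
  have hS : Set.range simpleRoot \ (A ∪ B) ⊆ posRoots \ (A ∪ B) := by
    rintro _ ⟨⟨i, rfl⟩, hi⟩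
    exact ⟨simpleRoot_mem_posRoots i, hi⟩
  have simple_part : ∀ y ∈ posRoots, ∃ u ∈ nonnegSpan (A ∪ B),
      ∃ c ∈ nonnegSpan (Set.range simpleRoot \ (A ∪ B)), u + c = y := by
    intro y hy
    have : y ∈ nonnegSpan ((Set.range simpleRoot ∩ (A ∪ B)) ∪ (Set.range simpleRoot \ (A ∪ B))) := by
      rw [Set.inter_union_sdiff]
      exact hy.2
    obtain ⟨u, hu, c, hc, e⟩ := exists_add_of_mem_nonnegSpan_union this
    exact ⟨u, nonnegSpan_mono Set.inter_subset_right hu, c, hc, e⟩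
  -- Write `y = u + c` with `u` in the cone and `c` built from simple roots of the complement. If `h
  -- c ≤ 0`, a nonnegative combination of `y` and `c` lies on the plane, hence in the cone; adding a
  -- multiple of `u` gives a positive multiple of `y` there unless `h y = h c = 0`, when `y` itself
  -- is on the plane.
  have pos : ∀ h : V →ₗ[ℝ] ℝ, (∀ e ∈ nonnegSpan (posRoots \ (A ∪ B)), h e = 0 →
      e ∈ nonnegSpan (A ∪ B)) → ∀ y ∈ posRoots, y ∉ nonnegSpan (A ∪ B) → 0 ≤ h y →
      ∀ u ∈ nonnegSpan (A ∪ B), ∀ c ∈ nonnegSpan (Set.range simpleRoot \ (A ∪ B)), u + c = y →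
      0 < h c := by
    intro h planeU y hy hyU h1 u hu c hc e
    by_contra! hc0
    rcases (by linarith : 0 ≤ h y - h c).eq_or_lt with hz | hz
    · exact hyU (planeU y (mem_compl y hy hyU) (by linarith))
    · apply hyU
      have he1 : (-h c) • y + h y • c ∈ nonnegSpan (A ∪ B) := by
        refine planeU _ (comb_mem_nonnegSpan (mem_compl y hy hyU) (nonnegSpan_mono hS hc)
          (by linarith) h1) ?_
        simp only [map_add, map_smul, smul_eq_mul]
        ring
      have : y = (h y - h c)⁻¹ • (((-h c) • y + h y • c) + h y • u) := by
        have : ((-h c) • y + h y • c) + h y • u = (h y - h c) • y := by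
          rw [add_assoc, ← smul_add, add_comm c u, e]
          module
        rw [this, smul_smul, inv_mul_cancel₀ hz.ne', one_smul]
      rw [this]
      exact smul_mem_nonnegSpan (inv_nonneg.2 hz.le) (add_mem_nonnegSpan he1
        (smul_mem_nonnegSpan h1 hu))
  obtain ⟨u, hu, c, hc, e⟩ := simple_part y hy
  obtain ⟨u', hu', c', hc', e'⟩ := simple_part y' hy'
  have hcpos := pos h planeU y hy hyU h1 u hu c hc e
  have hcneg : 0 < (-h) c' := pos (-h) (fun e he hhe => planeU e he (by simpa using hhe)) y' hy' hyU'
    (by simpa using h2) u' hu' c' hc' e'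
  rw [LinearMap.neg_apply] at hcneg
  -- Balancing `c` and `c'` yields a nonzero vector on the plane, a combination of simple roots of
  -- the complement. Being `a p + b q` with `a, b ≥ 0`, it forces `p` or `q` into the cone of those
  -- simple roots.
  obtain ⟨z, hz⟩ : ∃ z, z = (-h c') • c + h c • c' := ⟨_, rfl⟩
  have hzS : z ∈ nonnegSpan (Set.range simpleRoot \ (A ∪ B)) :=
    hz ▸ comb_mem_nonnegSpan hc hc' hcneg.le hcpos.le
  have hS0 : ∀ {x}, x ∈ nonnegSpan (Set.range simpleRoot \ (A ∪ B)) → 0 ≤ x := fun hx =>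
    nonneg_of_mem_nonnegSpan_posRoots (fun r hr => (hS hr).1) hx
  have hz0 : z ≠ 0 := by
    intro h0
    have hc0 : c = 0 := by
      funext l
      have g := congrFun (hz.symm.trans h0) l
      have g1 : 0 ≤ c l := hS0 hc l
      have g2 : 0 ≤ c' l := hS0 hc' l
      simp only [Pi.add_apply, Pi.smul_apply, smul_eq_mul, Pi.zero_apply] at g ⊢
      have := mul_nonneg hcpos.le g2
      have g3 := mul_nonneg hcneg.le g1
      exact (mul_eq_zero.1 (by linarith : -h c' * c l = 0)).resolve_left hcneg.ne'
    rw [hc0, map_zero] at hcpos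
    exact lt_irrefl _ hcpos
  obtain ⟨a, b, ha, hb, hab⟩ := plane z (nonnegSpan_mono hS hzS) (by
    rw [hz]
    simp only [map_add, map_smul, smul_eq_mul]
    ring)
  have hle : ∀ l, z l = a * p l + b * q l := fun l => by rw [hab]; simp
  rcases ha.eq_or_lt with ha | ha
  · rcases hb.eq_or_lt with hb | hb
    · rw [← ha, ← hb] at hab
      exact hz0 (by rw [hab]; simp)
    · refine hqne (hB.eq_zero_of_subset (hS.trans hNB) hq (mem_nonnegSpan_simple hq0 hzS ?_))
      intro l hl
      rw [hle, ← ha, zero_mul, zero_add] at hl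
      exact (mul_eq_zero.1 hl).resolve_left hb.ne'
  · refine hpne (hA.eq_zero_of_subset (hS.trans hNA) hp (mem_nonnegSpan_simple hp0 hzS ?_))
    intro l hl
    rw [hle] at hl
    have g1 := mul_nonneg ha.le (hp0 l)
    have g2 := mul_nonneg hb (hq0 l)
    exact (mul_eq_zero.1 (by linarith : a * p l = 0)).resolve_left ha.ne'

/-- Coclosedness. If `r = p + q` were in the cone, a functional vanishing on `p` and `q` would
vanish on `r`, and so have opposite signs on `x` and `y` or vanish on one of them. -/
theorem comb_not_mem_nonnegSpan_union (hA : IsBiclosed A) (hB : IsBiclosed B) {x y r : V}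
    (hx : x ∈ posRoots) (hxU : x ∉ nonnegSpan (A ∪ B)) (hy : y ∈ posRoots)
    (hyU : y ∉ nonnegSpan (A ∪ B)) (hr : r ∈ posRoots) {a b : ℝ} (ha : 0 ≤ a) (hb : 0 ≤ b)
    (e : r = a • x + b • y) : r ∉ nonnegSpan (A ∪ B) := by
  intro hrU
  have hrN : r ∈ nonnegSpan (posRoots \ (A ∪ B)) := by
    rw [e]
    exact comb_mem_nonnegSpan (subset_nonnegSpan ⟨hx, fun h => hxU (subset_nonnegSpan h)⟩)
      (subset_nonnegSpan ⟨hy, fun h => hyU (subset_nonnegSpan h)⟩) ha hb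
  obtain ⟨p, hp, q, hq, rfl⟩ := exists_add_of_mem_nonnegSpan_union hrU
  have hlt : Submodule.span ℝ {p, q} < ⊤ := by
    rw [lt_top_iff_ne_top]
    intro htop
    have h1 := finrank_span_le_card (R := ℝ) ({p, q} : Set V)
    have h2 : ({p, q} : Set V).toFinset.card ≤ 2 := by
      rw [Set.toFinset_insert, Set.toFinset_singleton]
      exact Finset.card_le_two
    rw [htop, finrank_top] at h1
    simp at h1 h2
    omega
  obtain ⟨h, h0, hle⟩ := Submodule.exists_le_ker_of_lt_top _ hlt
  have hhp : h p = 0 := hle (Submodule.subset_span (by simp))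
  have hhq : h q = 0 := hle (Submodule.subset_span (by simp))
  have hne := ne_zero_of_mem_roots hr.1
  have hsum : a * h x + b * h y = 0 := by
    have := congrArg h e
    simp only [map_add, map_smul, smul_eq_mul, hhp, hhq] at this
    linarith
  have go : ∀ y y' : V, y ∈ posRoots → y ∉ nonnegSpan (A ∪ B) → y' ∈ posRoots →
      y' ∉ nonnegSpan (A ∪ B) → 0 ≤ h y → h y' ≤ 0 → False := fun y y' g1 g2 g3 g4 g5 g6 =>
    no_opposite_sides hA hB hp hq hrN hne h0 hhp hhq g1 g2 g3 g4 g5 g6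
  rcases ha.eq_or_lt with ha | ha
  · have hb0 : b ≠ 0 := by
      rintro rfl
      rw [← ha] at e
      exact hne (by rw [e]; simp)
    have : h y = 0 := by
      rw [← ha, zero_mul, zero_add] at hsum
      exact (mul_eq_zero.1 hsum).resolve_left hb0
    exact go y y hy hyU hy hyU this.ge this.le
  · rcases le_total 0 (h x) with hhx | hhx
    · rcases hb.eq_or_lt with hb | hb
      · have : h x = 0 := by
          rw [← hb, zero_mul, add_zero] at hsum
          exact (mul_eq_zero.1 hsum).resolve_left ha.ne'
        exact go x x hx hxU hx hxU this.ge this.le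
      · refine go x y hx hxU hy hyU hhx ?_
        by_contra! hc
        nlinarith [mul_nonneg ha.le hhx, mul_pos hb hc]
    · rcases hb.eq_or_lt with hb | hb
      · have : h x = 0 := by
          rw [← hb, zero_mul, add_zero] at hsum
          exact (mul_eq_zero.1 hsum).resolve_left ha.ne'
        exact go x x hx hxU hx hxU this.ge this.le
      · refine go y x hy hyU hx hxU ?_ hhx
        by_contra! hc
        nlinarith [mul_nonneg ha.le (neg_nonneg.2 hhx), mul_pos hb (neg_pos.2 hc)]

end Binary

/-! ### Cone roots lie in every closed set containing the union -/

/-- A member `u` of `U` that is a canonical generator of a plane through the root `η`. -/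
def IsGenerator (U : Set V) (η u : V) : Prop :=
  u ∈ U ∧ ∃ y ∈ posRoots, form u y ≤ -1 ∧ η ∈ Submodule.span ℝ {u, y} ∧
    (∀ r ∈ posRoots, r ∈ Submodule.span ℝ {u, y} → r ∈ nonnegSpan {u, y}) ∧ refl u η ∈ posRoots

theorem IsGenerator.mono {U U' : Set V} {η u : V} (h : IsGenerator U η u) (hU : U ⊆ U') :
    IsGenerator U' η u :=
  ⟨hU h.1, h.2⟩

theorem IsBiclosed.exists_generator {A : Set V} (hA : IsBiclosed A) {η a : V} (hη : η ∈ posRoots)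
    (hηA : η ∉ A) (ha : a ∈ A) :
    ∃ x, IsGenerator A η x ∧ ∃ s t : ℝ, 0 < s ∧ 0 ≤ t ∧ a = s • x + t • η := by
  obtain ⟨x, hx, y, hy, hxH, hxy, hb, hc, hr, s, t, hs, ht, e⟩ :=
    hA.halfSystem.exists_canonical (hA.1.1 ha) (Or.inl ha) hη (Or.inr (by simpa using ⟨hη, hηA⟩))
  have hxA : x ∈ A := hxH.resolve_right fun h => not_neg_mem_posRoots hx h.1
  refine ⟨x, ⟨hxA, y, hy, hxy, hb, hc, hr⟩, s, t, lt_of_le_of_ne hs ?_, ht, e⟩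
  rintro rfl
  rw [zero_smul, zero_add] at e
  exact hηA (eq_of_smul_mem_posRoots hη (hA.1.1 ha) e ▸ ha)

/-- Each member of `A ∪ B` is a generator plus a nonnegative multiple of `η`. Collecting these gives
`η = z + r η` with `z` nonzero and nonnegative, so `r < 1` and `η` is a multiple of `z`. -/
theorem mem_nonnegSpan_generators {A B : Set V} (hA : IsBiclosed A) (hB : IsBiclosed B) {η : V}
    (hη : η ∈ posRoots) (hηN : η ∉ A ∪ B) (hηU : η ∈ nonnegSpan (A ∪ B)) :
    η ∈ nonnegSpan {u | IsGenerator (A ∪ B) η u} := by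
  have hG : {u | IsGenerator (A ∪ B) η u} ⊆ posRoots := fun u hu => hu.1.elim
    (fun h => hA.1.1 h) (fun h => hB.1.1 h)
  have key : η = 0 ∨ ∃ z ∈ nonnegSpan {u | IsGenerator (A ∪ B) η u}, z ≠ 0 ∧
      ∃ r : ℝ, 0 ≤ r ∧ η = z + r • η := by
    refine nonnegSpan_induction (p := fun x => x = 0 ∨
      ∃ z ∈ nonnegSpan {u | IsGenerator (A ∪ B) η u}, z ≠ 0 ∧ ∃ r : ℝ, 0 ≤ r ∧ x = z + r • η)
      ?_ (Or.inl rfl) ?_ ?_ hηU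
    · intro u hu
      right
      have : ∃ x, IsGenerator (A ∪ B) η x ∧ ∃ s t : ℝ, 0 < s ∧ 0 ≤ t ∧ u = s • x + t • η := by
        rcases hu with hu | hu
        · obtain ⟨x, hx, h⟩ := hA.exists_generator hη (fun h => hηN (Or.inl h)) hu
          exact ⟨x, hx.mono Set.subset_union_left, h⟩
        · obtain ⟨x, hx, h⟩ := hB.exists_generator hη (fun h => hηN (Or.inr h)) hu
          exact ⟨x, hx.mono Set.subset_union_right, h⟩
      obtain ⟨x, hx, s, t, hs, ht, e⟩ := this
      exact ⟨s • x, smul_mem_nonnegSpan hs.le (subset_nonnegSpan hx),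
        smul_ne_zero hs.ne' (ne_zero_of_mem_roots (hG hx).1), t, ht, e⟩
    · rintro x y - - (rfl | ⟨z, hz, hz0, r, hr, rfl⟩) hy
      · simpa using hy
      rcases hy with rfl | ⟨z', hz', hz0', r', hr', rfl⟩
      · exact Or.inr ⟨z, hz, hz0, r, hr, add_zero _⟩
      refine Or.inr ⟨z + z', add_mem_nonnegSpan hz hz', ?_, r + r', add_nonneg hr hr', by module⟩
      intro h0
      apply hz0
      have h1 := nonneg_of_mem_nonnegSpan_posRoots hG hz
      have h2 := nonneg_of_mem_nonnegSpan_posRoots hG hz'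
      refine le_antisymm ?_ h1
      rw [eq_neg_of_add_eq_zero_left h0]
      simpa using h2
    · rintro c x hc - (rfl | ⟨z, hz, hz0, r, hr, rfl⟩)
      · exact Or.inl (smul_zero c)
      rcases hc.eq_or_lt with rfl | hc
      · exact Or.inl (zero_smul _ _)
      · exact Or.inr ⟨c • z, smul_mem_nonnegSpan hc.le hz, smul_ne_zero hc.ne' hz0, c * r,
          by positivity, by module⟩
  obtain ⟨z, hz, hz0, r, hr, e⟩ := key.resolve_left (ne_zero_of_mem_roots hη.1)
  have e' : z = (1 - r) • η := by
    linear_combination (norm := module) -e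
  have hz1 := nonneg_of_mem_nonnegSpan_posRoots hG hz
  have hr1 : 0 < 1 - r := by
    by_contra! hc
    refine hz0 (le_antisymm (fun l => ?_) hz1)
    have := posRoots_nonneg hη l
    rw [e']
    simp only [Pi.zero_apply, Pi.smul_apply, smul_eq_mul] at *
    nlinarith
  have := smul_mem_nonnegSpan (inv_nonneg.2 hr1.le) hz
  rwa [e', smul_smul, inv_mul_cancel₀ hr1.ne', one_smul] at this

theorem refl_neg (a x : V) : refl (-a) x = refl a x := by
  simp [refl_apply]

/-- Cramer's rule in the fan plane. When the determinant vanishes, `(u i - u k) ^ 2 = 1` exhibits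
`y` as a multiple of `u`. -/
theorem Triple.simpleRoot_mem_span {i k l : Fin 3} (d : Triple i k l) {u y : V} (hu : u ∈ roots)
    (hul : u l = 0) (hyl : y l = 0) (h : ∀ c : ℝ, y ≠ c • u) :
    simpleRoot k ∈ Submodule.span ℝ {u, y} := by
  have f1 := form_self_of_mem_roots hu
  rw [d.form_eq, hul] at f1
  by_cases hD : u i * y k - u k * y i = 0
  · refine absurd ?_ (h ((u i - u k) * (y i - y k)))
    apply d.ext
    · simp only [Pi.smul_apply, smul_eq_mul]
      linear_combination (-(y i)) * f1 + (u i - u k) * hD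
    · simp only [Pi.smul_apply, smul_eq_mul]
      linear_combination (-(y k)) * f1 + (u i - u k) * hD
    · simp [hul, hyl]
  · refine Submodule.mem_span_pair.2 ⟨-(y i) / (u i * y k - u k * y i),
      u i / (u i * y k - u k * y i), ?_⟩
    apply d.ext
    · simp only [Pi.add_apply, Pi.smul_apply, smul_eq_mul, simpleRoot_ne d.ij]
      field_simp
      ring
    · simp only [Pi.add_apply, Pi.smul_apply, smul_eq_mul, simpleRoot_same]
      rw [div_mul_eq_mul_div, div_mul_eq_mul_div, ← add_div, div_eq_one_iff_eq hD]
      ring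
    · simp [hul, hyl, simpleRoot_ne d.jk.symm]

theorem map_mem_span_pair {u y x : V} (g : V →ₗ[ℝ] V) (h : x ∈ Submodule.span ℝ {u, y}) :
    g x ∈ Submodule.span ℝ {g u, g y} := by
  obtain ⟨a, b, rfl⟩ := Submodule.mem_span_pair.1 h
  exact Submodule.mem_span_pair.2 ⟨a, b, by simp⟩

section Binary

variable {A B C : Set V}

/-- If a root `η` of the cone of `A ∪ B` is missing from a closed set `C`, then the ray from `η` in
the direction of a simple root of its fan outside that cone leaves the cone at a point whose
product with `η` is negative. -/
theorem exists_form_neg (hA : IsBiclosed A) (hB : IsBiclosed B) (hC : IsClosedRoots C)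
    (hUC : A ∪ B ⊆ C) {w : List (Fin 3)} {f : V} {i k l : Fin 3} (d : Triple i k l)
    (hfl : f l = 0) (hη : act w f ∈ posRoots)
    (hηU : act w f ∈ nonnegSpan (A ∪ B)) (hηC : act w f ∉ C)
    (hδ : act w (simpleRoot k) ∈ posRoots) (hδU : act w (simpleRoot k) ∉ nonnegSpan (A ∪ B))
    (hf : f ∈ fans)
    (ih : ∀ w' : List (Fin 3), w'.length < w.length → ∀ g ∈ fans, act w' g ∈ posRoots →
      act w' g ∈ nonnegSpan (A ∪ B) → act w' g ∈ C) :
    ∃ t : ℝ, 0 ≤ t ∧ act w f + t • act w (simpleRoot k) ∈ nonnegSpan (A ∪ B) ∧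
      form (act w f) (act w f + t • act w (simpleRoot k)) < 0 := by
  have hU : A ∪ B ⊆ posRoots := Set.union_subset hA.1.1 hB.1.1
  obtain ⟨η, eη⟩ : ∃ η, η = act w f := ⟨_, rfl⟩
  obtain ⟨δ, eδ⟩ : ∃ δ, δ = act w (simpleRoot k) := ⟨_, rfl⟩
  rw [← eη] at hη hηU hηC ⊢
  rw [← eδ] at hδ hδU ⊢
  obtain ⟨L, hL, hηL⟩ := exists_list_of_mem_nonnegSpan
    (mem_nonnegSpan_generators hA hB hη (fun h => hηC (hUC h)) hηU)
  have hLU : {x | x ∈ L} ⊆ A ∪ B := fun x hx => (hL x hx).1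
  obtain ⟨t, ht, htL, h, hh, hδneg, h0⟩ := exists_exit L hηL
    (fun hc => hδU (nonnegSpan_mono hLU hc))
  refine ⟨t, ht, nonnegSpan_mono hLU htL, ?_⟩
  have htight := mem_nonnegSpan_tight hh htL h0
  have hne : η + t • δ ≠ 0 := by
    intro hz
    refine not_nonneg_and_nonpos_of_mem_roots hη.1 (posRoots_nonneg hη) ?_
    rw [eq_neg_of_add_eq_zero_left hz]
    simpa using smul_nonneg ht (posRoots_nonneg hδ)
  -- The exit point is a combination of the generators tight for `h`, so it suffices that each of
  -- these has negative product with `η`.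
  have key : ∀ u ∈ L, h u = 0 → form η u ≤ -1 := by
    intro u huL hu0
    obtain ⟨huU, y, hy, huy, hηs, hcan, hx⟩ := hL u huL
    have hu := hU huU
    refine (form_le_neg_one_or_one_le hη.1 hu.1).resolve_right fun hηu => ?_
    obtain ⟨p, q, hp, hq, e⟩ := mem_nonnegSpan_pair.1 (hcan η hη hηs)
    have hηu' : η ≠ u := fun e => hηC (e ▸ hUC huU)
    have hq0 : 0 < q := by
      refine lt_of_le_of_ne hq ?_
      rintro rfl
      rw [zero_smul, add_zero] at e
      exact hηu' (eq_of_smul_mem_posRoots hu hη e)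
    have hκ : 1 ≤ form u η := by rwa [form_comm]
    have hback : η = (1 : ℝ) • refl u η + (2 * form u η) • u := by rw [refl_apply]; module
    by_cases hyU : y ∈ nonnegSpan (A ∪ B)
    · have hsub : nonnegSpan {u, y} ⊆ nonnegSpan (A ∪ B) := by
        refine nonnegSpan_subset ?_
        rintro x (rfl | rfl)
        · exact subset_nonnegSpan huU
        · exact hyU
      have hxs : refl u η ∈ Submodule.span ℝ {u, y} := by
        rw [refl_apply]
        exact Submodule.sub_mem _ hηs (Submodule.smul_mem _ _ (Submodule.subset_span (by simp)))
      -- The whole plane of `u` and `y` is now in the cone. If `w⁻¹ u` is positive, the light cone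
      -- puts the plane inside the moved fan, so `δ` would be in the cone; if it is negative, the
      -- exchange condition makes `refl u η` accessible to the induction.
      rcases nonneg_or_nonpos_of_mem_roots (act_mem_roots w.reverse hu.1) with hpos | hneg
      · have hfw : Forward (η - u) := by
          refine (forward_sub_or_sub hu.1 hη.1 hκ hηu'.symm).resolve_right fun hfw => ?_
          refine hfw.2.2 (le_antisymm (fun l => ?_) hfw.2.1)
          have g1 := posRoots_nonneg hx l
          have g2 := posRoots_nonneg hu l
          have g3 := congrFun hback l
          simp only [Pi.zero_apply, Pi.sub_apply, Pi.add_apply, Pi.smul_apply, smul_eq_mul] at *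
          nlinarith
        have hfw' := (hfw.act w.reverse).2.1 l
        rw [map_sub, eη, act_reverse_act] at hfw'
        have hul : act w.reverse u l = 0 := by
          have g := hpos l
          simp only [Pi.sub_apply, Pi.zero_apply, hfl] at *
          linarith
        have hyl : act w.reverse y l = 0 := by
          have g := congrFun (congrArg (act w.reverse) (eη.symm.trans e)) l
          rw [act_reverse_act] at g
          simp only [map_add, map_smul, Pi.add_apply, Pi.smul_apply, smul_eq_mul, hfl, hul,
            mul_zero, zero_add] at g
          exact (mul_eq_zero.1 g.symm).resolve_left hq0.ne'
        have hspan := d.simpleRoot_mem_span (act_mem_roots w.reverse hu.1) hul hyl (by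
            intro c hc
            have hc' := congrArg (act w) hc
            rw [map_smul, act_act_reverse, act_act_reverse] at hc'
            rw [eq_of_smul_mem_posRoots hu hy hc', form_self_of_mem_roots hu.1] at huy
            norm_num at huy)
        have hspan' := map_mem_span_pair (act w).toLinearMap hspan
        simp only [LinearEquiv.coe_coe, act_act_reverse, ← eδ] at hspan'
        exact hδU (hsub (hcan δ hδ hspan'))
      · obtain ⟨w', hw', he⟩ := exists_shorter hu hneg
        have hxC : refl u η ∈ C := by
          have g := ih w' hw' f hf
          rw [← he, ← eη] at g
          exact g hx (hsub (hcan _ hx hxs))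
        exact hηC (hC.comb_mem hxC (hUC huU) hη zero_le_one (by linarith) hback)
    -- If `y` is outside the cone, `y` and `δ` are outside roots on opposite sides of the supporting
    -- plane, which meets the cones of `A` and `B` in summands of the exit point.
    · have hsplit : {s | s ∈ {x | x ∈ L} ∧ h s = 0} ⊆
          {s | s ∈ A ∧ h s = 0} ∪ {s | s ∈ B ∧ h s = 0} := by
        rintro s ⟨hs, hs0⟩
        exact (hLU hs).imp (fun g => ⟨g, hs0⟩) fun g => ⟨g, hs0⟩
      obtain ⟨p', hp', q', hq', epq⟩ :=
        exists_add_of_mem_nonnegSpan_union (nonnegSpan_mono hsplit htight)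
      have hmem : p' + q' ∈ nonnegSpan (posRoots \ (A ∪ B)) := by
        rw [epq]
        exact add_mem_nonnegSpan (subset_nonnegSpan ⟨hη, fun g => hηC (hUC g)⟩)
          (smul_mem_nonnegSpan ht (subset_nonnegSpan ⟨hδ, fun g => hδU (subset_nonnegSpan g)⟩))
      refine no_opposite_sides hA hB (nonnegSpan_mono (fun s hs => hs.1) hp')
        (nonnegSpan_mono (fun s hs => hs.1) hq') hmem (epq ▸ hne) (h := h)
        (fun hz => by rw [hz] at hδneg; simp at hδneg)
        (eq_zero_of_mem_nonnegSpan_eq_zero (fun s hs => hs.2) hp')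
        (eq_zero_of_mem_nonnegSpan_eq_zero (fun s hs => hs.2) hq') hy hyU hδ hδU ?_ hδneg.le
      have g1 := congrArg h e
      simp only [map_add, map_smul, smul_eq_mul, hu0, mul_zero, zero_add] at g1 h0
      have g2 : 0 ≤ q * h y := by
        rw [← g1]
        nlinarith [mul_nonneg ht (neg_nonneg.2 hδneg.le)]
      exact nonneg_of_mul_nonneg_right g2 hq0
  have hfin : ∀ x ∈ nonnegSpan {s | s ∈ {x | x ∈ L} ∧ h s = 0}, x = 0 ∨ form η x < 0 := by
    intro x hx
    refine nonnegSpan_induction (p := fun x => x = 0 ∨ form η x < 0) ?_ (Or.inl rfl) ?_ ?_ hx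
    · rintro u ⟨hu, hu0⟩
      right
      linarith [key u hu hu0]
    · rintro x y - - (rfl | hx) hy
      · simpa using hy
      rcases hy with rfl | hy
      · right
        simpa using hx
      · right
        rw [map_add]
        linarith
    · rintro c x hc - (rfl | hx)
      · exact Or.inl (smul_zero c)
      rcases hc.eq_or_lt with rfl | hc
      · exact Or.inl (zero_smul _ _)
      · right
        rw [map_smul, smul_eq_mul]
        exact mul_neg_of_pos_of_neg hc hx
  exact (hfin _ htight).resolve_left hne

/-- Applying `s_k s_i` raises `m` by one. -/
theorem Triple.fan_root {i k l : Fin 3} (d : Triple i k l) (m : ℕ) :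
    ((2 * m : ℝ) • simpleRoot i + (2 * m + 1 : ℝ) • simpleRoot k : V) ∈ roots := by
  induction m with
  | zero => simpa using simpleRoot_mem_roots k
  | succ m ih =>
    have := simpleReflection_mem_roots k (simpleReflection_mem_roots i ih)
    convert this using 1
    have e1 : ∀ a b : ℝ, simpleReflection i (a • simpleRoot i + b • simpleRoot k) =
        (2 * b - a) • simpleRoot i + b • simpleRoot k := by
      intro a b
      simp [simpleReflection_apply, form_simpleRoot, d.ij]
      module
    have e2 : ∀ a b : ℝ, simpleReflection k (a • simpleRoot i + b • simpleRoot k) =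
        a • simpleRoot i + (2 * a - b) • simpleRoot k := by
      intro a b
      simp [simpleReflection_apply, form_simpleRoot, d.ij.symm]
      module
    rw [e1, e2]
    push_cast
    congr 2 <;> ring

/-- Fan roots satisfy `g k - g i = 1` or `-1`. In the first case the product from `exists_form_neg`
is `1 + t > 0`, a contradiction. In the second it is `1 - t`, so `t > 1`; then the cone contains a
far fan root of the first kind, and this root with `α_i` generates `f`. -/
theorem mem_of_mixed (hA : IsBiclosed A) (hB : IsBiclosed B) (hC : IsClosedRoots C)
    (hUC : A ∪ B ⊆ C) {w : List (Fin 3)} {f : V} {i k l : Fin 3} (d : Triple i k l)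
    (hf : f ∈ roots) (hfl : f l = 0) (hfk : 0 ≤ f k) (hη : act w f ∈ posRoots)
    (hηU : act w f ∈ nonnegSpan (A ∪ B)) (hi : act w (simpleRoot i) ∈ C)
    (hδ : act w (simpleRoot k) ∈ posRoots) (hδU : act w (simpleRoot k) ∉ nonnegSpan (A ∪ B))
    (ih : ∀ w' : List (Fin 3), w'.length < w.length → ∀ g ∈ fans, act w' g ∈ posRoots →
      act w' g ∈ nonnegSpan (A ∪ B) → act w' g ∈ C) : act w f ∈ C := by
  have form_val : ∀ g : V, g ∈ roots → g l = 0 → ∀ t : ℝ,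
      form (act w g) (act w g + t • act w (simpleRoot k)) = 1 + t * (g k - g i) := by
    intro g hg hgl t
    rw [map_add, map_smul, form_act, form_act, form_self_of_mem_roots hg, form_comm,
      d.rotate.rotate.form_simpleRoot_left, hgl, smul_eq_mul]
    ring
  have up : ∀ g : V, g ∈ roots → g l = 0 → g k - g i = 1 → act w g ∈ posRoots →
      act w g ∈ nonnegSpan (A ∪ B) → act w g ∈ C := by
    intro g hg hgl hgki hpos hgU
    by_contra hgC
    obtain ⟨t, ht, -, hneg⟩ := exists_form_neg hA hB hC hUC d hgl hpos hgU hgC hδ hδU ⟨hg, l, hgl⟩ ih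
    rw [form_val g hg hgl, hgki] at hneg
    linarith
  have hdiff : (f k - f i - 1) * (f k - f i + 1) = 0 := by
    have := form_self_of_mem_roots hf
    rw [d.form_eq, hfl] at this
    linarith
  rcases mul_eq_zero.1 hdiff with hd | hd
  · exact up f hf hfl (by linarith) hη hηU
  by_contra hηC
  obtain ⟨t, ht, htU, hneg⟩ :=
    exists_form_neg hA hB hC hUC d hfl hη hηU hηC hδ hδU ⟨hf, l, hfl⟩ ih
  have hki : f i = f k + 1 := by linarith
  rw [form_val f hf hfl, hki] at hneg
  have ht1 : 0 < t - 1 := by linarith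
  -- The roots `g` of `fan_root` approach the direction `α_i + α_k`, which for `t > 1` lies between
  -- `f` and `f + t • α_k`; this `m` makes the coefficient of `f` nonnegative.
  obtain ⟨m, hm⟩ := exists_nat_gt ((f k + 1) / (t - 1))
  rw [div_lt_iff₀ ht1] at hm
  set g : V := (2 * m : ℝ) • simpleRoot i + (2 * m + 1 : ℝ) • simpleRoot k with hg
  have hm0 : (0 : ℝ) ≤ m := Nat.cast_nonneg m
  have hgr : g ∈ roots := d.fan_root m
  have hgi : g i = 2 * m := by simp [hg, simpleRoot_ne d.ij]
  have hgk : g k = 2 * m + 1 := by simp [hg, simpleRoot_ne d.ij.symm]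
  have hgl : g l = 0 := by simp [hg, simpleRoot_ne d.ik.symm, simpleRoot_ne d.jk.symm]
  have hiP : act w (simpleRoot i) ∈ posRoots := hC.1 hi
  have hgpos : act w g ∈ posRoots := by
    refine mem_posRoots.2 ⟨act_mem_roots w hgr, ?_⟩
    rw [hg, map_add, map_smul, map_smul]
    exact add_nonneg (smul_nonneg (by positivity) (posRoots_nonneg hiP))
      (smul_nonneg (by positivity) (posRoots_nonneg hδ))
  have ht0 : 0 < t := by linarith
  have hk1 : 0 < f k + 1 := by linarith
  have hgU : act w g ∈ nonnegSpan (A ∪ B) := by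
    have e : g = ((2 * m * t - 2 * m - f k - 1) / ((f k + 1) * t)) • f +
        ((2 * m + f k + 1) / ((f k + 1) * t)) • (f + t • simpleRoot k) := by
      apply d.ext
      · simp only [Pi.add_apply, Pi.smul_apply, smul_eq_mul, hgi, simpleRoot_ne d.ij, hki]
        field_simp
        ring
      · simp only [Pi.add_apply, Pi.smul_apply, smul_eq_mul, hgk, simpleRoot_same]
        field_simp
        ring
      · simp [hgl, hfl, simpleRoot_ne d.jk.symm]
    rw [e, map_add, map_smul, map_smul, map_add, map_smul]
    refine comb_mem_nonnegSpan hηU htU (div_nonneg ?_ (by positivity)) (by positivity)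
    nlinarith
  have hgC := up g hgr hgl (by rw [hgi, hgk]; ring) hgpos hgU
  refine hηC (hC.comb_mem hi hgC hη (s := f k + 1 - f k / (2 * m + 1) * (2 * m))
    (t := f k / (2 * m + 1)) ?_ (by positivity) ?_)
  · have : f k / (2 * m + 1) * (2 * m) ≤ f k := by
      rw [div_mul_eq_mul_div, div_le_iff₀ (by positivity)]
      nlinarith
    linarith
  · rw [← map_smul, ← map_smul, ← map_add]
    congr 1
    apply d.ext
    · simp only [Pi.add_apply, Pi.smul_apply, smul_eq_mul, hgi, simpleRoot_same, hki]
      ring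
    · simp only [Pi.add_apply, Pi.smul_apply, smul_eq_mul, hgk, simpleRoot_ne d.ij.symm]
      field_simp
      ring
    · simp [hgl, hfl, simpleRoot_ne d.ik.symm]

theorem act_mem_closed_aux (hA : IsBiclosed A) (hB : IsBiclosed B) (hC : IsClosedRoots C)
    (hUC : A ∪ B ⊆ C) (n : ℕ) : ∀ w : List (Fin 3), w.length = n → ∀ f ∈ fans,
    act w f ∈ posRoots → act w f ∈ nonnegSpan (A ∪ B) → act w f ∈ C := by
  have hU : A ∪ B ⊆ posRoots := Set.union_subset hA.1.1 hB.1.1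
  induction n using Nat.strong_induction_on with
  | _ n ih =>
  intro w hw f hf hη hηU
  have ih' : ∀ w' : List (Fin 3), w'.length < w.length → ∀ g ∈ fans, act w' g ∈ posRoots →
      act w' g ∈ nonnegSpan (A ∪ B) → act w' g ∈ C := fun w' hw' => ih _ (hw ▸ hw') w' rfl
  obtain ⟨hfr, l, hfl⟩ := hf
  obtain ⟨i, k, d⟩ := Triple.exists_last l
  -- When `w α_i` is negative, exchange gives a shorter `w'` with `w f = w' (s_i f)`, and `s_i f`
  -- stays on the same fan.
  have shorten : ∀ i, i ≠ l → -act w (simpleRoot i) ∈ posRoots → act w f ∈ C := by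
    intro i hil hn
    obtain ⟨w', hw', he⟩ := exists_shorter (w := w) hn (by
      rw [map_neg, act_reverse_act]
      simpa using simpleRoot_nonneg i)
    have h1 := he (simpleReflection i f)
    rw [refl_neg, ← refl_simpleRoot, act_refl, refl_refl
      (act_mem_roots w (simpleRoot_mem_roots i))] at h1
    rw [h1] at hη hηU ⊢
    refine ih' w' hw' _ ⟨?_, l, ?_⟩ hη hηU
    · rw [refl_simpleRoot]
      exact simpleReflection_mem_roots i hfr
    · rw [refl_simpleRoot, simpleReflection_ne hil.symm, hfl]
  rcases mem_posRoots_or_neg_mem (act_mem_roots w (simpleRoot_mem_roots i)) with hi | hi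
  swap
  · exact shorten i d.ik hi
  rcases mem_posRoots_or_neg_mem (act_mem_roots w (simpleRoot_mem_roots k)) with hk | hk
  swap
  · exact shorten k d.jk hk
  have hf2 := d.eq_combination hfl
  have hη2 : act w f = f i • act w (simpleRoot i) + f k • act w (simpleRoot k) := by
    conv_lhs => rw [hf2]
    simp
  have hf0 : 0 ≤ f := by
    refine (nonneg_or_nonpos_of_mem_roots hfr).resolve_right fun hle => ?_
    refine not_nonneg_and_nonpos_of_mem_roots hη.1 (posRoots_nonneg hη) ?_
    rw [hη2]
    exact add_nonpos (smul_nonpos_of_nonpos_of_nonneg (hle i) (posRoots_nonneg hi))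
      (smul_nonpos_of_nonpos_of_nonneg (hle k) (posRoots_nonneg hk))
  -- The last letter of `w` can be absorbed into the simple root, because `s_n α_m` still has a
  -- vanishing coordinate. For the empty word, extremality of the simple roots applies.
  have simple_mem : ∀ m, act w (simpleRoot m) ∈ posRoots →
      act w (simpleRoot m) ∈ nonnegSpan (A ∪ B) → act w (simpleRoot m) ∈ C := by
    intro m hm hmU
    rcases List.eq_nil_or_concat w with rfl | ⟨v, n, rfl⟩
    · exact hUC (simpleRoot_mem_of_mem_nonnegSpan hU hmU)
    · rw [List.concat_eq_append] at *
      have e : act (v ++ [n]) (simpleRoot m) = act v (simpleReflection n (simpleRoot m)) := by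
        rw [act_append]
        simp
      rw [e] at hm hmU ⊢
      refine ih' v (by simp) _ ⟨simpleReflection_mem_roots n (simpleRoot_mem_roots m), ?_⟩ hm hmU
      obtain ⟨a, b, dm⟩ := Triple.exists_last m
      by_cases han : a = n
      · exact ⟨b, by rw [simpleReflection_ne (han ▸ dm.ij.symm), simpleRoot_ne dm.jk]⟩
      · exact ⟨a, by rw [simpleReflection_ne han, simpleRoot_ne dm.ik]⟩
  by_cases hiU : act w (simpleRoot i) ∈ nonnegSpan (A ∪ B)
  · by_cases hkU : act w (simpleRoot k) ∈ nonnegSpan (A ∪ B)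
    · exact hC.comb_mem (simple_mem i hi hiU) (simple_mem k hk hkU) hη (hf0 i) (hf0 k) hη2
    · exact mem_of_mixed hA hB hC hUC d hfr hfl (hf0 k) hη hηU (simple_mem i hi hiU) hk hkU
        ih'
  · by_cases hkU : act w (simpleRoot k) ∈ nonnegSpan (A ∪ B)
    · exact mem_of_mixed hA hB hC hUC d.swap hfr hfl (hf0 i) hη hηU (simple_mem k hk hkU)
        hi hiU ih'
    · exact absurd hηU (comb_not_mem_nonnegSpan_union hA hB hi hiU hk hkU hη (hf0 i) (hf0 k) hη2)

/-- The 2-closure of the union of two biclosed sets consists of the positive roots in its cone. -/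
theorem IsBiclosed.isTwoClosure_union (hA : IsBiclosed A) (hB : IsBiclosed B) :
    IsBiclosed (posRoots ∩ nonnegSpan (A ∪ B)) ∧
      IsTwoClosure (A ∪ B) (posRoots ∩ nonnegSpan (A ∪ B)) := by
  have hcl : IsClosedRoots (posRoots ∩ nonnegSpan (A ∪ B)) := by
    refine ⟨Set.inter_subset_left, fun x hx y hy r hr => ⟨hr.2, nonnegSpan_subset ?_ hr.1⟩⟩
    rintro z (rfl | rfl)
    · exact hx.2
    · exact hy.2
  refine ⟨⟨hcl, Set.sdiff_subset, ?_⟩, ⟨hcl, ?_⟩, ?_⟩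
  · intro x hx y hy r hr
    obtain ⟨s, t, hs, ht, e⟩ := mem_nonnegSpan_pair.1 hr.1
    exact ⟨hr.2, fun h => comb_not_mem_nonnegSpan_union hA hB hx.1 (fun g => hx.2 ⟨hx.1, g⟩) hy.1
      (fun g => hy.2 ⟨hy.1, g⟩) hr.2 hs ht e h.2⟩
  · exact Set.subset_inter (Set.union_subset hA.1.1 hB.1.1) subset_nonnegSpan
  · rintro C ⟨hC, hUC⟩ r ⟨hr, hrU⟩
    obtain ⟨w, i, rfl⟩ := mem_roots.1 hr.1
    exact act_mem_closed_aux hA hB hC hUC _ w rfl _ (simpleRoot_mem_fans i) hr hrU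

end Binary

/-! ### Finite and arbitrary joins -/

theorem isClosedRoots_empty : IsClosedRoots ∅ :=
  ⟨Set.empty_subset _, fun _ h => h.elim⟩

theorem isBiclosed_empty : IsBiclosed ∅ := by
  refine ⟨isClosedRoots_empty, ?_⟩
  rw [Set.sdiff_empty]
  exact ⟨subset_rfl, fun _ _ _ _ _ h => h.2⟩

theorem exists_finite_join {ι : Type*} (R : ι → ExtendedWeakOrder) (S : Finset ι) :
    ∃ J : Set V, IsBiclosed J ∧ IsTwoClosure (⋃ i ∈ S, (R i : Set V)) J := by
  classical
  induction S using Finset.induction_on with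
  | empty =>
    refine ⟨∅, isBiclosed_empty, ⟨isClosedRoots_empty, by simp⟩, fun D _ => Set.empty_subset D⟩
  | insert i S _ ih =>
    obtain ⟨J, hJ, hcl⟩ := ih
    obtain ⟨hG, hGcl⟩ := (R i).2.isTwoClosure_union hJ
    refine ⟨_, hG, ⟨hG.1, ?_⟩, ?_⟩
    · rw [Finset.set_biUnion_insert]
      exact (Set.union_subset_union_right _ hcl.1.2).trans hGcl.1.2
    · rintro D ⟨hD, hsub⟩
      rw [Finset.set_biUnion_insert, Set.union_subset_iff] at hsub
      exact hGcl.2 ⟨hD, Set.union_subset hsub.1 (hcl.2 ⟨hD, hsub.2⟩)⟩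

/-- The finite joins form a directed family. Closedness passes to its union because any two members
occur in a common finite join; closedness of the complement passes because a root of the union
occurs in one finite join, whose complement contains the complement of the union. -/
theorem exists_join {ι : Type*} (R : ι → ExtendedWeakOrder) :
    ∃ J : Set V, IsBiclosed J ∧ IsTwoClosure (⋃ i, (R i : Set V)) J := by
  classical
  choose J hJ hcl using exists_finite_join R
  have mono : ∀ S T : Finset ι, S ⊆ T → J S ⊆ J T := fun S T hST =>
    (hcl S).2 ⟨(hJ T).1, (Set.biUnion_subset_biUnion_left hST).trans (hcl T).1.2⟩
  have hclosed : IsClosedRoots (⋃ S, J S) := by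
    refine ⟨Set.iUnion_subset fun S => (hJ S).1.1, fun x hx y hy r hr => ?_⟩
    obtain ⟨S, hS⟩ := Set.mem_iUnion.1 hx
    obtain ⟨T, hT⟩ := Set.mem_iUnion.1 hy
    exact Set.mem_iUnion.2 ⟨S ∪ T, (hJ (S ∪ T)).1.2 x (mono _ _ Finset.subset_union_left hS) y
      (mono _ _ Finset.subset_union_right hT) hr⟩
  refine ⟨⋃ S, J S, ⟨hclosed, Set.sdiff_subset, fun x hx y hy r hr => ⟨hr.2, fun hrJ => ?_⟩⟩,
    ⟨hclosed, ?_⟩, ?_⟩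
  · obtain ⟨S, hS⟩ := Set.mem_iUnion.1 hrJ
    exact ((hJ S).2.2 x ⟨hx.1, fun h => hx.2 (Set.mem_iUnion.2 ⟨S, h⟩)⟩ y
      ⟨hy.1, fun h => hy.2 (Set.mem_iUnion.2 ⟨S, h⟩)⟩ hr).2 hS
  · refine Set.iUnion_subset fun i => Set.Subset.trans ?_ (Set.subset_iUnion J {i})
    simpa using (hcl {i}).1.2
  · rintro D ⟨hD, hsub⟩
    refine Set.iUnion_subset fun S => (hcl S).2 ⟨hD, ?_⟩
    exact Set.iUnion₂_subset fun i _ => (Set.subset_iUnion _ i).trans hsub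

end UniversalCoxeter

end

/-- Every family of biclosed sets of positive roots for `U3` has a join in the extended weak order,
and this join is the 2-closure of the union of the family. -/
theorem theoremB {ι : Type*} (R : ι → UniversalCoxeter.ExtendedWeakOrder) :
    ∃ J : UniversalCoxeter.ExtendedWeakOrder,
      IsLUB (Set.range R) J ∧
        UniversalCoxeter.IsTwoClosure (⋃ i, (R i : Set UniversalCoxeter.V))
          (J : Set UniversalCoxeter.V) := by
  obtain ⟨J, hJ, hcl⟩ := UniversalCoxeter.exists_join R
  refine ⟨⟨J, hJ⟩, ⟨?_, fun D hD => ?_⟩, hcl⟩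
  · rintro _ ⟨i, rfl⟩
    exact (Set.subset_iUnion (fun i => (R i : Set UniversalCoxeter.V)) i).trans hcl.1.2
  · exact hcl.2 ⟨D.2.1, Set.iUnion_subset fun i => hD ⟨i, rfl⟩⟩
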